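/- Let $0<q<1$ and $0<\alpha\le 1$ be real numbers. For $n\ge 0$ put $m=\lfloor \alpha n\rfloor$ and consider the random directed bipartite graph $G$ on disjoint vertex sets $V_1,V_2$ with $|V_1|=n$, $|V_2|=m$, in which each of the $2nm$ possible arcs $u\to v$ with $u,v$ in different parts is included independently with probability $q$. Let $M$ be its Laplacian: $M_{uv}=1$ if $u\to v$ is an arc, $M_{uv}=0$ for other pairs $u\neq v$, and $M_{uu}=-\sum_{v\ne u}M_{uv}$ (so the rows of $M$ sum to zero). Let $\operatorname{corank}(M/p)$ be $n+m$ minus the rank of $M$ modulo $p$ over $\mathbb F_p$. The sandpile group of $G$ is $\Gamma(G)=\mathbb Z_0^{\,n+m}/L$, where $\mathbb Z_0^{\,n+m}$ is the group of integer vectors with zero coordinate sum and $L$ is the lattice spanned by the rows of $M$; its $p$-rank is $\dim_{\mathbb F_p}\Gamma(G)/p\Gamma(G)$. (1) There are constants $c,C>0$, depending only on $q$ and $\alpha$, such that for every prime $p$ with $1/p<\alpha$, every $n$ with $p\le c\sqrt n$, and every integer $0\le k\le(1+\alpha)n$, $$\left|\,\mathbb P\bigl(\operatorname{corank}(M/p)=1+k\bigr)-\frac{1}{p^{k^2+k}}\,\frac{\prod_{i=k+2}^{\infty}(1-p^{-i})}{\prod_{i=1}^{k}(1-p^{-i})}\,\right|\le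 \exp\!\left(-\frac{Cn}{p^2}\right).$$ (2) For every prime $p$ with $1/p<\alpha$ (in particular for every prime $p$ in the balanced case $\alpha=1$), the expected $p$-rank of $\Gamma(G)$ is $O(1)$: there is a constant $B$, depending only on $p,q,\alpha$, such that $\mathbb E[\,p\text{-rank of }\Gamma(G)\,]\le B$ for all $n$. -/

import Mathlib

open MeasureTheory ProbabilityTheory

noncomputable section

namespace BipartiteSandpile

/-- The possible arcs of a directed bipartite graph with parts `Fin n` and `Fin m`:
`inl (i, j)` is the arc from `i` to `j`, and `inr (j, i)` is the arc from `j` to `i`. -/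
abbrev Arc (n m : ℕ) : Type := (Fin n × Fin m) ⊕ (Fin m × Fin n)

/-- The directed bipartite graph whose arcs are the crossing pairs on which `ω` is `true`. -/
def bipartiteDigraph {n m : ℕ} (ω : Arc n m → Bool) : Digraph (Fin n ⊕ Fin m) where
  Adj
    | Sum.inl i, Sum.inr j => ω (Sum.inl (i, j)) = true
    | Sum.inr j, Sum.inl i => ω (Sum.inr (j, i)) = true
    | Sum.inl _, Sum.inl _ => False
    | Sum.inr _, Sum.inr _ => False

/-- The law of the random directed bipartite graph: each of the `2 * n * m` possible arcs is
included independently with probability `q`. -/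
def arcMeasure (n m : ℕ) (q : unitInterval) : Measure (Arc n m → Bool) :=
  Measure.pi fun _ => bernoulliMeasure true false q

section Laplacian

variable {V : Type*} [Fintype V] [DecidableEq V]

open Classical in
/-- The adjacency matrix of a digraph, with integer entries. -/
def adjacency (G : Digraph V) : Matrix V V ℤ :=
  Matrix.of fun u v => if G.Adj u v then 1 else 0

/-- The Laplacian of a digraph: the adjacency matrix minus the diagonal matrix of the
out-degrees. Its rows sum to zero. -/
def laplacian (G : Digraph V) : Matrix V V ℤ :=
  adjacency G - Matrix.diagonal fun u => ∑ v, adjacency G u v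

/-- The corank of a square matrix. -/
def corank {R : Type*} [CommRing R] (A : Matrix V V R) : ℕ :=
  Fintype.card V - A.rank

/-- The reduction modulo `p` of an integer matrix. -/
def modMatrix (p : ℕ) (A : Matrix V V ℤ) : Matrix V V (ZMod p) :=
  A.map (Int.cast : ℤ → ZMod p)

variable (V) in
/-- The lattice of integer vectors with zero coordinate sum. -/
def zeroSum : Submodule ℤ (V → ℤ) :=
  LinearMap.ker (∑ v, (LinearMap.proj v : (V → ℤ) →ₗ[ℤ] ℤ))

/-- The lattice spanned by the rows of the Laplacian. -/
def rowLattice (G : Digraph V) : Submodule ℤ (V → ℤ) :=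
  Submodule.span ℤ (Set.range (laplacian G).row)

theorem rowLattice_le_zeroSum (G : Digraph V) : rowLattice G ≤ zeroSum V := by
  rw [rowLattice, Submodule.span_le]
  rintro _ ⟨u, rfl⟩
  simp [zeroSum, laplacian, Matrix.row, Matrix.diagonal_apply, Finset.sum_sub_distrib]

/-- The sandpile group of a digraph: the zero-sum vectors modulo the lattice spanned by the rows
of the Laplacian. -/
abbrev SandpileGroup (G : Digraph V) : Type _ :=
  zeroSum V ⧸ (rowLattice G).submoduleOf (zeroSum V)

end Laplacian

/-- The `p`-rank of an abelian group `Γ`: the dimension of `Γ / pΓ` over `ℤ / pℤ`. -/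
def pRank (p : ℕ) (Γ : Type*) [AddCommGroup Γ] : ℕ :=
  Module.finrank (ZMod p) (ModN Γ p)

/-- The number
`p ^ (-(k ^ 2 + k)) * ∏_{i ≥ k + 2} (1 - p ^ (-i)) / ∏_{1 ≤ i ≤ k} (1 - p ^ (-i))`. -/
def limitLaw (p k : ℕ) : ℝ :=
  1 / (p : ℝ) ^ (k ^ 2 + k) *
    ((∏' i : ℕ, (1 - 1 / (p : ℝ) ^ (i + (k + 2)))) /
      ∏ i ∈ Finset.Icc 1 k, (1 - 1 / (p : ℝ) ^ i))

end BipartiteSandpile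

end

/-! Modulo p, a vector w lies in the kernel of M exactly when the bit vector of each vertex u
annihilates the differences w v - w u over the vertices v of the opposite part
(`ker_modMatrix_laplacian`). The corank is therefore the dimension left by n + m independent random
linear equations, which can be exposed one by one. Constant vectors always survive, whence the 1 in
1 + k.

The law comes from the last R + 1 rows of the second part. Suppose the earlier rows leave a space of
dimension exactly R + 1 and no nonzero solution that is sparse on the first part (`IsGood`). Then
the differences seen by a later row have linearly many nonzero coordinates for every nonconstant
solution. By Fourier inversion (`abs_Pr_bitDot_sub_le`) the next row vanishes on the current space,
of dimension d modulo constants, with probability close to p^(-d). The dimension thus follows the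
chain of a uniform (R + 1) × R matrix (`abs_Pr_finrank_cut_sub_le`), whose law is explicit
(`uniformCorank_formula`) and converges to `limitLaw`. The Fourier error gives exp(-Cn/p²); the
other errors are exponentially small in n.

The good event is likely for two reasons (`Pr_not_isGood_le`). A first-part row whose degree is
nonzero mod p determines its own coordinate from the second part; a balanced row, of degree zero mod
p, leaves its coordinate free and constrains the second part. About n/p rows are balanced, fewer
than m because 1/p < α, so Odlyzko's lemma (`Pr_bitDot_le`) makes their equations independent, and
it does the same for the first s rows of the second part. Sparse solutions are excluded by a union
bound (`exists_structured_bound`) that rests on a Littlewood–Offord estimate mod p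
(`Pr_bitDot_eq_zero_le_inv`), which is effective when p² is at most a small multiple of n.

For the expectation, the p-rank is at most the corank (`pRank_sandpileGroup_le_corank`). The limit
law has geometric tails, and when p² > cn the trivial bound 2n is already a constant. -/

noncomputable section

namespace BipartiteSandpile

attribute [-instance] AddSubgroupClass.instZModModule

/-! ### Finite product probability spaces -/

section FiniteProbability

variable {X Y : Type*} [Fintype X] [Fintype Y]

/-- A probability vector on a finite type. -/
structure IsProb (μ : X → ℝ) : Prop where
  nonneg : ∀ x, 0 ≤ μ x
  sum_eq : ∑ x, μ x = 1

open Classical in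
/-- The total weight of the points that satisfy a predicate. -/
def Pr (μ : X → ℝ) (P : X → Prop) : ℝ := ∑ x, if P x then μ x else 0

/-- The product weight on functions. -/
def iidWeight {ι : Type*} [Fintype ι] (μ : X → ℝ) (B : ι → X) : ℝ := ∏ i, μ (B i)

/-- The product weight on pairs. -/
def prodWeight (μ : X → ℝ) (ν : Y → ℝ) (z : X × Y) : ℝ := μ z.1 * ν z.2

variable {μ : X → ℝ} {ν : Y → ℝ}

theorem Pr_eq_sum (P : X → Prop) [DecidablePred P] : Pr μ P = ∑ x, if P x then μ x else 0 := by
  unfold Pr; exact Finset.sum_congr rfl fun x _ => by congr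

theorem Pr_nonneg (hμ : IsProb μ) (P : X → Prop) : 0 ≤ Pr μ P :=
  Finset.sum_nonneg fun x _ => by split_ifs <;> simp [hμ.nonneg]

theorem Pr_mono (hμ : IsProb μ) {P Q : X → Prop} (h : ∀ x, P x → Q x) : Pr μ P ≤ Pr μ Q :=
  Finset.sum_le_sum fun x _ => by
    by_cases hP : P x
    · simp [hP, h x hP]
    · by_cases hQ : Q x <;> simp [hP, hQ, hμ.nonneg]

theorem Pr_congr {P Q : X → Prop} (h : ∀ x, P x ↔ Q x) : Pr μ P = Pr μ Q := by
  rw [show P = Q from funext fun x => propext (h x)]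

theorem Pr_true (hμ : IsProb μ) : Pr μ (fun _ => True) = 1 := by simp [Pr, hμ.sum_eq]

theorem Pr_false : Pr μ (fun _ => False) = 0 := by simp [Pr]

theorem Pr_le_one (hμ : IsProb μ) (P : X → Prop) : Pr μ P ≤ 1 := by
  rw [← Pr_true hμ]; exact Pr_mono hμ fun _ _ => trivial

theorem Pr_or_le (hμ : IsProb μ) (P Q : X → Prop) :
    Pr μ (fun x => P x ∨ Q x) ≤ Pr μ P + Pr μ Q := by
  rw [Pr, Pr, Pr, ← Finset.sum_add_distrib]
  refine Finset.sum_le_sum fun x _ => ?_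
  have := hμ.nonneg x
  by_cases hP : P x <;> by_cases hQ : Q x <;> simp [hP, hQ, this]

theorem Pr_add_Pr_not (hμ : IsProb μ) (P : X → Prop) : Pr μ P + Pr μ (fun x => ¬ P x) = 1 := by
  rw [Pr, Pr, ← Finset.sum_add_distrib, ← hμ.sum_eq]
  exact Finset.sum_congr rfl fun x _ => by by_cases hP : P x <;> simp [hP]

theorem Pr_exists_le (hμ : IsProb μ) {I : Type*} (s : Finset I) (P : I → X → Prop) :
    Pr μ (fun x => ∃ i ∈ s, P i x) ≤ ∑ i ∈ s, Pr μ (P i) := by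
  classical
  induction s using Finset.induction_on with
  | empty => simp [Pr]
  | insert a s ha ih =>
    rw [Finset.sum_insert ha]
    refine le_trans (Pr_mono hμ (Q := fun x => P a x ∨ ∃ i ∈ s, P i x) ?_)
      ((Pr_or_le hμ _ _).trans (by gcongr))
    intro x; simp

theorem IsProb.prod (hμ : IsProb μ) (hν : IsProb ν) : IsProb (prodWeight μ ν) where
  nonneg z := mul_nonneg (hμ.nonneg _) (hν.nonneg _)
  sum_eq := by
    simp only [prodWeight]
    rw [Fintype.sum_prod_type]
    simp [← Finset.mul_sum, hμ.sum_eq, hν.sum_eq]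

theorem IsProb.iid {ι : Type*} [Fintype ι] [DecidableEq ι] (hμ : IsProb μ) :
    IsProb (iidWeight μ : (ι → X) → ℝ) where
  nonneg B := Finset.prod_nonneg fun i _ => hμ.nonneg _
  sum_eq := by
    classical
    have := Finset.prod_univ_sum (fun _ : ι => (Finset.univ : Finset X)) (fun _ x => μ x)
    simp only [Fintype.piFinset_univ] at this
    simp only [iidWeight]
    rw [← this]; simp [hμ.sum_eq]

theorem Pr_prod (P : X × Y → Prop) :
    Pr (prodWeight μ ν) P = ∑ x, μ x * Pr ν fun y => P (x, y) := by
  simp only [Pr, prodWeight, Fintype.sum_prod_type, Finset.mul_sum, mul_ite, mul_zero]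

theorem Pr_prod_and (P : X → Prop) (Q : Y → Prop) :
    Pr (prodWeight μ ν) (fun z => P z.1 ∧ Q z.2) = Pr μ P * Pr ν Q := by
  rw [Pr_prod]
  simp only [Pr, Finset.sum_mul]
  refine Finset.sum_congr rfl fun x _ => ?_
  by_cases h : P x
  · rw [if_pos h]
    refine congrArg _ (Finset.sum_congr rfl fun y _ => ?_)
    by_cases hQ : Q y <;> simp [h, hQ]
  · simp [h]

theorem Pr_prod_fst (hν : IsProb ν) (P : X → Prop) :
    Pr (prodWeight μ ν) (fun z => P z.1) = Pr μ P := by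
  have := Pr_prod_and (μ := μ) (ν := ν) P (fun _ => True)
  simpa [Pr_true hν] using this

/-- Conditioning on the first coordinate: a bound that holds for every good value. -/
theorem abs_Pr_prod_sub_le (hμ : IsProb μ) (hν : IsProb ν) (G : X → Prop) (P : X × Y → Prop)
    {g ε : ℝ} (hg0 : 0 ≤ g) (hg1 : g ≤ 1) (hε : 0 ≤ ε)
    (h : ∀ x, G x → |Pr ν (fun y => P (x, y)) - g| ≤ ε) :
    |Pr (prodWeight μ ν) P - g| ≤ ε + Pr μ fun x => ¬ G x := by
  classical
  have e : Pr (prodWeight μ ν) P - g = ∑ x, μ x * (Pr ν (fun y => P (x, y)) - g) := by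
    rw [Pr_prod]
    simp only [mul_sub, Finset.sum_sub_distrib, ← Finset.sum_mul, hμ.sum_eq, one_mul]
  have e2 : ε + Pr μ (fun x => ¬ G x) = ∑ x, (μ x * ε + if ¬ G x then μ x else 0) := by
    rw [Finset.sum_add_distrib, ← Finset.sum_mul, hμ.sum_eq, one_mul, Pr_eq_sum]
  rw [e, e2]
  refine (Finset.abs_sum_le_sum_abs _ _).trans (Finset.sum_le_sum fun x _ => ?_)
  have h0 := hμ.nonneg x
  rw [abs_mul, abs_of_nonneg h0]
  by_cases hG : G x
  · simpa [hG] using mul_le_mul_of_nonneg_left (h x hG) h0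
  · have h1 : |Pr ν (fun y => P (x, y)) - g| ≤ 1 := by
      have := Pr_nonneg hν fun y => P (x, y)
      have := Pr_le_one hν fun y => P (x, y)
      rw [abs_le]; constructor <;> linarith
    have h2 := mul_le_mul_of_nonneg_left h1 h0
    have h3 := mul_nonneg h0 hε
    simp only [hG, not_false_eq_true, if_true]
    linarith

theorem Pr_prod_le (hμ : IsProb μ) (hν : IsProb ν) (G : X → Prop) (P : X × Y → Prop)
    {ε : ℝ} (hε : 0 ≤ ε) (h : ∀ x, G x → Pr ν (fun y => P (x, y)) ≤ ε) :
    Pr (prodWeight μ ν) P ≤ ε + Pr μ fun x => ¬ G x := by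
  have := abs_Pr_prod_sub_le hμ hν G P le_rfl zero_le_one hε
    (fun x hx => by rw [sub_zero, abs_of_nonneg (Pr_nonneg hν _)]; exact h x hx)
  rw [sub_zero, abs_of_nonneg (Pr_nonneg (hμ.prod hν) _)] at this
  exact this

theorem Pr_iid_forall {ι : Type*} [Fintype ι] [DecidableEq ι] (P : ι → X → Prop) :
    Pr (iidWeight μ : (ι → X) → ℝ) (fun B => ∀ i, P i (B i)) = ∏ i, Pr μ (P i) := by
  classical
  have := Finset.prod_univ_sum (fun _ : ι => (Finset.univ : Finset X))
    (fun i x => if P i x then μ x else 0)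
  simp only [Fintype.piFinset_univ] at this
  simp only [Pr, iidWeight]
  rw [this]
  refine Finset.sum_congr rfl fun B _ => ?_
  by_cases h : ∀ i, P i (B i)
  · simp [h]
  · rw [if_neg h]
    push Not at h
    obtain ⟨i, hi⟩ := h
    exact (Finset.prod_eq_zero (Finset.mem_univ i) (by simp [hi])).symm

theorem Pr_iid_succ {r : ℕ} (P : (Fin (r + 1) → X) → Prop) :
    Pr (iidWeight μ) P = ∑ x, μ x * Pr (iidWeight μ) fun B => P (Fin.cons x B) := by
  simp only [Pr, Finset.mul_sum]
  rw [← (Fin.consEquiv fun _ : Fin (r + 1) => X).sum_comp, Fintype.sum_prod_type]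
  refine Finset.sum_congr rfl fun x _ => Finset.sum_congr rfl fun B _ => ?_
  simp only [Fin.consEquiv_apply, iidWeight, Fin.prod_univ_succ, Fin.cons_zero, Fin.cons_succ]
  rw [mul_ite, mul_zero]; rfl

theorem Pr_iid_zero (P : (Fin 0 → X) → Prop) (Q : Prop) (h : ∀ B, P B ↔ Q) [Decidable Q] :
    Pr (iidWeight μ) P = if Q then 1 else 0 := by
  simp [Pr, iidWeight, h]

theorem Pr_iid_add {s r : ℕ} (P : (Fin (s + r) → X) → Prop) :
    Pr (iidWeight μ) P =
      Pr (prodWeight (iidWeight μ) (iidWeight μ))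
        fun z : (Fin s → X) × (Fin r → X) => P (Fin.append z.1 z.2) := by
  simp only [Pr]
  rw [← (Fin.appendEquiv s r).sum_comp]
  refine Finset.sum_congr rfl fun z _ => ?_
  have : iidWeight μ (Fin.append z.1 z.2) = prodWeight (iidWeight μ) (iidWeight μ) z := by
    simp [iidWeight, prodWeight, Fin.prod_univ_add]
  simp only [Fin.appendEquiv, Equiv.coe_fn_mk]
  rw [this]; rfl

/-- The recursion that bounds a probability step by step. -/
theorem sum_mul_ite_le {Q : X → Prop} (hμ : IsProb μ) {f : X → ℝ} {a b : ℝ} (hb : 0 ≤ b)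
    (h1 : ∀ x, f x ≤ 1) (hf : ∀ x, ¬ Q x → f x ≤ b) (ha : Pr μ Q ≤ a) :
    ∑ x, μ x * f x ≤ a + b := by
  classical
  have : ∑ x, μ x * f x ≤ ∑ x, ((if Q x then μ x else 0) + μ x * b) := by
    refine Finset.sum_le_sum fun x _ => ?_
    have h0 := hμ.nonneg x
    by_cases hQ : Q x
    · simp only [hQ, if_true]
      have := mul_le_mul_of_nonneg_left (h1 x) h0
      have := mul_nonneg h0 hb
      linarith
    · simp only [hQ, if_false, zero_add]
      exact mul_le_mul_of_nonneg_left (hf x hQ) h0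
  refine this.trans ?_
  rw [Finset.sum_add_distrib, ← Finset.sum_mul, hμ.sum_eq, one_mul]
  rw [← Pr_eq_sum]
  linarith

open Classical in
/-- A Chernoff bound for the number of occurrences of an event in independent trials. -/
theorem Pr_iid_card_le {r : ℕ} (hμ : IsProb μ) (Q : X → Prop) {w γ : ℝ}
    (hw : Pr μ Q ≤ w) (hw1 : w ≤ 1) (hγ0 : 0 ≤ γ) (hγ1 : γ ≤ 1) :
    Pr (iidWeight μ : (Fin r → X) → ℝ)
      (fun A => (w + γ) * r ≤ ((Finset.univ.filter fun i => Q (A i)).card : ℝ)) ≤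
      Real.exp (-(γ ^ 2 / 4 * r)) := by
  -- The exponent is at most l² - γ l per trial since w ≤ 1; l = γ / 2 minimises it and yields the
  -- rate γ² / 4.
  set l : ℝ := γ / 2 with hl
  have hexp : ∀ A : Fin r → X, (∏ i, if Q (A i) then Real.exp l else 1) =
      Real.exp (l * (Finset.univ.filter fun i => Q (A i)).card) := by
    intro A
    rw [Finset.prod_ite, Finset.prod_const, Finset.prod_const_one, mul_one, ← Real.exp_nat_mul]
    congr 1; ring
  have hmgf : ∑ x, μ x * (if Q x then Real.exp l else 1) ≤ Real.exp (w * (l + l ^ 2)) := by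
    have e : ∑ x, μ x * (if Q x then Real.exp l else 1) = 1 + Pr μ Q * (Real.exp l - 1) := by
      rw [Pr, Finset.sum_mul]
      nth_rewrite 2 [← hμ.sum_eq]
      rw [← Finset.sum_add_distrib]
      refine Finset.sum_congr rfl fun x _ => ?_
      by_cases h : Q x
      · simp only [h, if_true]; ring
      · simp [h]
    have h1 : Real.exp l - 1 ≤ l + l ^ 2 := by
      have := Real.abs_exp_sub_one_sub_id_le (x := l) (by rw [abs_of_nonneg] <;> linarith)
      have := (abs_le.1 this).2
      linarith
    have h0 : 0 ≤ Real.exp l - 1 := by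
      have := Real.add_one_le_exp l; linarith
    rw [e]
    have := Real.add_one_le_exp (w * (l + l ^ 2))
    have h2 : Pr μ Q * (Real.exp l - 1) ≤ w * (l + l ^ 2) :=
      mul_le_mul hw h1 h0 ((Pr_nonneg hμ _).trans hw)
    linarith
  have hpos : 0 < Real.exp (l * ((w + γ) * r)) := Real.exp_pos _
  have key : Pr (iidWeight μ : (Fin r → X) → ℝ)
      (fun A => (w + γ) * r ≤ ((Finset.univ.filter fun i => Q (A i)).card : ℝ)) *
        Real.exp (l * ((w + γ) * r)) ≤ Real.exp (w * (l + l ^ 2)) ^ r := by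
    calc _ ≤ ∑ A : Fin r → X, iidWeight μ A * ∏ i, (if Q (A i) then Real.exp l else 1) := by
          rw [Pr, Finset.sum_mul]
          refine Finset.sum_le_sum fun A _ => ?_
          have h0 : 0 ≤ iidWeight μ A := hμ.iid.nonneg A
          rw [hexp]
          split_ifs with h
          · refine mul_le_mul_of_nonneg_left (Real.exp_le_exp.2 ?_) h0
            exact mul_le_mul_of_nonneg_left h (by positivity)
          · rw [zero_mul]; positivity
      _ = (∑ x, μ x * (if Q x then Real.exp l else 1)) ^ r := by
          simp only [iidWeight, ← Finset.prod_mul_distrib]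
          have := Finset.prod_univ_sum (fun _ : Fin r => (Finset.univ : Finset X))
            (fun _ x => μ x * (if Q x then Real.exp l else 1))
          simp only [Fintype.piFinset_univ] at this
          rw [← this]; simp
      _ ≤ _ := by
          refine pow_le_pow_left₀ (Finset.sum_nonneg fun x _ => ?_) hmgf r
          refine mul_nonneg (hμ.nonneg x) ?_
          split_ifs <;> positivity
  rw [← le_div_iff₀ hpos] at key
  refine key.trans ?_
  rw [← Real.exp_nat_mul, ← Real.exp_sub]
  refine Real.exp_le_exp.2 ?_
  have hr : (0 : ℝ) ≤ r := Nat.cast_nonneg r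
  have : w * γ ^ 2 * r ≤ 1 * γ ^ 2 * r := by gcongr
  rw [hl]; nlinarith

end FiniteProbability

section Resample

variable {X ι : Type*} [Fintype X] [Fintype ι] [DecidableEq ι] {μ : X → ℝ}

/-- Resampling one coordinate does not change a product law. -/
theorem Pr_iid_update (hμ : IsProb μ) (i : ι) (P : (ι → X) → Prop) :
    Pr (iidWeight μ) P =
      ∑ B : ι → X, iidWeight μ B * Pr μ fun c => P (Function.update B i c) := by
  classical
  have h1 : ∑ z : (ι → X) × X, iidWeight μ z.1 * μ z.2 * (if P z.1 then 1 else 0) =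
      ∑ z : (ι → X) × X,
        iidWeight μ z.1 * μ z.2 * (if P (Function.update z.1 i z.2) then 1 else 0) := by
    -- Swapping coordinate i with the fresh sample is an involution that preserves the joint weight.
    let e : (ι → X) × X ≃ (ι → X) × X :=
      { toFun := fun z => (Function.update z.1 i z.2, z.1 i)
        invFun := fun z => (Function.update z.1 i z.2, z.1 i)
        left_inv := fun z => by simp
        right_inv := fun z => by simp }
    rw [← e.sum_comp]
    refine Finset.sum_congr rfl fun z _ => ?_
    have : iidWeight μ (Function.update z.1 i z.2) * μ (z.1 i) = iidWeight μ z.1 * μ z.2 := by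
      simp only [iidWeight]
      rw [← Finset.mul_prod_erase Finset.univ _ (Finset.mem_univ i),
        ← Finset.mul_prod_erase Finset.univ (fun j => μ (z.1 j)) (Finset.mem_univ i)]
      have : ∏ j ∈ Finset.univ.erase i, μ (Function.update z.1 i z.2 j) =
          ∏ j ∈ Finset.univ.erase i, μ (z.1 j) :=
        Finset.prod_congr rfl fun j hj => by
          rw [Function.update_of_ne (Finset.ne_of_mem_erase hj)]
      rw [this, Function.update_self]; ring
    simp only [e, Equiv.coe_fn_mk, this]
  rw [Fintype.sum_prod_type, Fintype.sum_prod_type] at h1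
  have h2 : Pr (iidWeight μ) P =
      ∑ B : ι → X, ∑ c, iidWeight μ B * μ c * (if P B then 1 else 0) := by
    rw [Pr_eq_sum]
    refine Finset.sum_congr rfl fun B _ => ?_
    simp only [← Finset.sum_mul, ← Finset.mul_sum, hμ.sum_eq, mul_one]
    split_ifs <;> simp
  rw [h2]
  refine h1.trans (Finset.sum_congr rfl fun B _ => ?_)
  rw [Pr_eq_sum, Finset.mul_sum]
  refine Finset.sum_congr rfl fun c _ => ?_
  split_ifs <;> simp

end Resample

/-- The law of a biased coin. -/
def coin (t : ℝ) (b : Bool) : ℝ := if b then t else 1 - t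

theorem isProb_coin {t : ℝ} (h0 : 0 ≤ t) (h1 : t ≤ 1) : IsProb (coin t) where
  nonneg b := by cases b <;> simp [coin, h0, h1]
  sum_eq := by simp [coin]

/-! ### Random bit vectors and Odlyzko's lemma -/

section BitDot

variable {F ι : Type*} [Field F] [Fintype ι]

/-- The linear form `v ↦ ∑ k, b k * v k` attached to a vector of bits. -/
def bitDot (b : ι → Bool) : (ι → F) →ₗ[F] F := ∑ k, if b k then LinearMap.proj k else 0

theorem bitDot_apply (b : ι → Bool) (v : ι → F) :
    bitDot b v = ∑ k, if b k then v k else 0 := by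
  simp only [bitDot, LinearMap.coe_sum, Finset.sum_apply]
  refine Finset.sum_congr rfl fun k _ => ?_
  split_ifs <;> simp

theorem bitDot_update [DecidableEq ι] (b : ι → Bool) (i : ι) (c : Bool) (v : ι → F) :
    bitDot (Function.update b i c) v =
      (if c then v i else 0) + bitDot (Function.update b i false) v := by
  simp only [bitDot_apply]
  rw [← Finset.add_sum_erase _ _ (Finset.mem_univ i),
    ← Finset.add_sum_erase (a := i) _ (fun k => if Function.update b i false k = true then v k
      else 0) (Finset.mem_univ i)]
  simp only [Function.update_self, Bool.false_eq_true, if_false, zero_add]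
  congr 1
  refine Finset.sum_congr rfl fun k hk => ?_
  rw [Function.update_of_ne (Finset.ne_of_mem_erase hk),
    Function.update_of_ne (Finset.ne_of_mem_erase hk)]

theorem finrank_inf_ker_of_le {V : Type*} [AddCommGroup V] [Module F V] (K : Submodule F V)
    (φ : V →ₗ[F] F) (h : ∀ w ∈ K, φ w = 0) : K ⊓ LinearMap.ker φ = K :=
  inf_eq_left.2 fun w hw => h w hw

theorem finrank_inf_ker_add_one {V : Type*} [AddCommGroup V] [Module F V]
    [FiniteDimensional F V] (K : Submodule F V)
    (φ : V →ₗ[F] F) (h : ¬ ∀ w ∈ K, φ w = 0) :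
    Module.finrank F ↥(K ⊓ LinearMap.ker φ) + 1 = Module.finrank F K := by
  have e1 := (φ.domRestrict K).finrank_range_add_finrank_ker
  have hr : LinearMap.range (φ.domRestrict K) = ⊤ := by
    refine LinearMap.range_eq_top.2 (LinearMap.surjective fun h0 => h fun w hw => ?_)
    exact congrArg (fun f => f ⟨w, hw⟩) h0
  rw [hr, finrank_top, Module.finrank_self] at e1
  have e2 : Module.finrank F (LinearMap.ker (φ.domRestrict K)) =
      Module.finrank F ↥(K ⊓ LinearMap.ker φ) := by
    have : (LinearMap.ker (φ.domRestrict K)).map K.subtype = K ⊓ LinearMap.ker φ := by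
      ext w
      simp only [Submodule.mem_map, LinearMap.mem_ker, Submodule.mem_inf]
      constructor
      · rintro ⟨x, hx, rfl⟩; exact ⟨x.2, hx⟩
      · rintro ⟨h1, h2⟩; exact ⟨⟨w, h1⟩, h2, rfl⟩
    rw [← this]
    exact (Submodule.equivMapOfInjective _ K.injective_subtype _).finrank_eq
  omega

/-- The larger of the two probabilities of a biased coin. -/
def coinMax (t : ℝ) : ℝ := max t (1 - t)

theorem Pr_coin_le {t : ℝ} (h0 : 0 ≤ t) (P : Bool → Prop) (h : ¬ (P true ∧ P false)) :
    Pr (coin t) P ≤ coinMax t := by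
  classical
  rw [Pr_eq_sum, Fintype.sum_bool, coinMax]
  by_cases ht : P true <;> by_cases hf : P false
  · exact absurd ⟨ht, hf⟩ h
  · simp [ht, hf, coin]
  · simp [ht, hf, coin]
  · simp [ht, hf, h0]

theorem coinMax_pos (t : ℝ) : 0 < coinMax t := by
  unfold coinMax
  rcases le_total t (1/2) with h | h
  · exact lt_max_of_lt_right (by linarith)
  · exact lt_max_of_lt_left (by linarith)

/-- Since p ≥ 2, powers of `coinMax t` also dominate the uniform probabilities p^(-d). -/
theorem half_le_coinMax (t : ℝ) : 1 / 2 ≤ coinMax t := by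
  unfold coinMax
  rcases le_total t (1/2) with h | h
  · exact le_max_of_le_right (by linarith)
  · exact le_max_of_le_left (by linarith)

/-- Odlyzko's lemma: a random vector of bits annihilates a subspace of dimension `d` with
probability at most `ρ ^ d`. -/
theorem Pr_bitDot_le [DecidableEq ι] {t : ℝ} (h0 : 0 ≤ t) (h1 : t ≤ 1) (U : Submodule F (ι → F)) :
    Pr (iidWeight (coin t)) (fun b : ι → Bool => ∀ v ∈ U, bitDot b v = 0) ≤
      coinMax t ^ Module.finrank F U := by
  have hc := isProb_coin h0 h1
  induction hd : Module.finrank F U generalizing U with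
  | zero => simpa using Pr_le_one hc.iid _
  | succ d ih =>
    have hne : U ≠ ⊥ := by rintro rfl; simp at hd
    obtain ⟨v, hv, hv0⟩ := Submodule.exists_mem_ne_zero_of_ne_bot hne
    obtain ⟨i, hi⟩ := Function.ne_iff.1 hv0
    have hi' : v i ≠ 0 := hi
    -- Bit i does not act on U', so the other bits decide whether U' is annihilated; given them, at
    -- most one value of bit i annihilates v.
    set U' := U ⊓ LinearMap.ker (LinearMap.proj i : (ι → F) →ₗ[F] F) with hU'
    have hd' : Module.finrank F U' = d := by
      have := finrank_inf_ker_add_one U (LinearMap.proj i) (fun h => hi' (h v hv))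
      rw [← hU'] at this; omega
    classical
    rw [Pr_iid_update hc i]
    have key : ∀ B : ι → Bool, Pr (coin t) (fun c => ∀ v ∈ U, bitDot (Function.update B i c) v = 0)
        ≤ if (∀ v ∈ U', bitDot B v = 0) then coinMax t else 0 := by
      intro B
      have hB : ∀ w ∈ U', ∀ c, bitDot (Function.update B i c) w = bitDot B w := by
        intro w hw c
        have hwi : w i = 0 := hw.2
        have e1 := bitDot_update B i c w
        have e2 := bitDot_update B i (B i) w
        rw [Function.update_eq_self] at e2
        rw [e1, e2]; simp [hwi]
      split_ifs with hz
      · refine Pr_coin_le h0 _ fun ⟨ht, hf⟩ => ?_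
        have e := bitDot_update B i true v
        rw [ht v hv, hf v hv] at e
        simp at e; exact hi' e.symm
      · rw [Pr_congr (Q := fun _ => False), Pr_false]
        intro c
        refine iff_of_false (fun h => hz fun w hw => ?_) id
        rw [← hB w hw c]; exact h w hw.1
    calc _ ≤ ∑ B : ι → Bool, iidWeight (coin t) B *
          (if (∀ v ∈ U', bitDot B v = 0) then coinMax t else 0) :=
        Finset.sum_le_sum fun B _ => mul_le_mul_of_nonneg_left (key B) (hc.iid.nonneg B)
      _ = coinMax t * Pr (iidWeight (coin t)) (fun b : ι → Bool => ∀ v ∈ U', bitDot b v = 0) := by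
        rw [Pr_eq_sum, Finset.mul_sum]
        refine Finset.sum_congr rfl fun B _ => ?_
        split_ifs <;> ring
      _ ≤ coinMax t * coinMax t ^ d := mul_le_mul_of_nonneg_left (ih U' hd') (coinMax_pos t).le
      _ = _ := by ring

theorem Pr_bitDot_eq_zero_le [DecidableEq ι] {t : ℝ} (h0 : 0 ≤ t) (h1 : t ≤ 1) {v : ι → F}
    (hv : v ≠ 0) :
    Pr (iidWeight (coin t)) (fun b : ι → Bool => bitDot b v = 0) ≤ coinMax t := by
  have := Pr_bitDot_le h0 h1 (Submodule.span F {v})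
  rw [finrank_span_singleton hv, pow_one] at this
  refine le_trans (le_of_eq (Pr_congr fun b => ?_)) this
  constructor
  · intro h w hw
    obtain ⟨a, rfl⟩ := Submodule.mem_span_singleton.1 hw
    rw [map_smul, h, smul_zero]
  · intro h; exact h v (Submodule.mem_span_singleton_self v)

end BitDot

/-! ### Fourier analysis modulo p and the Littlewood–Offord bound -/

section Fourier

variable {p : ℕ} [Fact p.Prime] {ι : Type*} [Fintype ι] [DecidableEq ι]

/-- The characteristic function of a biased coin. -/
def charFn (p : ℕ) [NeZero p] (t : ℝ) (x : ZMod p) : ℂ := 1 - t + t * ZMod.stdAddChar x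

theorem sum_iid_mul_char (t : ℝ) (v : ι → ZMod p) :
    ∑ b : ι → Bool, (iidWeight (coin t) b : ℂ) * ZMod.stdAddChar (bitDot b v) =
      ∏ k, charFn p t (v k) := by
  have := Finset.prod_univ_sum (fun _ : ι => (Finset.univ : Finset Bool))
    (fun k c => (coin t c : ℂ) * ZMod.stdAddChar (if c then v k else 0))
  simp only [Fintype.piFinset_univ, Fintype.sum_bool] at this
  have e : ∀ k, charFn p t (v k) = (coin t true : ℂ) * ZMod.stdAddChar (if true then v k else 0) +
      (coin t false : ℂ) * ZMod.stdAddChar (if false then v k else 0) := by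
    intro k; simp [charFn, coin]; ring
  simp only [e]
  simp only [if_true] at this ⊢
  refine Eq.trans ?_ this.symm
  refine Finset.sum_congr rfl fun b _ => ?_
  have hsum : ∀ f : ι → ZMod p, (ZMod.stdAddChar (∑ k, f k) : ℂ) = ∏ k, ZMod.stdAddChar (f k) := by
    intro f
    have := map_prod (ZMod.stdAddChar (N := p)).toMonoidHom (fun k => Multiplicative.ofAdd (f k))
      Finset.univ
    rw [← ofAdd_sum] at this
    exact this
  rw [Finset.prod_mul_distrib, iidWeight, bitDot_apply, hsum]
  push_cast; rfl

-- The indicator that a form vanishes on U is the average of its characters over U. Taking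
-- expectations, independence of the bits factors each character.
open Classical in
theorem Pr_bitDot_eq_fourier (t : ℝ) (U : Submodule (ZMod p) (ι → ZMod p)) :
    (Pr (iidWeight (coin t)) (fun b : ι → Bool => ∀ v ∈ U, bitDot b v = 0) : ℂ) *
      (p : ℂ) ^ Module.finrank (ZMod p) U = ∑ v : U, ∏ k, charFn p t (v.1 k) := by
  classical
  have hcard : (Fintype.card U : ℂ) = (p : ℂ) ^ Module.finrank (ZMod p) U := by
    rw [Module.card_eq_pow_finrank (K := ZMod p) (V := U), ZMod.card]; push_cast; rfl
  have hind : ∀ b : ι → Bool, ∑ v : U, (ZMod.stdAddChar (bitDot b v.1) : ℂ) =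
      if (∀ v ∈ U, bitDot b v = 0) then (p : ℂ) ^ Module.finrank (ZMod p) U else 0 := by
    intro b
    let χ : AddChar U ℂ := (ZMod.stdAddChar (N := p)).compAddMonoidHom
      ((bitDot b : (ι → ZMod p) →ₗ[ZMod p] ZMod p).domRestrict U).toAddMonoidHom
    have h := AddChar.sum_eq_ite χ
    have hχ : χ = 0 ↔ ∀ v ∈ U, bitDot b v = 0 := by
      constructor
      · intro h v hv
        have : χ ⟨v, hv⟩ = 1 := by rw [h]; rfl
        have h2 : (ZMod.stdAddChar (bitDot b v) : ℂ) = ZMod.stdAddChar (0 : ZMod p) := by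
          rw [AddChar.map_zero_eq_one]; exact this
        exact ZMod.injective_stdAddChar h2
      · intro h
        ext v
        change (ZMod.stdAddChar (bitDot b v.1) : ℂ) = 1
        rw [h v.1 v.2, AddChar.map_zero_eq_one]
    simp only [hχ] at h
    rw [← hcard]
    exact h
  have : ∑ v : U, ∏ k, charFn p t (v.1 k) = ∑ b : ι → Bool, (iidWeight (coin t) b : ℂ) *
      ∑ v : U, (ZMod.stdAddChar (bitDot b v.1) : ℂ) := by
    simp only [Finset.mul_sum]
    rw [Finset.sum_comm]
    exact Finset.sum_congr rfl fun v _ => (sum_iid_mul_char t v.1).symm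
  rw [this, Pr_eq_sum]
  push_cast
  rw [Finset.sum_mul]
  refine Finset.sum_congr rfl fun b _ => ?_
  rw [hind]; split_ifs <;> simp

/-- The distance from a residue to zero. -/
def zdist (x : ZMod p) : ℕ := min x.val (p - x.val)

/-- The squared norm of 1 - t + t e^(iθ) is 1 - 4t(1-t) sin²(θ/2), and Jordan's inequality bounds
the sine below by the distance to zero. -/
theorem normSq_charFn_le {t : ℝ} (h0 : 0 ≤ t) (h1 : t ≤ 1) (x : ZMod p) :
    ‖charFn p t x‖ ^ 2 ≤ 1 - 16 * (t * (1 - t)) * (zdist x : ℝ) ^ 2 / (p : ℝ) ^ 2 := by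
  have hp : 0 < p := (Fact.out : p.Prime).pos
  have hpR : (0 : ℝ) < p := by exact_mod_cast hp
  set θ : ℝ := 2 * Real.pi * x.val / p with hθ
  have hψ : (ZMod.stdAddChar x : ℂ) = Complex.exp (θ * Complex.I) := by
    have := ZMod.stdAddChar_coe (N := p) (x.val : ℤ)
    rw [show (((x.val : ℤ)) : ZMod p) = x by simp] at this
    rw [this, hθ]; push_cast; congr 1; ring
  have hn : ‖charFn p t x‖ ^ 2 = 1 - 4 * (t * (1 - t)) * Real.sin (Real.pi * x.val / p) ^ 2 := by
    have hc : Real.cos θ = 1 - 2 * Real.sin (Real.pi * x.val / p) ^ 2 := by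
      rw [show θ = 2 * (Real.pi * x.val / p) by rw [hθ]; ring, Real.cos_two_mul]
      nlinarith [Real.sin_sq_add_cos_sq (Real.pi * x.val / p)]
    rw [← Complex.normSq_eq_norm_sq, charFn, hψ, Complex.exp_mul_I, Complex.normSq_apply]
    simp only [Complex.add_re, Complex.sub_re, Complex.one_re, Complex.ofReal_re, Complex.mul_re,
      Complex.add_im, Complex.sub_im, Complex.one_im, Complex.ofReal_im, Complex.mul_im,
      ← Complex.ofReal_cos, ← Complex.ofReal_sin, Complex.I_re, Complex.I_im]
    have := Real.sin_sq_add_cos_sq θ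
    ring_nf
    ring_nf at hc
    rw [show Real.sin θ ^ 2 = 1 - Real.cos θ ^ 2 by linarith, hc]
    ring
  have hsin : 2 * (zdist x : ℝ) / p ≤ Real.sin (Real.pi * x.val / p) := by
    have hxp : x.val < p := ZMod.val_lt x
    rcases le_total (2 * x.val) p with h | h
    · have : zdist x = x.val := by unfold zdist; omega
      rw [this]
      have h2 : (2 * x.val : ℝ) ≤ p := by exact_mod_cast h
      have := Real.mul_le_sin (x := Real.pi * x.val / p) (by positivity) (by
        rw [div_le_div_iff₀ hpR two_pos]; nlinarith [Real.pi_pos])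
      refine le_trans (le_of_eq ?_) this
      field_simp
    · have : zdist x = p - x.val := by unfold zdist; omega
      rw [this, ← Real.sin_pi_sub, Nat.cast_sub hxp.le]
      have h2 : (p : ℝ) ≤ 2 * x.val := by exact_mod_cast h
      have h3 : (x.val : ℝ) ≤ p := by exact_mod_cast hxp.le
      have e : Real.pi - Real.pi * x.val / p = Real.pi * (p - x.val) / p := by field_simp
      rw [e]
      have := Real.mul_le_sin (x := Real.pi * (p - x.val) / p)
        (div_nonneg (mul_nonneg Real.pi_pos.le (by linarith)) hpR.le) (by
        rw [div_le_div_iff₀ hpR two_pos]; nlinarith [Real.pi_pos])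
      refine le_trans (le_of_eq ?_) this
      field_simp
  rw [hn]
  have h4 : (2 * (zdist x : ℝ) / p) ^ 2 ≤ Real.sin (Real.pi * x.val / p) ^ 2 :=
    pow_le_pow_left₀ (by positivity) hsin 2
  have h5 : 0 ≤ t * (1 - t) := mul_nonneg h0 (by linarith)
  have h6 := mul_le_mul_of_nonneg_left h4 (by linarith : 0 ≤ 4 * (t * (1 - t)))
  have e : 4 * (t * (1 - t)) * (2 * (zdist x : ℝ) / p) ^ 2 =
    16 * (t * (1 - t)) * (zdist x : ℝ) ^ 2 / (p : ℝ) ^ 2 := by rw [div_pow]; ring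
  linarith

theorem norm_charFn_le_exp {t : ℝ} (h0 : 0 ≤ t) (h1 : t ≤ 1) (x : ZMod p) :
    ‖charFn p t x‖ ≤ Real.exp (-(8 * (t * (1 - t)) * (zdist x : ℝ) ^ 2 / (p : ℝ) ^ 2)) := by
  have h := normSq_charFn_le h0 h1 x
  have h2 := Real.add_one_le_exp (-(16 * (t * (1 - t)) * (zdist x : ℝ) ^ 2 / (p : ℝ) ^ 2))
  refine le_of_sq_le_sq ?_ (Real.exp_pos _).le
  rw [← Real.exp_nat_mul]
  refine h.trans (le_trans (by linarith) (h2.trans (le_of_eq ?_)))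
  congr 1; push_cast; ring

theorem norm_charFn_le_one {t : ℝ} (h0 : 0 ≤ t) (h1 : t ≤ 1) (x : ZMod p) :
    ‖charFn p t x‖ ≤ 1 := by
  refine (norm_charFn_le_exp h0 h1 x).trans (Real.exp_le_one_iff.2 ?_)
  have : 0 ≤ t * (1 - t) := mul_nonneg h0 (by linarith)
  rw [neg_nonpos]; positivity

theorem one_le_zdist {x : ZMod p} (hx : x ≠ 0) : 1 ≤ zdist x := by
  have h1 : x.val ≠ 0 := (ZMod.val_ne_zero x).2 hx
  have h2 : x.val < p := ZMod.val_lt x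
  unfold zdist; omega

/-- The number of nonzero coordinates of a vector. -/
def suppCard {F ι : Type*} [Zero F] [Fintype ι] [DecidableEq F] (v : ι → F) : ℕ :=
  (Finset.univ.filter fun k => v k ≠ 0).card

/-- Every nonzero coordinate is at distance at least one from zero. This worst case is the source of
n/p² in the final error. -/
theorem norm_prod_charFn_le {κ : Type*} [Fintype κ] {t : ℝ} (h0 : 0 ≤ t) (h1 : t ≤ 1)
    (v : κ → ZMod p) :
    ‖∏ k, charFn p t (v k)‖ ≤ Real.exp (-(8 * (t * (1 - t)) * suppCard v / (p : ℝ) ^ 2)) := by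
  rw [norm_prod]
  have h5 : 0 ≤ t * (1 - t) := mul_nonneg h0 (by linarith)
  calc _ ≤ ∏ k, (if v k ≠ 0 then Real.exp (-(8 * (t * (1 - t)) / (p : ℝ) ^ 2)) else 1) := by
        refine Finset.prod_le_prod (fun _ _ => norm_nonneg _) fun k _ => ?_
        split_ifs with h
        · refine (norm_charFn_le_exp h0 h1 (v k)).trans (Real.exp_le_exp.2 (neg_le_neg ?_))
          have : (1 : ℝ) ≤ (zdist (v k) : ℝ) ^ 2 := by
            exact_mod_cast Nat.one_le_pow _ _ (one_le_zdist h)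
          have h6 : 8 * (t * (1 - t)) * 1 ≤ 8 * (t * (1 - t)) * (zdist (v k) : ℝ) ^ 2 :=
            mul_le_mul_of_nonneg_left this (by linarith)
          rw [mul_one] at h6
          gcongr
        · exact norm_charFn_le_one h0 h1 _
    _ = _ := by
        rw [Finset.prod_ite, Finset.prod_const, Finset.prod_const_one, mul_one, ← Real.exp_nat_mul]
        congr 1; simp only [suppCard]; ring

/-- If all nonzero vectors of a subspace have small characteristic function, then a random vector
of bits annihilates it with nearly the uniform probability. -/
theorem abs_Pr_bitDot_sub_le {t : ℝ} (h0 : 0 ≤ t) (h1 : t ≤ 1)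
    (U : Submodule (ZMod p) (ι → ZMod p)) {s : ℕ} (hs : ∀ v ∈ U, v ≠ 0 → s ≤ suppCard v) :
    |Pr (iidWeight (coin t)) (fun b : ι → Bool => ∀ v ∈ U, bitDot b v = 0) -
      1 / (p : ℝ) ^ Module.finrank (ZMod p) U| ≤
      Real.exp (-(8 * (t * (1 - t)) * s / (p : ℝ) ^ 2)) := by
  classical
  set P := Pr (iidWeight (coin t)) (fun b : ι → Bool => ∀ v ∈ U, bitDot b v = 0) with hP
  set D : ℝ := (p : ℝ) ^ Module.finrank (ZMod p) U with hD
  have hp : 0 < p := (Fact.out : p.Prime).pos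
  have hDpos : 0 < D := by rw [hD]; positivity
  have hF := Pr_bitDot_eq_fourier t U
  rw [← hP] at hF
  have h5 : 0 ≤ t * (1 - t) := mul_nonneg h0 (by linarith)
  -- The zero vector supplies the main term 1; each of the other D - 1 terms is small, and the final
  -- division by D cancels their number.
  have e1 : ((P * D - 1 : ℝ) : ℂ) = ∑ v ∈ Finset.univ.erase (0 : U), ∏ k, charFn p t (v.1 k) := by
    have h2 := Finset.add_sum_erase (Finset.univ : Finset U) (fun v => ∏ k, charFn p t (v.1 k))
      (Finset.mem_univ 0)
    have h3 : ∏ k, charFn p t ((0 : U).1 k) = 1 := by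
      refine Finset.prod_eq_one fun k _ => ?_
      simp [charFn]
    rw [h3] at h2
    rw [← h2] at hF
    push_cast [hD]
    rw [hF]; ring
  have e2 : |P * D - 1| ≤ D * Real.exp (-(8 * (t * (1 - t)) * s / (p : ℝ) ^ 2)) := by
    have : |P * D - 1| = ‖((P * D - 1 : ℝ) : ℂ)‖ := by rw [Complex.norm_real, Real.norm_eq_abs]
    rw [this, e1]
    calc _ ≤ ∑ v ∈ Finset.univ.erase (0 : U), ‖∏ k, charFn p t (v.1 k)‖ := norm_sum_le _ _
      _ ≤ ∑ v ∈ Finset.univ.erase (0 : U), Real.exp (-(8 * (t * (1 - t)) * s / (p : ℝ) ^ 2)) := by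
          refine Finset.sum_le_sum fun v hv => ?_
          refine (norm_prod_charFn_le h0 h1 _).trans (Real.exp_le_exp.2 (neg_le_neg ?_))
          have : s ≤ suppCard v.1 := hs v.1 v.2 (by
            intro h; exact (Finset.ne_of_mem_erase hv) (Subtype.ext h))
          gcongr
      _ ≤ ∑ v : U, Real.exp (-(8 * (t * (1 - t)) * s / (p : ℝ) ^ 2)) :=
          Finset.sum_le_sum_of_subset_of_nonneg (Finset.erase_subset _ _)
            fun _ _ _ => (Real.exp_pos _).le
      _ = _ := by
          rw [Finset.sum_const, nsmul_eq_mul, Finset.card_univ,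
            Module.card_eq_pow_finrank (K := ZMod p) (V := U), ZMod.card]
          push_cast; rfl
  have e3 : P - 1 / D = (P * D - 1) / D := by field_simp
  rw [e3, abs_div, abs_of_pos hDpos, div_le_iff₀ hDpos]
  linarith

/-- Every distance is k or p - k, so two copies of ∑ 1/k² ≤ 2 suffice. The bound is uniform in p. -/
theorem sum_inv_zdist_sq_le :
    ∑ x ∈ Finset.univ.erase (0 : ZMod p), ((zdist x : ℝ) ^ 2)⁻¹ ≤ 4 := by
  have hp : p.Prime := Fact.out
  have h1 : ∑ x ∈ Finset.univ.erase (0 : ZMod p), ((zdist x : ℝ) ^ 2)⁻¹ =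
      ∑ k ∈ Finset.Ioo 0 p, (((min k (p - k) : ℕ) : ℝ) ^ 2)⁻¹ := by
    refine Finset.sum_bij (fun x _ => x.val) ?_ ?_ ?_ ?_
    · intro x hx
      have h1 : x.val ≠ 0 := (ZMod.val_ne_zero x).2 (Finset.ne_of_mem_erase hx)
      have h2 : x.val < p := ZMod.val_lt x
      rw [Finset.mem_Ioo]; omega
    · intro x _ y _ h; exact ZMod.val_injective p h
    · intro k hk
      rw [Finset.mem_Ioo] at hk
      refine ⟨(k : ZMod p), ?_, ZMod.val_cast_of_lt hk.2⟩
      refine Finset.mem_erase.2 ⟨fun h => ?_, Finset.mem_univ _⟩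
      have := ZMod.val_cast_of_lt hk.2
      rw [h, ZMod.val_zero] at this; omega
    · intro x _; rfl
  have h2 : ∑ k ∈ Finset.Ioo 0 p, ((k : ℝ) ^ 2)⁻¹ ≤ 2 := by
    simpa using sum_Ioo_inv_sq_le (α := ℝ) 0 p
  have h3 : ∑ k ∈ Finset.Ioo 0 p, (((p - k : ℕ) : ℝ) ^ 2)⁻¹ ≤ 2 := by
    refine le_trans (le_of_eq ?_) h2
    refine Finset.sum_bij' (fun k _ => p - k) (fun k _ => p - k) ?_ ?_ ?_ ?_ ?_ <;>
      intro k hk <;> rw [Finset.mem_Ioo] at hk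
    · rw [Finset.mem_Ioo]; omega
    · rw [Finset.mem_Ioo]; omega
    · omega
    · omega
  rw [h1]
  refine (Finset.sum_le_sum (g := fun k : ℕ => ((k : ℝ) ^ 2)⁻¹ + (((p - k : ℕ) : ℝ) ^ 2)⁻¹)
    fun k _ => ?_).trans ?_
  · rcases min_choice k (p - k) with h | h <;> rw [h]
    · exact le_add_of_nonneg_right (by positivity)
    · exact le_add_of_nonneg_left (by positivity)
  · rw [Finset.sum_add_distrib]; linarith

/-- AM–GM trades a product over the different points ξ v_k for powers at single points. As ξ ↦ ξ v_k
permutes the nonzero residues, the sum over ξ then no longer depends on v. -/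
theorem prod_le_avg_pow {κ : Type*} (s : Finset κ) (hs : s.Nonempty) (f : κ → ℝ) (hf : ∀ k, 0 ≤ f k) :
    ∏ k ∈ s, f k ≤ (∑ k ∈ s, f k ^ s.card) / s.card := by
  have hc : s.card ≠ 0 := Finset.card_ne_zero.2 hs
  have hc' : (s.card : ℝ) ≠ 0 := by exact_mod_cast hc
  have := Real.geom_mean_le_arith_mean_weighted s (fun _ => (s.card : ℝ)⁻¹)
    (fun k => f k ^ s.card) (fun _ _ => by positivity) (by simp [hc'])
    (fun k _ => pow_nonneg (hf k) _)
  simp only [Real.pow_rpow_inv_natCast (hf _) hc] at this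
  rw [← Finset.mul_sum] at this
  rw [div_eq_inv_mul]; exact this

/-- A Littlewood–Offord bound modulo `p`. -/
theorem Pr_bitDot_eq_zero_le_inv {t : ℝ} (h0 : 0 < t) (h1 : t < 1) {v : ι → ZMod p} {s : ℕ}
    (hs0 : 0 < s) (hs : s ≤ suppCard v) :
    Pr (iidWeight (coin t)) (fun b : ι → Bool => bitDot b v = 0) ≤
      (1 + 1 / (2 * (t * (1 - t))) * ((p : ℝ) ^ 2 / s)) / p := by
  set P := Pr (iidWeight (coin t)) (fun b : ι → Bool => bitDot b v = 0) with hP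
  have hp : 0 < p := (Fact.out : p.Prime).pos
  have hpR : (0 : ℝ) < p := by exact_mod_cast hp
  have ht : 0 < t * (1 - t) := mul_pos h0 (by linarith)
  set S := Finset.univ.filter fun k => v k ≠ 0 with hS
  have hScard : S.card = suppCard v := rfl
  have hsS : (s : ℝ) ≤ S.card := by rw [hScard]; exact_mod_cast hs
  have hsR : (0 : ℝ) < s := by exact_mod_cast hs0
  have hSne : S.Nonempty := Finset.card_pos.1 (by omega)
  have e1 : ((P * p : ℝ) : ℂ) = ∑ ξ : ZMod p, ∏ k, charFn p t (ξ * v k) := by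
    have : ∀ ξ : ZMod p, ∏ k, charFn p t (ξ * v k) = ∑ b : ι → Bool,
        (iidWeight (coin t) b : ℂ) * ZMod.stdAddChar (ξ * bitDot b v) := by
      intro ξ
      have := sum_iid_mul_char (p := p) t (ξ • v)
      simp only [map_smul, smul_eq_mul, Pi.smul_apply] at this
      exact this.symm
    simp only [this]
    rw [Finset.sum_comm, hP, Pr_eq_sum]
    push_cast
    rw [Finset.sum_mul]
    refine Finset.sum_congr rfl fun b _ => ?_
    rw [← Finset.mul_sum, AddChar.sum_mulShift _ (ZMod.isPrimitive_stdAddChar p), ZMod.card]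
    split_ifs <;> simp
  have e2 : P * p ≤ 1 + ∑ ξ ∈ Finset.univ.erase (0 : ZMod p), ∏ k, ‖charFn p t (ξ * v k)‖ := by
    have h2 : P * p ≤ ‖((P * p : ℝ) : ℂ)‖ := by rw [Complex.norm_real]; exact le_abs_self _
    rw [e1, ← Finset.add_sum_erase _ _ (Finset.mem_univ (0 : ZMod p))] at h2
    refine h2.trans ((norm_add_le _ _).trans (add_le_add ?_ ?_))
    · simp [charFn]
    · exact (norm_sum_le _ _).trans (le_of_eq (by simp only [norm_prod]))
  have e3 : ∀ ξ : ZMod p, ∏ k, ‖charFn p t (ξ * v k)‖ ≤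
      (∑ k ∈ S, ‖charFn p t (ξ * v k)‖ ^ S.card) / S.card := by
    intro ξ
    refine le_trans ?_ (prod_le_avg_pow S hSne _ fun _ => norm_nonneg _)
    rw [← Finset.prod_mul_prod_compl S]
    exact mul_le_of_le_one_right (Finset.prod_nonneg fun _ _ => norm_nonneg _)
      (Finset.prod_le_one (fun _ _ => norm_nonneg _)
        fun _ _ => norm_charFn_le_one h0.le h1.le _)
  set a : ℝ := 8 * (t * (1 - t)) with ha
  have hapos : 0 < a := by positivity
  have e4 : ∀ x ∈ Finset.univ.erase (0 : ZMod p), ‖charFn p t x‖ ^ S.card ≤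
      (p : ℝ) ^ 2 / (a * s) * ((zdist x : ℝ) ^ 2)⁻¹ := by
    intro x hx
    have hx0 : (1 : ℝ) ≤ zdist x := by exact_mod_cast one_le_zdist (Finset.ne_of_mem_erase hx)
    have h3 := pow_le_pow_left₀ (norm_nonneg _) (norm_charFn_le_exp h0.le h1.le x) S.card
    rw [← Real.exp_nat_mul] at h3
    refine h3.trans ?_
    set y : ℝ := a * s * (zdist x : ℝ) ^ 2 / (p : ℝ) ^ 2 with hy
    have hypos : 0 < y := by positivity
    have h4 : (S.card : ℝ) * -(a * (zdist x : ℝ) ^ 2 / (p : ℝ) ^ 2) ≤ -y := by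
      have : s * (a * (zdist x : ℝ) ^ 2 / (p : ℝ) ^ 2) ≤
        S.card * (a * (zdist x : ℝ) ^ 2 / (p : ℝ) ^ 2) := by gcongr
      have e : y = s * (a * (zdist x : ℝ) ^ 2 / (p : ℝ) ^ 2) := by rw [hy]; ring
      linarith
    refine (Real.exp_le_exp.2 h4).trans ?_
    -- This crude decay is enough, because the inverse squares of the distances have a bounded sum.
    have h5 : Real.exp (-y) ≤ y⁻¹ := by
      rw [Real.exp_neg]
      have := Real.add_one_le_exp y
      gcongr; linarith
    refine h5.trans (le_of_eq ?_)
    rw [hy]; field_simp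
  have e5 : ∀ k ∈ S, ∑ ξ ∈ Finset.univ.erase (0 : ZMod p), ‖charFn p t (ξ * v k)‖ ^ S.card ≤
      4 * ((p : ℝ) ^ 2 / (a * s)) := by
    intro k hk
    have hvk : v k ≠ 0 := (Finset.mem_filter.1 hk).2
    have : ∑ ξ ∈ Finset.univ.erase (0 : ZMod p), ‖charFn p t (ξ * v k)‖ ^ S.card =
        ∑ x ∈ Finset.univ.erase (0 : ZMod p), ‖charFn p t x‖ ^ S.card := by
      refine Finset.sum_bij' (fun ξ _ => ξ * v k) (fun x _ => x / v k) ?_ ?_ ?_ ?_ ?_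
      · intro ξ hξ; simpa [hvk] using hξ
      · intro ξ hξ; simpa [hvk] using hξ
      · intro ξ _; field_simp
      · intro ξ _; field_simp
      · intro ξ _; rfl
    rw [this]
    refine (Finset.sum_le_sum e4).trans ?_
    rw [← Finset.mul_sum, mul_comm]
    exact mul_le_mul_of_nonneg_right sum_inv_zdist_sq_le (by positivity)
  have hS0 : (0 : ℝ) < S.card := lt_of_lt_of_le hsR hsS
  have e6 : ∑ ξ ∈ Finset.univ.erase (0 : ZMod p), ∏ k, ‖charFn p t (ξ * v k)‖ ≤
      4 * ((p : ℝ) ^ 2 / (a * s)) := by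
    refine (Finset.sum_le_sum fun ξ _ => e3 ξ).trans ?_
    rw [← Finset.sum_div, Finset.sum_comm, div_le_iff₀ hS0]
    refine (Finset.sum_le_sum e5).trans (le_of_eq ?_)
    rw [Finset.sum_const, nsmul_eq_mul]; ring
  rw [le_div_iff₀ hpR]
  refine e2.trans (add_le_add le_rfl (e6.trans (le_of_eq ?_)))
  rw [ha]; field_simp; norm_num

end Fourier

/-! ### Exposing the rows one at a time -/

section Chains

variable {F ι E : Type*} [Field F] [Fintype ι] [AddCommGroup E] [Module F E]

/-- The vectors of `K` on which all the forms `w ↦ bitDot (B j) (T j w)` vanish. -/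
def cut {J : Type*} (T : J → E →ₗ[F] (ι → F)) (K : Submodule F E) (B : J → ι → Bool) :
    Submodule F E :=
  K ⊓ ⨅ j, LinearMap.ker (bitDot (B j) ∘ₗ T j)

section Cut

variable {J : Type*} {T : J → E →ₗ[F] (ι → F)} {K : Submodule F E} {B : J → ι → Bool}

theorem mem_cut {w : E} : w ∈ cut T K B ↔ w ∈ K ∧ ∀ j, bitDot (B j) (T j w) = 0 := by
  simp [cut, Submodule.mem_iInf]

theorem cut_le : cut T K B ≤ K := inf_le_left

end Cut

/-- The first row is absorbed into K; all inductions on `cut` run through this identity. -/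
theorem cut_cons {r : ℕ} (T : Fin (r + 1) → E →ₗ[F] (ι → F)) (K : Submodule F E) (b : ι → Bool)
    (B : Fin r → ι → Bool) :
    cut T K (Fin.cons b B : Fin (r + 1) → ι → Bool) =
      cut (fun j => T j.succ) (K ⊓ LinearMap.ker (bitDot b ∘ₗ T 0)) B := by
  ext w
  simp [mem_cut, Fin.forall_fin_succ, and_assoc]

theorem cut_zero (T : Fin 0 → E →ₗ[F] (ι → F)) (K : Submodule F E) (B : Fin 0 → ι → Bool) :
    cut T K B = K := by
  ext w; simp [mem_cut]

theorem Pr_kill_le [DecidableEq ι] {t : ℝ} (h0 : 0 ≤ t) (h1 : t ≤ 1) (T : E →ₗ[F] (ι → F)) (K : Submodule F E) :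
    Pr (iidWeight (coin t)) (fun b : ι → Bool => ∀ w ∈ K, (bitDot b ∘ₗ T) w = 0) ≤
      coinMax t ^ Module.finrank F (K.map T) := by
  refine le_trans (le_of_eq (Pr_congr fun b => ?_)) (Pr_bitDot_le h0 h1 (K.map T))
  simp

theorem finrank_map_add [FiniteDimensional F E] {E' : Type*} [AddCommGroup E'] [Module F E']
    (T : E →ₗ[F] E') (K : Submodule F E) :
    Module.finrank F (K.map T) + Module.finrank F ↥(K ⊓ LinearMap.ker T) = Module.finrank F K := by
  have e1 := (T.domRestrict K).finrank_range_add_finrank_ker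
  have e2 : (LinearMap.ker (T.domRestrict K)).map K.subtype = K ⊓ LinearMap.ker T := by
    ext w
    simp only [Submodule.mem_map, LinearMap.mem_ker, Submodule.mem_inf]
    constructor
    · rintro ⟨x, hx, rfl⟩; exact ⟨x.2, hx⟩
    · rintro ⟨h1, h2⟩; exact ⟨⟨w, h1⟩, h2, rfl⟩
  have e3 := (Submodule.equivMapOfInjective _ K.injective_subtype
    (LinearMap.ker (T.domRestrict K))).finrank_eq
  rw [e2] at e3
  rw [LinearMap.range_domRestrict] at e1
  omega

theorem coinMax_le_one {t : ℝ} (h0 : 0 ≤ t) (h1 : t ≤ 1) : coinMax t ≤ 1 :=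
  max_le h1 (by linarith)

/-- If the forms are far from degenerate on `K`, then every step lowers the dimension. -/
theorem Pr_finrank_cut_ne_le [DecidableEq ι] [FiniteDimensional F E]
    {t : ℝ} (h0 : 0 ≤ t) (h1 : t ≤ 1) {r D N : ℕ}
    (T : Fin r → E →ₗ[F] (ι → F)) (K : Submodule F E)
    (hD : ∀ j, Module.finrank F ↥(K ⊓ LinearMap.ker (T j)) ≤ D)
    (hK : r + D + N ≤ Module.finrank F K) :
    Pr (iidWeight (iidWeight (coin t)))
      (fun B => Module.finrank F (cut T K B) + r ≠ Module.finrank F K) ≤ r * coinMax t ^ N := by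
  have hc := (isProb_coin h0 h1).iid (ι := ι)
  induction r generalizing K with
  | zero => rw [Pr_iid_zero _ False (by intro B; rw [cut_zero]; simp)]; simp
  | succ r ih =>
    rw [Pr_iid_succ]
    have hpow : 0 ≤ (r : ℝ) * coinMax t ^ N :=
      mul_nonneg (Nat.cast_nonneg r) (pow_nonneg (coinMax_pos t).le N)
    refine (sum_mul_ite_le (Q := fun b => ∀ w ∈ K, (bitDot b ∘ₗ T 0) w = 0) hc hpow
      (fun b => Pr_le_one hc.iid _) ?_ (a := coinMax t ^ N) ?_).trans (le_of_eq ?_)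
    · intro b hb
      have hdim := finrank_inf_ker_add_one K _ hb
      set K' := K ⊓ LinearMap.ker (bitDot b ∘ₗ T 0) with hK'
      refine le_trans (le_of_eq (Pr_congr fun B => ?_)) (ih (fun j => T j.succ) K' ?_ (by omega))
      · rw [cut_cons, ← hK']; omega
      · intro j
        exact (Submodule.finrank_mono (inf_le_inf_right _ inf_le_left)).trans (hD j.succ)
    -- At this point K has dimension more than D + N, of which at most D is lost in the kernel of T
    -- 0, so the image has dimension at least N.
    · refine (Pr_kill_le h0 h1 _ _).trans
        (pow_le_pow_of_le_one (coinMax_pos t).le (coinMax_le_one h0 h1) ?_)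
      have := finrank_map_add (T 0) K
      have := hD 0
      omega
    · push_cast; ring

theorem finrank_cut_add_ge [FiniteDimensional F E] {r : ℕ} (T : Fin r → E →ₗ[F] (ι → F))
    (K : Submodule F E) (B : Fin r → ι → Bool) :
    Module.finrank F K ≤ Module.finrank F (cut T K B) + r := by
  induction r generalizing K with
  | zero => rw [cut_zero]; omega
  | succ r ih =>
    rw [← Fin.cons_self_tail B, cut_cons]
    have := ih (fun j => T j.succ) (K ⊓ LinearMap.ker (bitDot (B 0) ∘ₗ T 0)) (Fin.tail B)
    by_cases h : ∀ w ∈ K, (bitDot (B 0) ∘ₗ T 0) w = 0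
    · rw [finrank_inf_ker_of_le K _ h] at this ⊢; omega
    · have := finrank_inf_ker_add_one K _ h; omega

/-- A random system of `r` linear forms leaves a solution space of dimension at most `N` when the
space has dimension at most `r + N`. -/
theorem Pr_lt_finrank_cut_le [DecidableEq ι] [FiniteDimensional F E]
    {t : ℝ} (h0 : 0 ≤ t) (h1 : t ≤ 1) {r N : ℕ}
    (T : Fin r → E →ₗ[F] (ι → F)) (K : Submodule F E) (hT : ∀ j, LinearMap.ker (T j) = ⊥)
    (hK : Module.finrank F K ≤ r + N) :
    Pr (iidWeight (iidWeight (coin t)))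
      (fun B => N < Module.finrank F (cut T K B)) ≤ r * coinMax t ^ N := by
  have hc := (isProb_coin h0 h1).iid (ι := ι)
  induction r generalizing K with
  | zero => rw [Pr_iid_zero _ False (by intro B; rw [cut_zero]; simp; omega)]; simp
  | succ r ih =>
    have hpow : 0 ≤ (r : ℝ) * coinMax t ^ N :=
      mul_nonneg (Nat.cast_nonneg r) (pow_nonneg (coinMax_pos t).le N)
    have hpow' : 0 ≤ coinMax t ^ N := pow_nonneg (coinMax_pos t).le N
    -- Once the dimension has fallen to N nothing remains to prove; until then a row fails to lower
    -- it with probability at most ρ^N, where ρ = `coinMax t`.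
    rcases le_or_gt (Module.finrank F K) N with hN | hN
    · rw [Pr_congr (Q := fun _ => False), Pr_false]
      · positivity
      · intro B
        have := Submodule.finrank_mono (cut_le (T := T) (K := K) (B := B))
        simp; omega
    rw [Pr_iid_succ]
    refine (sum_mul_ite_le (Q := fun b => ∀ w ∈ K, (bitDot b ∘ₗ T 0) w = 0) hc hpow
      (fun b => Pr_le_one hc.iid _) ?_ (a := coinMax t ^ N) ?_).trans (le_of_eq ?_)
    · intro b hb
      have hdim := finrank_inf_ker_add_one K _ hb
      refine le_trans (le_of_eq (Pr_congr fun B => ?_))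
        (ih (fun j => T j.succ) (K ⊓ LinearMap.ker (bitDot b ∘ₗ T 0)) (fun j => hT _) (by omega))
      rw [cut_cons]
    · refine (Pr_kill_le h0 h1 _ _).trans
        (pow_le_pow_of_le_one (coinMax_pos t).le (coinMax_le_one h0 h1) ?_)
      have := finrank_map_add (T 0) K
      rw [hT 0, inf_bot_eq, finrank_bot] at this
      omega
    · push_cast; ring

open Classical in
/-- The vectors of `Y` that are annihilated by those vectors of bits whose coordinate sum
vanishes. -/
def balancedCut {r : ℕ} (Y : Submodule F (ι → F)) (A : Fin r → ι → Bool) : Submodule F (ι → F) :=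
  Y ⊓ ⨅ i, if bitDot (A i) (1 : ι → F) = 0 then LinearMap.ker (bitDot (A i)) else ⊤

theorem mem_balancedCut {r : ℕ} {Y : Submodule F (ι → F)} {A : Fin r → ι → Bool} {y : ι → F} :
    y ∈ balancedCut Y A ↔ y ∈ Y ∧ ∀ i, bitDot (A i) (1 : ι → F) = 0 → bitDot (A i) y = 0 := by
  simp only [balancedCut, Submodule.mem_inf, Submodule.mem_iInf]
  refine and_congr_right fun _ => forall_congr' fun i => ?_
  split_ifs with h <;> simp [h]

open Classical in
/-- The number of vectors of bits whose coordinate sum vanishes. -/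
def balancedCount (F : Type*) [Field F] {r : ℕ} (A : Fin r → ι → Bool) : ℕ :=
  ∑ i, if bitDot (A i) (1 : ι → F) = 0 then 1 else 0

/-- Only balanced rows lower the dimension. As long as at most z of them occur, N dimensions remain,
so Odlyzko's lemma makes each new one independent. The number of balanced rows is random, hence its
bound is part of the event. -/
theorem Pr_finrank_balancedCut_ne_le [DecidableEq ι] {t : ℝ} (h0 : 0 ≤ t) (h1 : t ≤ 1) {r z N : ℕ}
    (Y : Submodule F (ι → F)) (hY : z + N ≤ Module.finrank F Y) :
    Pr (iidWeight (iidWeight (coin t))) (fun A : Fin r → ι → Bool => balancedCount F A ≤ z ∧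
      Module.finrank F (balancedCut Y A) + balancedCount F A ≠ Module.finrank F Y) ≤
      r * coinMax t ^ N := by
  have hc := (isProb_coin h0 h1).iid (ι := ι)
  induction r generalizing Y z with
  | zero =>
    rw [Pr_iid_zero _ False]
    · simp
    · intro A
      have : balancedCut Y A = Y := by ext; simp [mem_balancedCut]
      rw [this]; simp [balancedCount]
  | succ r ih =>
    have hpow : 0 ≤ (r : ℝ) * coinMax t ^ N :=
      mul_nonneg (Nat.cast_nonneg r) (pow_nonneg (coinMax_pos t).le N)
    rw [Pr_iid_succ]
    refine (sum_mul_ite_le (Q := fun b => ∀ w ∈ Y, (bitDot b ∘ₗ LinearMap.id) w = 0) hc hpow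
      (fun b => Pr_le_one hc.iid _) ?_ (a := coinMax t ^ N) ?_).trans (le_of_eq ?_)
    · intro b hb
      by_cases hs : bitDot b (1 : ι → F) = 0
      · have hdim := finrank_inf_ker_add_one Y _ hb
        rw [LinearMap.comp_id] at hdim
        set Y' := Y ⊓ LinearMap.ker (bitDot b) with hY'
        have hcut : ∀ B : Fin r → ι → Bool,
            balancedCut Y (Fin.cons b B : Fin (r + 1) → ι → Bool) = balancedCut Y' B := by
          intro B; ext y
          simp [mem_balancedCut, Fin.forall_fin_succ, hs, hY', and_assoc]
        have hcount : ∀ B : Fin r → ι → Bool,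
            balancedCount F (Fin.cons b B : Fin (r + 1) → ι → Bool) = 1 + balancedCount F B := by
          intro B
          simp only [balancedCount, Fin.sum_univ_succ, Fin.cons_zero, Fin.cons_succ, hs, if_true]
          rfl
        rcases Nat.eq_zero_or_pos z with hz | hz
        · rw [Pr_congr (Q := fun _ => False), Pr_false]
          · exact hpow
          · intro B; rw [hcount]; simp; omega
        · refine le_trans (le_of_eq (Pr_congr fun B => ?_)) (ih (z := z - 1) Y' (by omega))
          rw [hcut, hcount]
          constructor <;> rintro ⟨h3, h4⟩ <;> constructor <;> omega
      · have hcut : ∀ B : Fin r → ι → Bool,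
            balancedCut Y (Fin.cons b B : Fin (r + 1) → ι → Bool) = balancedCut Y B := by
          intro B; ext y
          simp [mem_balancedCut, Fin.forall_fin_succ, hs]
        have hcount : ∀ B : Fin r → ι → Bool,
            balancedCount F (Fin.cons b B : Fin (r + 1) → ι → Bool) = balancedCount F B := by
          intro B
          simp only [balancedCount, Fin.sum_univ_succ, Fin.cons_zero, Fin.cons_succ, hs, if_false,
            zero_add]
          rfl
        refine le_trans (le_of_eq (Pr_congr fun B => ?_)) (ih Y hY)
        rw [hcut, hcount]
    · refine (Pr_kill_le h0 h1 _ _).trans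
        (pow_le_pow_of_le_one (coinMax_pos t).le (coinMax_le_one h0 h1) ?_)
      rw [Submodule.map_id]; omega
    · push_cast; ring

end Chains

/-! ### The uniform corank law and the comparison with it -/

/-- The probability that `r` independent uniform vectors in a `d`-dimensional space over a field
with `1 / x` elements span a subspace of codimension `k`. -/
def uniformCorank (x : ℝ) (k : ℕ) : ℕ → ℕ → ℝ
  | d, 0 => if d = k then 1 else 0
  -- A uniform row vanishes on the remaining d dimensions with probability x^d. For d = 0 the
  -- truncated d - 1 is harmless, since its weight 1 - x^0 is zero.
  | d, r + 1 => x ^ d * uniformCorank x k d r + (1 - x ^ d) * uniformCorank x k (d - 1) r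

theorem uniformCorank_mem {x : ℝ} (hx0 : 0 ≤ x) (hx1 : x ≤ 1) (k d r : ℕ) :
    0 ≤ uniformCorank x k d r ∧ uniformCorank x k d r ≤ 1 := by
  induction r generalizing d with
  | zero => unfold uniformCorank; split_ifs <;> simp
  | succ r ih =>
    have h1 := ih d
    have h2 := ih (d - 1)
    have h3 : 0 ≤ x ^ d := pow_nonneg hx0 d
    have h4 : x ^ d ≤ 1 := pow_le_one₀ hx0 hx1
    unfold uniformCorank
    constructor
    · have := mul_nonneg h3 h1.1
      have := mul_nonneg (sub_nonneg.2 h4) h2.1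
      linarith
    · have := mul_le_mul_of_nonneg_left h1.2 h3
      have := mul_le_mul_of_nonneg_left h2.2 (sub_nonneg.2 h4)
      linarith

section FinalChain

variable {p : ℕ} [Fact p.Prime] {ι E : Type*} [Fintype ι] [DecidableEq ι] [AddCommGroup E]
  [Module (ZMod p) E] [FiniteDimensional (ZMod p) E]

/-- The dimension of the solution space of a random system that is unstructured on `K` has nearly
the law of the corank of a uniform matrix. -/
theorem abs_Pr_finrank_cut_sub_le {t : ℝ} (h0 : 0 ≤ t) (h1 : t ≤ 1) {r d s : ℕ} (k : ℕ)
    (T : Fin r → E →ₗ[ZMod p] (ι → ZMod p)) (K : Submodule (ZMod p) E) {e : E} (he0 : e ≠ 0)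
    (he : e ∈ K) (heT : ∀ j, T j e = 0)
    (hker : ∀ j, ∀ w ∈ K, T j w = 0 → w ∈ Submodule.span (ZMod p) {e})
    (hs : ∀ j, ∀ w ∈ K, T j w ≠ 0 → s ≤ suppCard (T j w))
    (hK : Module.finrank (ZMod p) K = d + 1) (hr : r ≤ d + 1) :
    |Pr (iidWeight (iidWeight (coin t))) (fun B => Module.finrank (ZMod p) (cut T K B) = k + 1) -
      uniformCorank (1 / p) k d r| ≤ ∑ i ∈ Finset.range r,
        min (Real.exp (-(8 * (t * (1 - t)) * s / (p : ℝ) ^ 2))) (coinMax t ^ i) := by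
  have hc := (isProb_coin h0 h1).iid (ι := ι)
  have hp1 : (1 : ℝ) < p := by exact_mod_cast (Fact.out : p.Prime).one_lt
  have hp0 : (0 : ℝ) < p := by linarith
  have hx0 : 0 ≤ 1 / (p : ℝ) := by positivity
  have hx1 : 1 / (p : ℝ) ≤ 1 := by rw [div_le_one hp0]; exact hp1.le
  induction r generalizing K d with
  | zero =>
    rw [Pr_iid_zero _ (d = k) (by intro B; rw [cut_zero, hK]; omega)]
    simp [uniformCorank]
  | succ r ih =>
    classical
    set ε := Real.exp (-(8 * (t * (1 - t)) * s / (p : ℝ) ^ 2)) with hε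
    set S := ∑ i ∈ Finset.range r, min ε (coinMax t ^ i) with hS
    set Q : (ι → Bool) → Prop := fun b => ∀ w ∈ K, (bitDot b ∘ₗ T 0) w = 0 with hQ
    have hkerK : K ⊓ LinearMap.ker (T 0) = Submodule.span (ZMod p) {e} := by
      refine le_antisymm (fun w hw => hker 0 w hw.1 hw.2) ?_
      rw [Submodule.span_singleton_le_iff_mem]
      exact ⟨he, heT 0⟩
    have hmap : Module.finrank (ZMod p) (K.map (T 0)) = d := by
      have := finrank_map_add (T 0) K
      rw [hkerK, finrank_span_singleton he0] at this
      omega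
    -- Fourier inversion gives ε. The alternative uses d ≥ r, where r rows are still to come: both
    -- probabilities are at most ρ^d ≤ ρ^r, with ρ = `coinMax t`. Its geometric decay keeps the
    -- total error independent of the number of rows.
    have hπ : |Pr (iidWeight (coin t)) Q - (1 / (p : ℝ)) ^ d| ≤ min ε (coinMax t ^ r) := by
      refine le_min ?_ ?_
      · have := abs_Pr_bitDot_sub_le h0 h1 (K.map (T 0)) (s := s) (by
          rintro _ ⟨w, hw, rfl⟩ hne; exact hs 0 w hw hne)
        rw [hmap, ← one_div_pow] at this
        rwa [Pr_congr (Q := Q) fun b => by simp [hQ]] at this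
      · have h3 := Pr_kill_le h0 h1 (T 0) K
        rw [hmap] at h3
        have h4 : (1 / (p : ℝ)) ^ d ≤ coinMax t ^ d := by
          refine pow_le_pow_left₀ hx0 ((le_trans ?_ (half_le_coinMax t))) d
          have : (2 : ℝ) ≤ p := by exact_mod_cast (Fact.out : p.Prime).two_le
          exact one_div_le_one_div_of_le two_pos this
        have h5 : coinMax t ^ d ≤ coinMax t ^ r :=
          pow_le_pow_of_le_one (coinMax_pos t).le (coinMax_le_one h0 h1) (by omega)
        have h6 : 0 ≤ (1 / (p : ℝ)) ^ d := pow_nonneg hx0 d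
        have h7 := Pr_nonneg hc Q
        rw [abs_le]; constructor <;> linarith
    set g1 := uniformCorank (1 / p) k d r with hg1
    set g2 := uniformCorank (1 / p) k (d - 1) r with hg2
    have hstep : ∀ b : ι → Bool, |Pr (iidWeight (iidWeight (coin t)))
        (fun B => Module.finrank (ZMod p) (cut T K (Fin.cons b B : Fin (r + 1) → ι → Bool)) =
          k + 1) - (if Q b then g1 else g2)| ≤ S := by
      intro b
      rw [Pr_congr fun B => by rw [cut_cons]]
      split_ifs with hb
      · rw [finrank_inf_ker_of_le K _ hb]
        exact ih (fun j => T j.succ) K he (fun j => heT _) (fun j => hker _) (fun j => hs _) hK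
          (by omega)
      · have hdim := finrank_inf_ker_add_one K _ hb
        -- For d = 0 every row vanishes on K, so in this branch d - 1 is a genuine subtraction.
        have hd : d ≠ 0 := by
          rintro rfl
          refine hb fun w hw => ?_
          have hbot : K.map (T 0) = ⊥ := Submodule.finrank_eq_zero.1 hmap
          have : T 0 w ∈ K.map (T 0) := ⟨w, hw, rfl⟩
          rw [hbot, Submodule.mem_bot] at this
          simp [this]
        exact ih (fun j => T j.succ) (K ⊓ LinearMap.ker (bitDot b ∘ₗ T 0))
          ⟨he, by simp [heT]⟩ (fun j => heT _) (fun j w hw => hker _ w hw.1)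
          (fun j w hw => hs _ w hw.1) (by omega) (by omega)
    have hsum : ∑ b : ι → Bool, iidWeight (coin t) b * (if Q b then g1 else g2) =
        Pr (iidWeight (coin t)) Q * g1 + (1 - Pr (iidWeight (coin t)) Q) * g2 := by
      have h2 := Pr_add_Pr_not hc Q
      rw [← h2, add_sub_cancel_left, Pr_eq_sum, Pr_eq_sum, Finset.sum_mul, Finset.sum_mul,
        ← Finset.sum_add_distrib]
      refine Finset.sum_congr rfl fun b _ => ?_
      by_cases hb : Q b <;> simp [hb]
    rw [Pr_iid_succ, Finset.sum_range_succ, ← hS]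
    have h8 : |∑ b : ι → Bool, iidWeight (coin t) b * Pr (iidWeight (iidWeight (coin t)))
        (fun B => Module.finrank (ZMod p) (cut T K (Fin.cons b B : Fin (r + 1) → ι → Bool)) =
          k + 1) - ∑ b : ι → Bool, iidWeight (coin t) b * (if Q b then g1 else g2)| ≤ S := by
      rw [← Finset.sum_sub_distrib]
      refine (Finset.abs_sum_le_sum_abs _ _).trans ?_
      calc _ ≤ ∑ b : ι → Bool, iidWeight (coin t) b * S := by
            refine Finset.sum_le_sum fun b _ => ?_
            rw [← mul_sub, abs_mul, abs_of_nonneg (hc.nonneg b)]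
            exact mul_le_mul_of_nonneg_left (hstep b) (hc.nonneg b)
        _ = S := by rw [← Finset.sum_mul, hc.sum_eq, one_mul]
    rw [hsum] at h8
    -- The two mixtures differ only in the probability of vanishing, and g1, g2 lie in [0, 1].
    have h9 : |(Pr (iidWeight (coin t)) Q * g1 + (1 - Pr (iidWeight (coin t)) Q) * g2) -
        ((1 / (p : ℝ)) ^ d * g1 + (1 - (1 / (p : ℝ)) ^ d) * g2)| ≤ min ε (coinMax t ^ r) := by
      have e : (Pr (iidWeight (coin t)) Q * g1 + (1 - Pr (iidWeight (coin t)) Q) * g2) -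
        ((1 / (p : ℝ)) ^ d * g1 + (1 - (1 / (p : ℝ)) ^ d) * g2) =
        (Pr (iidWeight (coin t)) Q - (1 / (p : ℝ)) ^ d) * (g1 - g2) := by ring
      have hg1' := uniformCorank_mem hx0 hx1 k d r
      have hg2' := uniformCorank_mem hx0 hx1 k (d - 1) r
      have h10 : |g1 - g2| ≤ 1 := by
        rw [abs_le]; constructor <;> linarith [hg1'.1, hg1'.2, hg2'.1, hg2'.2]
      rw [e, abs_mul]
      exact (mul_le_of_le_one_right (abs_nonneg _) h10).trans hπ
    have h11 := abs_add_le _ _ |>.trans (add_le_add h8 h9)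
    rw [sub_add_sub_cancel] at h11
    exact h11

end FinalChain

/-- The product `∏_{j ≤ i < j + n} (1 - x ^ i)`. -/
def qProd (x : ℝ) (j n : ℕ) : ℝ := ∏ i ∈ Finset.range n, (1 - x ^ (i + j))

theorem qProd_zero (x : ℝ) (j : ℕ) : qProd x j 0 = 1 := by simp [qProd]

theorem qProd_succ (x : ℝ) (j n : ℕ) : qProd x j (n + 1) = qProd x j n * (1 - x ^ (n + j)) :=
  Finset.prod_range_succ _ _

theorem qProd_add (x : ℝ) (j n m : ℕ) : qProd x j (n + m) = qProd x j n * qProd x (j + n) m := by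
  simp only [qProd, Finset.prod_range_add]
  congr 1
  exact Finset.prod_congr rfl fun i _ => by rw [show n + i + j = i + (j + n) by omega]

theorem uniformCorank_eq_zero_of_lt {x : ℝ} (k : ℕ) {d r : ℕ} (h : d < k ∨ r + k < d) :
    uniformCorank x k d r = 0 := by
  induction r generalizing d with
  | zero => rw [uniformCorank, if_neg (by omega)]
  | succ r ih => rw [uniformCorank, ih (by omega), ih (by omega)]; ring

/-- The law of the corank of a uniform matrix. -/
theorem uniformCorank_formula (x : ℝ) (k a b : ℕ) :
    uniformCorank x k (a + k) (a + b) * (qProd x 1 k * qProd x 1 b * qProd x 1 a) =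
      x ^ (k * b) * qProd x 1 (a + k) * qProd x 1 (a + b) := by
  -- Here a is the rank and a + b the number of rows: a vanishing row lowers b, a cutting row lowers
  -- a. Cleared denominators make the identity polynomial in x.
  induction hr : a + b generalizing a b with
  | zero =>
    obtain ⟨rfl, rfl⟩ : a = 0 ∧ b = 0 := by omega
    simp [uniformCorank, qProd_zero]
  | succ r ih =>
    rw [uniformCorank]
    rcases Nat.eq_zero_or_pos a with rfl | ha
    · obtain rfl : b = r + 1 := by omega
      have h1 := ih 0 r (by omega)
      have h2 : (1 - x ^ (0 + k)) * uniformCorank x k (0 + k - 1) r = 0 := by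
        rcases Nat.eq_zero_or_pos k with rfl | hk
        · simp
        · rw [uniformCorank_eq_zero_of_lt k (by omega), mul_zero]
      rw [h2]
      simp only [zero_add, qProd_zero, mul_one, add_zero] at h1 ⊢
      rw [qProd_succ, mul_add, pow_add, mul_one]
      linear_combination x ^ k * (1 - x ^ (r + 1)) * h1
    · obtain ⟨a, rfl⟩ : ∃ a', a = a' + 1 := ⟨a - 1, by omega⟩
      rcases Nat.eq_zero_or_pos b with rfl | hb
      · have h1 := ih a 0 (by omega)
        obtain rfl : a = r := by omega
        rw [uniformCorank_eq_zero_of_lt k (d := a + 1 + k) (by omega),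
          show a + 1 + k - 1 = a + k by omega]
        simp only [mul_zero, pow_zero, qProd_zero, mul_one, zero_add, one_mul] at h1 ⊢
        rw [show a + 1 + k = (a + k) + 1 by omega, qProd_succ x 1 (a + k), qProd_succ x 1 a]
        rw [show a + k + 1 = a + 1 + k by omega]
        linear_combination (1 - x ^ (a + 1 + k)) * (1 - x ^ (a + 1)) * h1
      · obtain ⟨b, rfl⟩ : ∃ b', b = b' + 1 := ⟨b - 1, by omega⟩
        have h1 := ih (a + 1) b (by omega)
        have h2 := ih a (b + 1) (by omega)
        rw [show a + 1 + k - 1 = a + k by omega]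
        rw [show a + 1 + k = (a + k) + 1 by omega, qProd_succ x 1 (a + k), qProd_succ x 1 a] at *
        rw [qProd_succ x 1 b] at *
        rw [qProd_succ x 1 r]
        rw [show r + 1 = a + b + 2 by omega]
        have e : x ^ (k * (b + 1)) = x ^ (k * b) * x ^ k := by rw [mul_add, pow_add, mul_one]
        rw [e] at *
        have e2 : x ^ (a + b + 2) = x ^ (a + 1) * x ^ (b + 1) := by rw [← pow_add]; congr 1; omega
        have e3 : x ^ (a + k + 1) = x ^ (a + 1) * x ^ k := by rw [← pow_add]; congr 1; omega
        rw [e2]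
        rw [e3] at *
        linear_combination x ^ (a + 1) * x ^ k * (1 - x ^ (b + 1)) * h1 +
          (1 - x ^ (a + 1) * x ^ k) * (1 - x ^ (a + 1)) * h2

section Bounds

variable {x : ℝ}

theorem qProd_nonneg (hx0 : 0 < x) (hx1 : x ≤ 1 / 2) (j n : ℕ) : 0 ≤ qProd x j n :=
  Finset.prod_nonneg fun i _ => sub_nonneg.2 (pow_le_one₀ hx0.le (by linarith))

theorem qProd_le_one (hx0 : 0 < x) (hx1 : x ≤ 1 / 2) (j n : ℕ) : qProd x j n ≤ 1 :=
  Finset.prod_le_one (fun i _ => sub_nonneg.2 (pow_le_one₀ hx0.le (by linarith)))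
    fun i _ => by have := pow_pos hx0 (i + j); linarith

theorem one_sub_le_qProd (hx0 : 0 < x) (hx1 : x ≤ 1 / 2) (j n : ℕ) : 1 - 2 * x ^ j ≤ qProd x j n := by
  -- The extra term 2 x^(j+n) makes the bound inductive.
  have h : 1 - 2 * x ^ j + 2 * x ^ (j + n) ≤ qProd x j n := by
    induction n with
    | zero => simp [qProd_zero]
    | succ n ih =>
      have h1 : x ^ (j + n) ≤ x ^ j := pow_le_pow_of_le_one hx0.le (by linarith) (by omega)
      have h2 := pow_pos hx0 (j + n)
      have h3 : x ^ (j + n) ≤ 1 := pow_le_one₀ hx0.le (by linarith)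
      have h4 := mul_le_mul_of_nonneg_right ih (sub_nonneg.2 h3)
      rw [qProd_succ, add_comm n j, ← add_assoc, pow_succ]
      nlinarith [mul_nonneg h2.le (sub_nonneg.2 h1), mul_nonneg h2.le (sub_nonneg.2 hx1)]
  have := pow_pos hx0 (j + n)
  linarith

/-- The bound 1 - 2x is void at x = 1/2, so the factor 1 - x is split off and the general bound is
used from the square on. -/
theorem quarter_le_qProd (hx0 : 0 < x) (hx1 : x ≤ 1 / 2) (n : ℕ) : 1 / 4 ≤ qProd x 1 n := by
  rcases n with _ | n
  · rw [qProd_zero]; norm_num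
  · rw [add_comm n 1, qProd_add]
    have h1 := one_sub_le_qProd hx0 hx1 2 n
    have h2 : qProd x 1 1 = 1 - x := by simp [qProd]
    rw [h2]
    have h3 : x ^ 2 ≤ 1 / 4 := by nlinarith
    nlinarith

theorem multipliable_one_sub_pow (hx0 : 0 < x) (hx1 : x ≤ 1 / 2) (j : ℕ) : Multipliable fun i : ℕ => 1 - x ^ (i + j) := by
  have : Summable fun i : ℕ => -x ^ (i + j) := by
    simp only [pow_add]
    exact ((summable_geometric_of_lt_one hx0.le (by linarith)).mul_right _).neg
  simpa [sub_eq_add_neg] using Real.multipliable_one_add_of_summable this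

theorem tendsto_qProd (hx0 : 0 < x) (hx1 : x ≤ 1 / 2) (j : ℕ) :
    Filter.Tendsto (qProd x j) Filter.atTop (nhds (∏' i : ℕ, (1 - x ^ (i + j)))) :=
  (multipliable_one_sub_pow hx0 hx1 j).hasProd.tendsto_prod_nat

theorem tprod_bounds (hx0 : 0 < x) (hx1 : x ≤ 1 / 2) (j : ℕ) :
    1 - 2 * x ^ j ≤ ∏' i : ℕ, (1 - x ^ (i + j)) ∧ ∏' i : ℕ, (1 - x ^ (i + j)) ≤ 1 :=
  ⟨ge_of_tendsto' (tendsto_qProd hx0 hx1 j) fun n => one_sub_le_qProd hx0 hx1 j n,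
    le_of_tendsto' (tendsto_qProd hx0 hx1 j) fun n => qProd_le_one hx0 hx1 j n⟩

theorem tprod_eq_qProd_mul (hx0 : 0 < x) (hx1 : x ≤ 1 / 2) (j n : ℕ) :
    ∏' i : ℕ, (1 - x ^ (i + j)) = qProd x j n * ∏' i : ℕ, (1 - x ^ (i + (j + n))) := by
  refine tendsto_nhds_unique (f := fun m => qProd x j (n + m)) (l := Filter.atTop) ?_ ?_
  · exact (tendsto_qProd hx0 hx1 j).comp
      (Filter.tendsto_atTop_mono (fun m => Nat.le_add_left m n) Filter.tendsto_id)
  · simp only [qProd_add]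
    exact (tendsto_qProd hx0 hx1 (j + n)).const_mul _

end Bounds

theorem limitLaw_eq (p k : ℕ) : limitLaw p k = (1 / (p : ℝ)) ^ (k ^ 2 + k) *
    ((∏' i : ℕ, (1 - (1 / (p : ℝ)) ^ (i + (k + 2)))) / qProd (1 / (p : ℝ)) 1 k) := by
  simp only [limitLaw, one_div_pow, qProd]
  congr 2
  rw [Finset.range_eq_Ico, Finset.prod_Ico_add' (fun i => 1 - 1 / (p : ℝ) ^ i) 0 k 1]
  rfl

theorem limitLaw_nonneg {p : ℕ} (hp : 2 ≤ p) (k : ℕ) : 0 ≤ limitLaw p k := by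
  have hp2 : (2 : ℝ) ≤ p := by exact_mod_cast hp
  have hx0 : 0 < 1 / (p : ℝ) := by positivity
  have hx1 : 1 / (p : ℝ) ≤ 1 / 2 := one_div_le_one_div_of_le two_pos hp2
  rw [limitLaw_eq]
  refine mul_nonneg (pow_nonneg hx0.le _) (div_nonneg ?_ (qProd_nonneg hx0 hx1 _ _))
  exact ge_of_tendsto' (tendsto_qProd hx0 hx1 _) fun n => qProd_nonneg hx0 hx1 _ n

theorem limitLaw_le {p : ℕ} (hp : 2 ≤ p) (k : ℕ) : limitLaw p k ≤ 4 * (1 / (p : ℝ)) ^ k := by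
  have hp2 : (2 : ℝ) ≤ p := by exact_mod_cast hp
  have hx0 : 0 < 1 / (p : ℝ) := by positivity
  have hx1 : 1 / (p : ℝ) ≤ 1 / 2 := one_div_le_one_div_of_le two_pos hp2
  rw [limitLaw_eq]
  set x := 1 / (p : ℝ)
  have h1 : x ^ (k ^ 2 + k) ≤ x ^ k := pow_le_pow_of_le_one hx0.le (by linarith) (by omega)
  have h2 := quarter_le_qProd hx0 hx1 k
  have h3 := (tprod_bounds hx0 hx1 (k + 2)).2
  have h4 : (∏' i : ℕ, (1 - x ^ (i + (k + 2)))) / qProd x 1 k ≤ 4 := by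
    rw [div_le_iff₀ (by linarith)]; linarith
  have h5 := pow_pos hx0 k
  have h6 := pow_pos hx0 (k ^ 2 + k)
  nlinarith

/-- The law of the corank of a uniform `(R + 1) × R` matrix is exponentially close to its limit. -/
theorem abs_uniformCorank_sub_limitLaw_le {p : ℕ} (hp : 2 ≤ p) (k R : ℕ) :
    |uniformCorank (1 / p) k R (R + 1) - limitLaw p k| ≤ 32 * (1 / (p : ℝ)) ^ R := by
  have hp2 : (2 : ℝ) ≤ p := by exact_mod_cast hp
  have hx0 : 0 < 1 / (p : ℝ) := by positivity
  have hx1 : 1 / (p : ℝ) ≤ 1 / 2 := one_div_le_one_div_of_le two_pos hp2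
  rcases lt_or_ge R k with h | h
  · rw [uniformCorank_eq_zero_of_lt k (by omega), zero_sub, abs_neg,
      abs_of_nonneg (limitLaw_nonneg hp k)]
    have h1 : (1 / (p : ℝ)) ^ k ≤ (1 / (p : ℝ)) ^ R :=
      pow_le_pow_of_le_one hx0.le (by linarith) h.le
    have h2 := limitLaw_le hp k
    have h3 := pow_pos hx0 R
    linarith
  · obtain ⟨a, rfl⟩ : ∃ a, R = a + k := ⟨R - k, by omega⟩
    rw [limitLaw_eq]
    set x := 1 / (p : ℝ)
    -- One row more than the dimension R = a + k means b = k + 1, whence the exponent k(k + 1) of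
    -- the limit law.
    have hf := uniformCorank_formula x k a (k + 1)
    set u := uniformCorank x k (a + k) (a + (k + 1))
    have ha := quarter_le_qProd hx0 hx1 a
    have hk := quarter_le_qProd hx0 hx1 k
    have hk1 := quarter_le_qProd hx0 hx1 (k + 1)
    have e1 := qProd_add x 1 a k
    have e2 := tprod_eq_qProd_mul hx0 hx1 (k + 2) a
    have e3 := qProd_add x 1 (k + 1) a
    rw [show 1 + (k + 1) = k + 2 by omega] at e3
    rw [show k + 1 + a = a + (k + 1) by omega] at e3
    rw [e2]
    obtain ⟨t1, t2⟩ := tprod_bounds hx0 hx1 (k + 2 + a)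
    set τ := ∏' i : ℕ, (1 - x ^ (i + (k + 2 + a)))
    set A := qProd x 1 a
    set K := qProd x 1 k
    set K1 := qProd x 1 (k + 1)
    have s1 := one_sub_le_qProd hx0 hx1 (1 + a) k
    have s2 := qProd_le_one hx0 hx1 (1 + a) k
    have w1 := qProd_nonneg hx0 hx1 (k + 2) a
    have w2 := qProd_le_one hx0 hx1 (k + 2) a
    set S := qProd x (1 + a) k
    set W := qProd x (k + 2) a
    have hu : u = x ^ (k ^ 2 + k) * (S * W / K) := by
      have hne : K * K1 * A ≠ 0 := by positivity
      have hK : K ≠ 0 := by positivity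
      rw [e1, e3] at hf
      rw [show k ^ 2 + k = k * (k + 1) by ring]
      rw [eq_comm, ← sub_eq_zero] at hf ⊢
      have : (K * K1 * A) * (x ^ (k * (k + 1)) * (S * W / K) - u) = 0 := by
        rw [← hf]; field_simp
      exact (mul_eq_zero.1 this).resolve_left hne
    -- After the common factors only S - τ is left, and both products lie within 2 x^a of 1.
    have hgoal : u - x ^ (k ^ 2 + k) * (W * τ / K) = x ^ (k ^ 2 + k) * (W / K * (S - τ)) := by
      rw [hu]; ring
    have hST : |S - τ| ≤ 2 * x ^ a := by
      have h1 : x ^ (1 + a) ≤ x ^ a := pow_le_pow_of_le_one hx0.le (by linarith) (by omega)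
      have h2 : x ^ (k + 2 + a) ≤ x ^ a := pow_le_pow_of_le_one hx0.le (by linarith) (by omega)
      rw [abs_le]; constructor <;> linarith
    have hWK0 : 0 ≤ W / K := div_nonneg w1 (by linarith)
    have hWK : W / K ≤ 4 := by rw [div_le_iff₀ (by linarith)]; linarith
    have hxk : x ^ (k ^ 2 + k) ≤ x ^ k := pow_le_pow_of_le_one hx0.le (by linarith) (by omega)
    change |u - _| ≤ _
    rw [hgoal, abs_mul, abs_mul, abs_of_nonneg hWK0, abs_of_nonneg (pow_nonneg hx0.le _)]
    calc x ^ (k ^ 2 + k) * (W / K * |S - τ|) ≤ x ^ k * (4 * (2 * x ^ a)) := by gcongr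
      _ = 8 * x ^ (a + k) := by rw [pow_add]; ring
      _ ≤ 32 * x ^ (a + k) := by
        have := pow_pos hx0 (a + k); linarith

/-! ### Entropy of sparse vectors and union bounds -/

section SmallBall

/-- A bound for the probability that a random vector of bits is orthogonal to a fixed vector with
`s` nonzero coordinates. -/
def smallBall (t : ℝ) (p s : ℕ) : ℝ :=
  min (coinMax t) ((1 + 1 / (2 * (t * (1 - t))) * ((p : ℝ) ^ 2 / s)) / p)

theorem smallBall_nonneg {t : ℝ} (h0 : 0 < t) (h1 : t < 1) (p s : ℕ) : 0 ≤ smallBall t p s := by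
  have : 0 < t * (1 - t) := mul_pos h0 (by linarith)
  exact le_min (coinMax_pos t).le (by positivity)

theorem smallBall_le_one {t : ℝ} (h0 : 0 < t) (h1 : t < 1) (p s : ℕ) : smallBall t p s ≤ 1 :=
  (min_le_left _ _).trans (coinMax_le_one h0.le h1.le)

theorem Pr_le_smallBall {p : ℕ} [Fact p.Prime] {ι : Type*} [Fintype ι] [DecidableEq ι] {t : ℝ}
    (h0 : 0 < t) (h1 : t < 1) {v : ι → ZMod p} {s : ℕ} (hs0 : 0 < s) (hs : s ≤ suppCard v) :
    Pr (iidWeight (coin t)) (fun b : ι → Bool => bitDot b v = 0) ≤ smallBall t p s := by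
  refine le_min (Pr_bitDot_eq_zero_le h0.le h1.le ?_) (Pr_bitDot_eq_zero_le_inv h0 h1 hs0 hs)
  rintro rfl
  simp [suppCard] at hs
  omega

end SmallBall

section Counting

variable {p : ℕ} [Fact p.Prime]

theorem suppCard_eq_zero_iff {F ι : Type*} [Zero F] [Fintype ι] [DecidableEq F] {v : ι → F} :
    suppCard v = 0 ↔ v = 0 := by
  simp [suppCard, funext_iff]

theorem sum_prod_ite {ι : Type*} [Fintype ι] [DecidableEq ι] (c : ι → ℝ) :
    ∑ v : ι → ZMod p, ∏ k, (if v k ≠ 0 then c k else 1) = ∏ k, (1 + (p - 1) * c k) := by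
  have := Finset.prod_univ_sum (fun _ : ι => (Finset.univ : Finset (ZMod p)))
    (fun k x => if x ≠ 0 then c k else 1)
  simp only [Fintype.piFinset_univ] at this
  rw [← this]
  refine Finset.prod_congr rfl fun k _ => ?_
  rw [← Finset.add_sum_erase _ _ (Finset.mem_univ (0 : ZMod p))]
  have : ∀ x ∈ Finset.univ.erase (0 : ZMod p), (if x ≠ 0 then c k else 1) = c k := by
    intro x hx; rw [if_pos (Finset.ne_of_mem_erase hx)]
  rw [Finset.sum_congr rfl this, Finset.sum_const, Finset.card_erase_of_mem (Finset.mem_univ _),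
    Finset.card_univ, ZMod.card, nsmul_eq_mul, Nat.cast_sub (Fact.out : p.Prime).one_le]
  simp

/-- The number of vectors with few nonzero coordinates. -/
theorem card_suppCard_le (N : ℕ) (S : ℝ) {h : ℝ} (hh : 0 ≤ h) :
    ((Finset.univ.filter fun v : Fin N → ZMod p => (suppCard v : ℝ) ≤ S).card : ℝ) ≤
      Real.exp ((Real.log p + h) * S + Real.exp (-h) * N) := by
  have hp1 : (1 : ℝ) ≤ p := by exact_mod_cast (Fact.out : p.Prime).one_le
  have hp0 : (0 : ℝ) < p := by linarith
  -- In the exponential Markov bound a coordinate contributes 1 + (p - 1) e^(-l) ≤ 1 + e^(-h): the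
  -- log p cancels the number of nonzero residues.
  set l := Real.log p + h with hl
  have hl0 : 0 ≤ l := add_nonneg (Real.log_nonneg hp1) hh
  have hpl : p * Real.exp (-l) = Real.exp (-h) := by
    rw [hl, neg_add, Real.exp_add, Real.exp_neg (Real.log p), Real.exp_log hp0]
    field_simp
  have h1 : ∀ v : Fin N → ZMod p, ∏ k, (if v k ≠ 0 then Real.exp (-l) else 1) =
      Real.exp (-l * suppCard v) := by
    intro v
    rw [Finset.prod_ite, Finset.prod_const, Finset.prod_const_one, mul_one, ← Real.exp_nat_mul]
    congr 1; simp only [suppCard]; ring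
  have h2 := sum_prod_ite (p := p) (fun _ : Fin N => Real.exp (-l))
  simp only [h1, Finset.prod_const, Finset.card_univ, Fintype.card_fin] at h2
  have h3 : (1 + ((p : ℝ) - 1) * Real.exp (-l)) ^ N ≤ Real.exp (Real.exp (-h) * N) := by
    rw [mul_comm _ (N : ℝ), Real.exp_nat_mul]
    have e := Real.exp_pos (-l)
    refine pow_le_pow_left₀ (by nlinarith) ?_ N
    have := Real.add_one_le_exp (Real.exp (-h))
    rw [← hpl] at this ⊢
    linarith
  rw [Real.exp_add, Finset.card_filter]
  push_cast
  calc _ ≤ ∑ v : Fin N → ZMod p, Real.exp (l * S) * Real.exp (-l * suppCard v) := by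
        refine Finset.sum_le_sum fun v _ => ?_
        rw [← Real.exp_add]
        split_ifs with hv
        · rw [Real.one_le_exp_iff]
          nlinarith
        · positivity
    _ ≤ _ := by
        rw [← Finset.mul_sum, h2]
        exact mul_le_mul_of_nonneg_left h3 (Real.exp_pos _).le

end Counting

set_option maxHeartbeats 1000000 in
/-- Sparse vectors are unlikely to be annihilated by linearly many random vectors of bits, even
after a union bound. -/
theorem exists_sparse_sum_le {t : ℝ} (h0 : 0 < t) (h1 : t < 1) {θ : ℝ} (hθ : 0 < θ) :
    ∃ δ > 0, ∃ c > 0, ∃ κ > 0, ∀ p : ℕ, ∀ _ : Fact p.Prime, ∀ N L : ℕ, ∀ S : ℝ,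
      (p : ℝ) ^ 2 ≤ c * N → θ * N ≤ L → S ≤ δ * N →
      ∑ v ∈ Finset.univ.filter (fun v : Fin N → ZMod p => v ≠ 0 ∧ (suppCard v : ℝ) ≤ S),
        smallBall t p (suppCard v) ^ L ≤ 2 * Real.exp (-(κ * N)) := by
  set C0 : ℝ := 1 / (2 * (t * (1 - t))) with hC0
  have hC0pos : 0 < C0 := by have : 0 < t * (1 - t) := mul_pos h0 (by linarith)
                             positivity
  set l : ℝ := -Real.log (coinMax t) with hl
  have hlpos : 0 < l := by
    have : coinMax t < 1 := max_lt h1 (by linarith)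
    have := Real.log_neg (coinMax_pos t) this
    linarith
  have hρ : coinMax t = Real.exp (-l) := by rw [hl, neg_neg, Real.exp_log (coinMax_pos t)]
  -- The exponent won from `coinMax t ^ L` is at least θ l N = 8 g N; the losses and the final rate
  -- are measured in units of g N.
  set g : ℝ := θ * l / 8 with hg
  have hgpos : 0 < g := by positivity
  obtain ⟨h, hh0, hh⟩ : ∃ h : ℝ, 0 ≤ h ∧ Real.exp (-h) ≤ g := by
    refine ⟨max 0 (-Real.log g), le_max_left _ _, ?_⟩
    rw [← Real.le_log_iff_exp_le hgpos]
    have := le_max_right 0 (-Real.log g)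
    linarith
  set c1 : ℝ := 2 * g / (1 + 2 * h) with hc1
  have hc1pos : 0 < c1 := by positivity
  set δ : ℝ := min (θ / 4) (g / (1 + h)) with hδ
  have hδpos : 0 < δ := lt_min (by positivity) (by positivity)
  have hδ1 : δ ≤ θ / 4 := min_le_left _ _
  have hδ2 : δ * (1 + h) ≤ g := by
    rw [← le_div_iff₀ (by positivity)]; exact min_le_right _ _
  refine ⟨δ, hδpos, c1 / (10 * C0), by positivity, g, hgpos, ?_⟩
  intro p hpf N L S hpN hL hS
  have hp2 : (2 : ℝ) ≤ p := by exact_mod_cast (Fact.out : p.Prime).two_le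
  have hp0 : (0 : ℝ) < p := by linarith
  have hN : (0 : ℝ) < N := by
    by_contra hcon
    have : (N : ℝ) = 0 := le_antisymm (not_lt.1 hcon) (Nat.cast_nonneg N)
    rw [this, mul_zero] at hpN
    nlinarith
  have hlogp : 1 / 2 ≤ Real.log p := by
    have h3 := Real.log_two_gt_d9
    have h4 := Real.log_le_log two_pos hp2
    linarith
  set lp := Real.log p with hlp
  -- Below this threshold the entropy is a small multiple of N and the constant bound `coinMax t`
  -- suffices. Above it the entropy may reach δ N log p, and a bound that decays with p is needed.
  set S1 : ℝ := c1 * N / lp with hS1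
  have hS1pos : 0 < S1 := by positivity
  set f : (Fin N → ZMod p) → ℝ := fun v => smallBall t p (suppCard v) ^ L with hf
  have hf1 : ∀ v, f v ≤ Real.exp (-(θ * l * N)) := by
    intro v
    have : f v ≤ coinMax t ^ L :=
      pow_le_pow_left₀ (smallBall_nonneg h0 h1 _ _) (min_le_left _ _) L
    refine this.trans ?_
    rw [hρ, ← Real.exp_nat_mul]
    refine Real.exp_le_exp.2 ?_
    have := mul_le_mul_of_nonneg_right hL hlpos.le
    linarith
  have hf2 : ∀ v, S1 ≤ suppCard v → f v ≤ Real.exp (-(θ * N * (l / 2 + lp / 4))) := by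
    intro v hv
    set b := smallBall t p (suppCard v) with hb
    have hb0 : 0 ≤ b := smallBall_nonneg h0 h1 _ _
    have hb1 : b ≤ Real.exp (-l) := by rw [← hρ]; exact min_le_left _ _
    -- The choice c = c1 / (10 C0) makes the Littlewood–Offord error at most (log p)/10 ≤ √p/5, and
    -- 1 + √p/5 ≤ √p already at p = 2.
    have hb2 : b ≤ Real.exp (-(lp / 2)) := by
      set q := Real.sqrt p with hq
      have hq2 : q ^ 2 = p := Real.sq_sqrt hp0.le
      have hq0 : 0 < q := Real.sqrt_pos.2 hp0
      have hq1 : 1.4 ≤ q := by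
        rw [hq]; apply Real.le_sqrt_of_sq_le; norm_num; linarith
      have e : Real.exp (-(lp / 2)) = 1 / q := by
        rw [Real.exp_neg, ← Real.log_sqrt hp0.le, Real.exp_log hq0, one_div]
      have hlq : lp ≤ 2 * q := by
        have h3 : Real.log q ≤ q - 1 := Real.log_le_sub_one_of_pos hq0
        have h4 : Real.log q = lp / 2 := Real.log_sqrt hp0.le
        linarith
      have hv0 : (0 : ℝ) < suppCard v := lt_of_lt_of_le hS1pos hv
      have h5 : C0 * ((p : ℝ) ^ 2 / suppCard v) ≤ lp / 10 := by
        have h6 : (p : ℝ) ^ 2 / suppCard v ≤ (p : ℝ) ^ 2 / S1 := by gcongr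
        have h7 : (p : ℝ) ^ 2 / S1 = (p : ℝ) ^ 2 * lp / (c1 * N) := by
          rw [hS1]; field_simp
        have h8 : (p : ℝ) ^ 2 * lp / (c1 * N) ≤ c1 / (10 * C0) * N * lp / (c1 * N) := by gcongr
        have h9 : c1 / (10 * C0) * N * lp / (c1 * N) = lp / 10 / C0 := by field_simp
        rw [h7] at h6
        rw [← le_div_iff₀' hC0pos]
        linarith
      rw [e]
      refine (min_le_right _ _).trans ?_
      rw [div_le_div_iff₀ hp0 hq0, one_mul, ← hq2, ← hC0]
      rw [← hq2] at h5
      have h10 : 1 + C0 * ((q ^ 2) ^ 2 / suppCard v) ≤ q := by linarith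
      have := mul_le_mul_of_nonneg_right h10 hq0.le
      linarith [sq q]
    -- The geometric mean of the two bounds: its first part pays for losses of order N, its second
    -- for the entropy N log p.
    have hb3 : b ≤ Real.exp (-(l / 2 + lp / 4)) := by
      refine le_of_sq_le_sq ?_ (Real.exp_pos _).le
      calc b ^ 2 = b * b := sq b
        _ ≤ Real.exp (-l) * Real.exp (-(lp / 2)) := by gcongr
        _ = _ := by rw [← Real.exp_add, ← Real.exp_nat_mul]; congr 1; push_cast; ring
    refine (pow_le_pow_left₀ hb0 hb3 L).trans ?_
    rw [← Real.exp_nat_mul]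
    refine Real.exp_le_exp.2 ?_
    have : 0 < l / 2 + lp / 4 := by positivity
    have := mul_le_mul_of_nonneg_right hL this.le
    linarith
  classical
  have hsplit : ∑ v ∈ Finset.univ.filter (fun v : Fin N → ZMod p => v ≠ 0 ∧ (suppCard v : ℝ) ≤ S),
      f v ≤ ∑ v ∈ Finset.univ.filter (fun v : Fin N → ZMod p => (suppCard v : ℝ) ≤ S1),
          Real.exp (-(θ * l * N)) +
        ∑ v ∈ Finset.univ.filter (fun v : Fin N → ZMod p => (suppCard v : ℝ) ≤ δ * N),
          Real.exp (-(θ * N * (l / 2 + lp / 4))) := by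
    simp only [Finset.sum_filter]
    rw [← Finset.sum_add_distrib]
    refine Finset.sum_le_sum fun v _ => ?_
    have e1 := Real.exp_pos (-(θ * l * N))
    have e2 := Real.exp_pos (-(θ * N * (l / 2 + lp / 4)))
    by_cases hv : v ≠ 0 ∧ (suppCard v : ℝ) ≤ S
    · rw [if_pos hv, if_pos (hv.2.trans hS)]
      rcases le_total (suppCard v : ℝ) S1 with h3 | h3
      · rw [if_pos h3]; have := hf1 v; linarith
      · have := hf2 v h3
        split_ifs <;> linarith
    · rw [if_neg hv]; split_ifs <;> linarith
  refine hsplit.trans ?_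
  rw [Finset.sum_const, Finset.sum_const, nsmul_eq_mul, nsmul_eq_mul, two_mul]
  have k1 := card_suppCard_le (p := p) N S1 hh0
  have k2 := card_suppCard_le (p := p) N (δ * N) hh0
  have hθl : θ * l = 8 * g := by rw [hg]; ring
  refine add_le_add ?_ ?_
  · refine (mul_le_mul_of_nonneg_right k1 (Real.exp_pos _).le).trans ?_
    rw [← Real.exp_add]
    refine Real.exp_le_exp.2 ?_
    have e1 : lp * S1 = c1 * N := by rw [hS1]; field_simp
    have e2 : S1 ≤ c1 * N * 2 := by
      rw [hS1, div_le_iff₀ (by linarith)]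
      have : 0 ≤ c1 * N * 2 := by positivity
      have := mul_le_mul_of_nonneg_left hlogp this
      linarith
    have e3 : c1 * (1 + 2 * h) = 2 * g := by rw [hc1]; field_simp
    have e4 : h * S1 ≤ h * (c1 * N * 2) := mul_le_mul_of_nonneg_left e2 hh0
    have e5 : Real.exp (-h) * N ≤ g * N := mul_le_mul_of_nonneg_right hh hN.le
    rw [← hlp, add_mul, e1, hθl]
    have : 2 * g * N = c1 * N + h * (c1 * N * 2) := by rw [← e3]; ring
    have : 0 ≤ g * N := by positivity
    linarith
  · refine (mul_le_mul_of_nonneg_right k2 (Real.exp_pos _).le).trans ?_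
    rw [← Real.exp_add]
    refine Real.exp_le_exp.2 ?_
    rw [← hlp]
    have e5 : Real.exp (-h) * N ≤ g * N := mul_le_mul_of_nonneg_right hh hN.le
    have e6 : δ * N * lp ≤ θ / 4 * N * lp := by gcongr
    have e7 : δ * (1 + h) * N ≤ g * N := mul_le_mul_of_nonneg_right hδ2 hN.le
    have e8 : θ * N * (l / 2 + lp / 4) = 4 * g * N + θ / 4 * N * lp := by
      have : θ * N * (l / 2 + lp / 4) = θ * l * N / 2 + θ / 4 * N * lp := by ring
      rw [this, hθl]; ring
    have e9 : 0 ≤ δ * N := by positivity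
    have : 0 ≤ g * N := by positivity
    linarith

/-- The union bound over dense vectors. -/
theorem exists_dense_bound {θ : ℝ} (hθ : 0 < θ) :
    ∃ δ > 0, ∃ ε > 0, ∃ κ > 0, ∃ h ≥ 0, ∀ p : ℕ, 2 ≤ p → ∀ n s r S : ℕ, ∀ β : ℝ,
      s + r ≤ n → θ * n ≤ s → 1 / (p : ℝ) ≤ β → β ≤ (1 + ε) / p → β ≤ 1 →
      S ≤ n → (S : ℝ) ≤ δ * n →
      Real.exp ((Real.log p + h) * S + Real.exp (-h) * n) *
        (β ^ (n - S) * ((p : ℝ) ^ r * (1 + (p - 1) * β) ^ s)) ≤ Real.exp (-(κ * n)) := by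
  set g : ℝ := min (θ / 96) (1 / 8) with hg
  have hgpos : 0 < g := lt_min (by positivity) (by norm_num)
  have hg1 : g ≤ θ / 96 := min_le_left _ _
  have hg2 : g ≤ 1 / 8 := min_le_right _ _
  obtain ⟨h, hh0, hh⟩ : ∃ h : ℝ, 0 ≤ h ∧ Real.exp (-h) ≤ g := by
    refine ⟨max 0 (-Real.log g), le_max_left _ _, ?_⟩
    rw [← Real.le_log_iff_exp_le hgpos]
    have := le_max_right 0 (-Real.log g)
    linarith
  refine ⟨min (θ / 16) (g / (1 + h)), lt_min (by positivity) (by positivity), g, hgpos, θ / 32,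
    by positivity, h, hh0, ?_⟩
  intro p hp n s r S β hsr hs hβ0 hβ1 hβ2 hSn hS
  set δ := min (θ / 16) (g / (1 + h)) with hδ
  have hδ1 : δ ≤ θ / 16 := min_le_left _ _
  have hδ2 : δ * (1 + h) ≤ g := by
    rw [← le_div_iff₀ (by positivity)]; exact min_le_right _ _
  have hδ0 : 0 < δ := lt_min (by positivity) (by positivity)
  have hp2 : (2 : ℝ) ≤ p := by exact_mod_cast hp
  have hp0 : (0 : ℝ) < p := by linarith
  have hβpos : 0 < β := lt_of_lt_of_le (by positivity) hβ0
  have hn0 : (0 : ℝ) ≤ n := Nat.cast_nonneg n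
  have hlogp : 1 / 2 ≤ Real.log p := by
    have h3 := Real.log_two_gt_d9
    have h4 := Real.log_le_log two_pos hp2
    linarith
  set lp := Real.log p with hlp
  have hpe : (p : ℝ) = Real.exp lp := (Real.exp_log hp0).symm
  have hβe : β ≤ Real.exp (g - lp) := by
    rw [Real.exp_sub, ← hpe]
    refine hβ1.trans ?_
    have := Real.add_one_le_exp g
    gcongr; linarith
  have hb1 : β ^ (n - S) ≤ Real.exp ((g - lp) * n + lp * S) := by
    have h3 : β ^ (n - S) * β ^ S = β ^ n := by rw [← pow_add]; congr 1; omega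
    have h4 : Real.exp (-(lp * S)) ≤ β ^ S := by
      have : Real.exp (-lp) ≤ β := by rw [Real.exp_neg, ← hpe, ← one_div]; exact hβ0
      calc Real.exp (-(lp * S)) = Real.exp (-lp) ^ S := by
            rw [← Real.exp_nat_mul]; congr 1; ring
        _ ≤ _ := pow_le_pow_left₀ (Real.exp_pos _).le this S
    have h5 : β ^ n ≤ Real.exp ((g - lp) * n) := by
      rw [mul_comm, Real.exp_nat_mul]; exact pow_le_pow_left₀ hβpos.le hβe n
    have h6 : β ^ (n - S) * Real.exp (-(lp * S)) ≤ Real.exp ((g - lp) * n) := by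
      refine le_trans ?_ h5
      rw [← h3]; gcongr
    rw [Real.exp_neg, ← div_eq_mul_inv, div_le_iff₀ (Real.exp_pos _), ← Real.exp_add] at h6
    exact h6
  -- The decisive saving: a tested coordinate of y costs p^(3/4) instead of p. For p = 2 this is
  -- (13/8)^4 ≤ 8, for p ≥ 3 it is (17/8)^4 ≤ 27.
  have hb2 : 1 + ((p : ℝ) - 1) * β ≤ Real.exp (3 / 4 * lp) := by
    have h3 : 1 + ((p : ℝ) - 1) * β ≤ 2 + 1 / 8 - 1 / p := by
      have h4 : ((p : ℝ) - 1) * β ≤ (p - 1) * ((1 + g) / p) := by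
        apply mul_le_mul_of_nonneg_left hβ1; linarith
      have h5 : ((p : ℝ) - 1) * ((1 + g) / p) = 1 + g - (1 + g) / p := by field_simp
      have h6 : 1 / (p : ℝ) ≤ (1 + g) / p := by gcongr; linarith
      linarith
    refine h3.trans ?_
    refine le_of_pow_le_pow_left₀ (n := 4) (by norm_num) (Real.exp_pos _).le ?_
    have h7 : Real.exp (3 / 4 * lp) ^ 4 = (p : ℝ) ^ 3 := by
      rw [← Real.exp_nat_mul, hpe, ← Real.exp_nat_mul]; congr 1; push_cast; ring
    rw [h7]
    rcases Nat.eq_or_lt_of_le hp with h8 | h8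
    · rw [← h8]; norm_num
    · have h9 : (3 : ℝ) ≤ p := by exact_mod_cast h8
      have h10 : 0 < 1 / (p : ℝ) := by positivity
      have h11 : 1 / (p : ℝ) ≤ 1 := by rw [div_le_one hp0]; linarith
      calc (2 + 1 / 8 - 1 / (p : ℝ)) ^ 4 ≤ (2 + 1 / 8) ^ 4 :=
            pow_le_pow_left₀ (by linarith) (by linarith) 4
        _ ≤ 3 ^ 3 := by norm_num
        _ ≤ _ := by gcongr
  have hb3 : (1 + ((p : ℝ) - 1) * β) ^ s ≤ Real.exp (3 / 4 * lp * s) := by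
    rw [mul_comm _ (s : ℝ), Real.exp_nat_mul]
    refine pow_le_pow_left₀ ?_ hb2 s
    have : 0 ≤ ((p : ℝ) - 1) * β := mul_nonneg (by linarith) hβpos.le
    linarith
  have hb4 : (p : ℝ) ^ r = Real.exp (lp * r) := by
    rw [mul_comm, Real.exp_nat_mul, ← hpe]
  rw [hb4]
  have hpos : 0 ≤ (1 + ((p : ℝ) - 1) * β) ^ s := by
    have : 0 ≤ ((p : ℝ) - 1) * β := mul_nonneg (by linarith) hβpos.le
    exact pow_nonneg (by linarith) s
  calc _ ≤ Real.exp ((lp + h) * S + Real.exp (-h) * n) *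
        (Real.exp ((g - lp) * n + lp * S) * (Real.exp (lp * r) * Real.exp (3 / 4 * lp * s))) := by
        gcongr
    _ = Real.exp ((lp + h) * S + Real.exp (-h) * n + ((g - lp) * n + lp * S + (lp * r +
        3 / 4 * lp * s))) := by rw [← Real.exp_add, ← Real.exp_add, ← Real.exp_add]
    _ ≤ _ := by
        refine Real.exp_le_exp.2 ?_
        have hsrR : (s : ℝ) + r ≤ n := by exact_mod_cast hsr
        have hlp0 : 0 < lp := by linarith
        have e1 : lp * ((s : ℝ) + r) ≤ lp * n := mul_le_mul_of_nonneg_left hsrR hlp0.le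
        have e2 : lp / 4 * (θ * n) ≤ lp / 4 * s := mul_le_mul_of_nonneg_left hs (by positivity)
        have e3 : lp * S ≤ lp * (θ / 16 * n) := by
          refine mul_le_mul_of_nonneg_left (hS.trans ?_) hlp0.le; gcongr
        have e4 : h * S ≤ h * (δ * n) := mul_le_mul_of_nonneg_left hS hh0
        have e5 : Real.exp (-h) * n ≤ g * n := mul_le_mul_of_nonneg_right hh hn0
        have e6 : δ * (1 + h) * n ≤ g * n := mul_le_mul_of_nonneg_right hδ2 hn0
        have e7 : 0 ≤ δ * n := by positivity
        have e8 : g * n ≤ θ / 96 * n := mul_le_mul_of_nonneg_right hg1 hn0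
        have e9 : 1 / 2 * (θ * n) ≤ lp * (θ * n) :=
          mul_le_mul_of_nonneg_right hlogp (by positivity)
        linarith

/-! ### Excluding solutions that are sparse on the first part -/

section RowForms

variable {F I J : Type*} [Field F]

/-- The differences `w (inr j) - w (inl i)` along the arcs that leave `inl i`. -/
def diffA (i : I) : (I ⊕ J → F) →ₗ[F] (J → F) where
  toFun w j := w (Sum.inr j) - w (Sum.inl i)
  map_add' w w' := by ext j; simp only [Pi.add_apply]; ring
  map_smul' a w := by ext j; simp [mul_sub]

/-- The differences `w (inl i) - w (inr j)` along the arcs that leave `inr j`. -/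
def diffB (j : J) : (I ⊕ J → F) →ₗ[F] (I → F) where
  toFun w i := w (Sum.inl i) - w (Sum.inr j)
  map_add' w w' := by ext i; simp only [Pi.add_apply]; ring
  map_smul' a w := by ext i; simp [mul_sub]

theorem diffA_apply (i : I) (w : I ⊕ J → F) (j : J) :
    diffA i w j = w (Sum.inr j) - w (Sum.inl i) := rfl

theorem diffB_apply (j : J) (w : I ⊕ J → F) (i : I) :
    diffB j w i = w (Sum.inl i) - w (Sum.inr j) := rfl

end RowForms

theorem prod_le_pow_sub {n S : ℕ} (f : Fin n → ℝ) (Z : Finset (Fin n)) {c : ℝ}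
    (hc0 : 0 ≤ c) (hc1 : c ≤ 1) (hf0 : ∀ i, 0 ≤ f i) (hf1 : ∀ i, f i ≤ 1)
    (hf : ∀ i, i ∉ Z → f i ≤ c) (hZ : Z.card ≤ S) : ∏ i, f i ≤ c ^ (n - S) := by
  calc ∏ i, f i ≤ ∏ i, (if i ∈ Z then 1 else c) := by
        refine Finset.prod_le_prod (fun i _ => hf0 i) fun i _ => ?_
        split_ifs with h
        · exact hf1 i
        · exact hf i h
    _ = c ^ (Finset.univ.filter fun i => i ∉ Z).card := by
        rw [Finset.prod_ite, Finset.prod_const_one, one_mul, Finset.prod_const]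
    _ ≤ c ^ (n - S) := by
        refine pow_le_pow_of_le_one hc0 hc1 ?_
        have h1 := Finset.card_filter_add_card_filter_not (s := (Finset.univ : Finset (Fin n)))
          (fun i => i ∈ Z)
        simp only [Finset.filter_mem_eq_inter, Finset.univ_inter, Finset.card_univ,
          Fintype.card_fin] at h1
        omega

section Structured

variable {p : ℕ} [Fact p.Prime] {n s r S : ℕ} {t : ℝ}

/-- Where x i = 0, row i tests y itself; at most S of the n rows are lost. -/
theorem prod_PrA_le (h0 : 0 ≤ t) (h1 : t ≤ 1) (x : Fin n → ZMod p) (y : Fin (s + r) → ZMod p)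
    {c : ℝ} (hc0 : 0 ≤ c) (hc1 : c ≤ 1) (hx : suppCard x ≤ S)
    (hy : Pr (iidWeight (coin t)) (fun b : Fin (s + r) → Bool => bitDot b y = 0) ≤ c) :
    ∏ i, Pr (iidWeight (coin t)) (fun b : Fin (s + r) → Bool =>
      bitDot b (diffA i (Sum.elim x y)) = 0) ≤ c ^ (n - S) := by
  have hc := (isProb_coin h0 h1).iid (ι := Fin (s + r))
  refine prod_le_pow_sub _ (Finset.univ.filter fun k => x k ≠ 0) hc0 hc1
    (fun i => Pr_nonneg hc _) (fun i => Pr_le_one hc _) (fun i hi => ?_) hx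
  have hxi : x i = 0 := by simpa using hi
  have : diffA i (Sum.elim x y) = y := by
    ext j; simp [diffA_apply, hxi]
  rwa [this]

theorem prod_PrB_le (h0 : 0 ≤ t) (h1 : t ≤ 1) (x : Fin n → ZMod p) (y : Fin (s + r) → ZMod p)
    {c : ℝ} (hc0 : 0 ≤ c) (hc1 : c ≤ 1) (hy : suppCard y ≤ S)
    (hx : Pr (iidWeight (coin t)) (fun b : Fin n → Bool => bitDot b x = 0) ≤ c) :
    ∏ j : Fin s, Pr (iidWeight (coin t)) (fun b : Fin n → Bool =>
      bitDot b (diffB (Fin.castAdd r j) (Sum.elim x y)) = 0) ≤ c ^ (s - S) := by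
  have hc := (isProb_coin h0 h1).iid (ι := Fin n)
  refine prod_le_pow_sub _ (Finset.univ.filter fun k => y (Fin.castAdd r k) ≠ 0) hc0 hc1
    (fun i => Pr_nonneg hc _) (fun i => Pr_le_one hc _) (fun i hi => ?_) ?_
  · have hyi : y (Fin.castAdd r i) = 0 := by simpa using hi
    have : diffB (Fin.castAdd r i) (Sum.elim x y) = x := by
      ext j; simp [diffB_apply, hyi]
    rwa [this]
  · refine le_trans ?_ hy
    refine Finset.card_le_card_of_injOn (Fin.castAdd r) (fun k hk => ?_)
      (Fin.castAdd_injective s r).injOn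
    simpa using hk

/-- If y j ≠ 0, then x - y j is nonzero wherever x vanishes. -/
theorem le_suppCard_diffB (x : Fin n → ZMod p) (y : Fin (s + r) → ZMod p) (j : Fin (s + r))
    (hj : y j ≠ 0) (hx : suppCard x ≤ S) : n - S ≤ suppCard (diffB j (Sum.elim x y)) := by
  have h1 := Finset.card_filter_add_card_filter_not (s := (Finset.univ : Finset (Fin n)))
    (fun i => x i ≠ 0)
  rw [Finset.card_univ, Fintype.card_fin] at h1
  have h2 : (Finset.univ.filter fun i => ¬ x i ≠ 0).card ≤ suppCard (diffB j (Sum.elim x y)) := by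
    refine Finset.card_le_card fun i hi => ?_
    have : x i = 0 := by simpa using hi
    refine Finset.mem_filter.2 ⟨Finset.mem_univ _, ?_⟩
    simp [diffB_apply, this, hj]
  have h3 : (Finset.univ.filter fun i => x i ≠ 0).card = suppCard x := rfl
  omega

theorem sum_prod_dense_le (y0 : ℝ) :
    ∑ y : Fin (s + r) → ZMod p, ∏ j : Fin s, (if y (Fin.castAdd r j) ≠ 0 then y0 else 1) =
      (p : ℝ) ^ r * (1 + (p - 1) * y0) ^ s := by
  have := sum_prod_ite (p := p) (Fin.append (fun _ : Fin s => y0) (fun _ : Fin r => 1))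
  simp only [Fin.prod_univ_add, Fin.append_left, Fin.append_right, ite_self,
    Finset.prod_const_one, mul_one, Finset.prod_const, Finset.card_univ, Fintype.card_fin] at this
  rw [this]
  ring

/-- The bound for the sparse part of the union bound, as a product over the two parts. -/
theorem sum_erase_zero_mul_le {X Y : Type*} [Zero X] [Zero Y] [DecidableEq X] [DecidableEq Y]
    (s : Finset X) (u : Finset Y) (hs : 0 ∈ s) (hu : 0 ∈ u) (Φ : X → ℝ) (Ψ : Y → ℝ)
    (hΦ : Φ 0 = 1) (hΨ : Ψ 0 = 1) {a b : ℝ} (ha : ∑ x ∈ s.erase 0, Φ x = a)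
    (hb : ∑ y ∈ u.erase 0, Ψ y = b) :
    ∑ q ∈ (s ×ˢ u).erase 0, Φ q.1 * Ψ q.2 = a + b + a * b := by
  have h1 := Finset.add_sum_erase (s ×ˢ u) (fun q => Φ q.1 * Ψ q.2)
    (a := 0) (Finset.mem_product.2 ⟨hs, hu⟩)
  rw [Finset.sum_product, ← Finset.sum_mul_sum, ← Finset.add_sum_erase s Φ hs,
    ← Finset.add_sum_erase u Ψ hu, ha, hb] at h1
  simp only [Prod.fst_zero, Prod.snd_zero, hΦ, hΨ] at h1
  linarith

end Structured

set_option maxHeartbeats 1000000 in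
/-- With overwhelming probability, no nonzero vector that is sparse on the first part is
annihilated by all rows of the first part and a proportion of the rows of the second part. -/
theorem exists_structured_bound {t : ℝ} (h0 : 0 < t) (h1 : t < 1) {θ : ℝ} (hθ : 0 < θ) :
    ∃ δ > 0, ∃ c > 0, ∃ κ > 0, δ ≤ 1 / 2 ∧ ∀ p : ℕ, ∀ _ : Fact p.Prime, ∀ n s r S : ℕ,
      s + r ≤ n → θ * n ≤ s → (p : ℝ) ^ 2 ≤ c * n → (S : ℝ) ≤ δ * n →
      Pr (prodWeight (iidWeight (iidWeight (coin t))) (iidWeight (iidWeight (coin t))))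
        (fun z : (Fin n → Fin (s + r) → Bool) × (Fin s → Fin n → Bool) =>
          ∃ q : (Fin n → ZMod p) × (Fin (s + r) → ZMod p), q ≠ 0 ∧ suppCard q.1 ≤ S ∧
            (∀ i, bitDot (z.1 i) (diffA i (Sum.elim q.1 q.2)) = 0) ∧
            ∀ j, bitDot (z.2 j) (diffB (Fin.castAdd r j) (Sum.elim q.1 q.2)) = 0) ≤
        9 * Real.exp (-(κ * n)) := by
  obtain ⟨δ1, hδ1, c1, hc1, κ1, hκ1, H1⟩ := exists_sparse_sum_le h0 h1 (θ := 1 / 2) (by norm_num)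
  obtain ⟨δ2, hδ2, c2, hc2, κ2, hκ2, H2⟩ := exists_sparse_sum_le h0 h1 (half_pos hθ)
  obtain ⟨δ3, hδ3, ε, hε, κ3, hκ3, h, hh, H3⟩ := exists_dense_bound hθ
  set C0 : ℝ := 1 / (2 * (t * (1 - t))) with hC0
  have hC0pos : 0 < C0 := by have : 0 < t * (1 - t) := mul_pos h0 (by linarith)
                             positivity
  -- The first bound lets the sparse estimate apply to y; the second leaves at least θ n / 2 of the
  -- s rows as tests of x.
  set η : ℝ := min δ1 (θ / 2) with hη
  have hηpos : 0 < η := lt_min hδ1 (by positivity)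
  have hη1 : η ≤ δ1 := min_le_left _ _
  have hη2 : η ≤ θ / 2 := min_le_right _ _
  -- In the dense case every tested vector has at least ζ n nonzero coordinates: y has more than η(s
  -- + r) ≥ ηθ n, and x - y j has at least n - S ≥ n/2.
  set ζ : ℝ := min (η * θ) (1 / 2) with hζ
  have hζpos : 0 < ζ := lt_min (by positivity) (by norm_num)
  have hζ1 : ζ ≤ η * θ := min_le_left _ _
  have hζ2 : ζ ≤ 1 / 2 := min_le_right _ _
  set δ : ℝ := min (1 / 2) (min δ2 δ3) with hδ
  set c : ℝ := min (c1 * θ) (min c2 (ε / C0 * ζ)) with hc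
  set κ : ℝ := min (κ1 * θ) (min κ2 κ3) with hκ
  refine ⟨δ, lt_min (by norm_num) (lt_min hδ2 hδ3), c,
    lt_min (by positivity) (lt_min hc2 (by positivity)), κ,
    lt_min (by positivity) (lt_min hκ2 hκ3), min_le_left _ _, ?_⟩
  intro p hpf n s r S hsr hs hpn hS
  have hn0 : (0 : ℝ) ≤ n := Nat.cast_nonneg n
  have hp2 : (2 : ℝ) ≤ p := by exact_mod_cast (Fact.out : p.Prime).two_le
  have hp0 : (0 : ℝ) < p := by linarith
  have hnpos : (0 : ℝ) < n := by
    by_contra hcon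
    have : (n : ℝ) = 0 := le_antisymm (not_lt.1 hcon) hn0
    rw [this, mul_zero] at hpn
    nlinarith
  have hS1 : (S : ℝ) ≤ 1 / 2 * n := hS.trans (by gcongr; exact min_le_left _ _)
  have hS2 : (S : ℝ) ≤ δ2 * n :=
    hS.trans (by gcongr; exact (min_le_right _ _).trans (min_le_left _ _))
  have hS3 : (S : ℝ) ≤ δ3 * n :=
    hS.trans (by gcongr; exact (min_le_right _ _).trans (min_le_right _ _))
  have hSn : S ≤ n := by
    have : (S : ℝ) ≤ n := by linarith
    exact_mod_cast this
  have hsrR : (s : ℝ) + r ≤ n := by exact_mod_cast hsr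
  have hr0 : (0 : ℝ) ≤ r := Nat.cast_nonneg r
  have hpc1 : (p : ℝ) ^ 2 ≤ c1 * ((s + r : ℕ) : ℝ) := by
    have e1 : c * n ≤ c1 * θ * n := by gcongr; exact min_le_left _ _
    have e2 : c1 * (θ * n) ≤ c1 * s := by gcongr
    push_cast
    have e3 : 0 ≤ c1 * r := by positivity
    linarith
  have hpc2 : (p : ℝ) ^ 2 ≤ c2 * n :=
    hpn.trans (by gcongr; exact (min_le_right _ _).trans (min_le_left _ _))
  have hpc3 : (p : ℝ) ^ 2 ≤ ε / C0 * ζ * n :=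
    hpn.trans (by gcongr; exact (min_le_right _ _).trans (min_le_right _ _))
  set S2 : ℕ := ⌊η * ((s + r : ℕ) : ℝ)⌋₊ with hS2def
  have hS2le : (S2 : ℝ) ≤ η * ((s + r : ℕ) : ℝ) := Nat.floor_le (by positivity)
  have hμ := (isProb_coin h0.le h1.le).iid (ι := Fin n)
  have hν := (isProb_coin h0.le h1.le).iid (ι := Fin (s + r))
  set β : ℝ := min 1 ((1 + ε) / p) with hβ
  have hβ1 : β ≤ 1 := min_le_left _ _
  have hβ2 : β ≤ (1 + ε) / p := min_le_right _ _
  have hβ0 : 1 / (p : ℝ) ≤ β := by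
    refine le_min ?_ ?_
    · rw [div_le_one hp0]; linarith
    · gcongr; linarith
  have hβpos : 0 ≤ β := le_trans (by positivity) hβ0
  have hball : ∀ k : ℕ, ζ * n ≤ k → smallBall t p k ≤ β := by
    intro k hk
    refine le_min (smallBall_le_one h0 h1 p k) ((min_le_right _ _).trans ?_)
    have hk0 : (0 : ℝ) < k := lt_of_lt_of_le (by positivity) hk
    rw [← hC0]
    have e1 : C0 * ((p : ℝ) ^ 2 / k) ≤ ε := by
      rw [← le_div_iff₀' hC0pos, div_le_iff₀ hk0]
      calc (p : ℝ) ^ 2 ≤ ε / C0 * (ζ * n) := by rw [← mul_assoc]; exact hpc3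
        _ ≤ _ := by gcongr
    gcongr
  set A : (Fin n → ZMod p) × (Fin (s + r) → ZMod p) → ℝ := fun q =>
    (∏ i, Pr (iidWeight (coin t)) (fun b : Fin (s + r) → Bool =>
      bitDot b (diffA i (Sum.elim q.1 q.2)) = 0)) *
    ∏ j : Fin s, Pr (iidWeight (coin t)) (fun b : Fin n → Bool =>
      bitDot b (diffB (Fin.castAdd r j) (Sum.elim q.1 q.2)) = 0) with hA
  classical
  set Q := (Finset.univ.filter fun q : (Fin n → ZMod p) × (Fin (s + r) → ZMod p) =>
    q ≠ 0 ∧ suppCard q.1 ≤ S) with hQ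
  have hunion : Pr (prodWeight (iidWeight (iidWeight (coin t))) (iidWeight (iidWeight (coin t))))
        (fun z : (Fin n → Fin (s + r) → Bool) × (Fin s → Fin n → Bool) =>
          ∃ q : (Fin n → ZMod p) × (Fin (s + r) → ZMod p), q ≠ 0 ∧ suppCard q.1 ≤ S ∧
            (∀ i, bitDot (z.1 i) (diffA i (Sum.elim q.1 q.2)) = 0) ∧
            ∀ j, bitDot (z.2 j) (diffB (Fin.castAdd r j) (Sum.elim q.1 q.2)) = 0) ≤
      ∑ q ∈ Q, A q := by
    refine le_trans (le_of_eq (Pr_congr fun z => ?_)) ((Pr_exists_le (hν.iid.prod hμ.iid) Q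
      (fun q z => (∀ i, bitDot (z.1 i) (diffA i (Sum.elim q.1 q.2)) = 0) ∧
        ∀ j, bitDot (z.2 j) (diffB (Fin.castAdd r j) (Sum.elim q.1 q.2)) = 0)).trans
          (le_of_eq (Finset.sum_congr rfl fun q _ => ?_)))
    · simp only [hQ, Finset.mem_filter, Finset.mem_univ, true_and, and_assoc]
    · rw [Pr_prod_and (fun a : Fin n → Fin (s + r) → Bool =>
          ∀ i, bitDot (a i) (diffA i (Sum.elim q.1 q.2)) = 0)
        (fun b : Fin s → Fin n → Bool =>
          ∀ j, bitDot (b j) (diffB (Fin.castAdd r j) (Sum.elim q.1 q.2)) = 0),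
        Pr_iid_forall (fun i (b : Fin (s + r) → Bool) =>
          bitDot b (diffA i (Sum.elim q.1 q.2)) = 0),
        Pr_iid_forall (fun j (b : Fin n → Bool) =>
          bitDot b (diffB (Fin.castAdd r j) (Sum.elim q.1 q.2)) = 0)]
  refine hunion.trans ?_
  -- the two weights of the sparse part
  set Φ : (Fin n → ZMod p) → ℝ := fun x =>
    if x = 0 then 1 else smallBall t p (suppCard x) ^ (s - S2) with hΦ
  set Ψ : (Fin (s + r) → ZMod p) → ℝ := fun y =>
    if y = 0 then 1 else smallBall t p (suppCard y) ^ (n - S) with hΨ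
  set X := Finset.univ.filter fun x : Fin n → ZMod p => suppCard x ≤ S with hX
  set Y := Finset.univ.filter fun y : Fin (s + r) → ZMod p => suppCard y ≤ S2 with hY
  have hΦ0 : ∀ x, 0 ≤ Φ x := fun x => by
    simp only [hΦ]; split_ifs; exacts [zero_le_one, pow_nonneg (smallBall_nonneg h0 h1 _ _) _]
  have hΨ0 : ∀ x, 0 ≤ Ψ x := fun x => by
    simp only [hΨ]; split_ifs; exacts [zero_le_one, pow_nonneg (smallBall_nonneg h0 h1 _ _) _]
  set D : (Fin n → ZMod p) × (Fin (s + r) → ZMod p) → ℝ := fun q =>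
    β ^ (n - S) * ∏ j : Fin s, (if q.2 (Fin.castAdd r j) ≠ 0 then β else 1) with hD
  have hD0 : ∀ q, 0 ≤ D q := fun q => mul_nonneg (pow_nonneg hβpos _)
    (Finset.prod_nonneg fun j _ => by split_ifs; exacts [hβpos, zero_le_one])
  have hPrA1 : ∀ q : (Fin n → ZMod p) × (Fin (s + r) → ZMod p), 0 ≤
      ∏ i, Pr (iidWeight (coin t)) (fun b : Fin (s + r) → Bool =>
        bitDot b (diffA i (Sum.elim q.1 q.2)) = 0) :=
    fun q => Finset.prod_nonneg fun i _ => Pr_nonneg hν _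
  have hPrB1 : ∀ q : (Fin n → ZMod p) × (Fin (s + r) → ZMod p), 0 ≤
      ∏ j : Fin s, Pr (iidWeight (coin t)) (fun b : Fin n → Bool =>
      bitDot b (diffB (Fin.castAdd r j) (Sum.elim q.1 q.2)) = 0) :=
    fun q => Finset.prod_nonneg fun i _ => Pr_nonneg hμ _
  -- For sparse y the tests decouple: rows with x i = 0 test y and rows with y j = 0 test x. The
  -- value 1 at zero covers pairs with one vanishing component.
  have hsparse : ∀ q ∈ Q, suppCard q.2 ≤ S2 → A q ≤ Φ q.1 * Ψ q.2 := by
    intro q hq hq2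
    have hq1 : suppCard q.1 ≤ S := (Finset.mem_filter.1 hq).2.2
    have e1 : ∏ i, Pr (iidWeight (coin t)) (fun b : Fin (s + r) → Bool =>
        bitDot b (diffA i (Sum.elim q.1 q.2)) = 0) ≤ Ψ q.2 := by
      simp only [hΨ]
      split_ifs with hy
      · exact Finset.prod_le_one (fun i _ => Pr_nonneg hν _) fun i _ => Pr_le_one hν _
      · exact prod_PrA_le h0.le h1.le _ _ (smallBall_nonneg h0 h1 _ _)
          (smallBall_le_one h0 h1 _ _) hq1 (Pr_le_smallBall h0 h1
            (Nat.pos_of_ne_zero fun h => hy (suppCard_eq_zero_iff.1 h)) le_rfl)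
    have e2 : ∏ j : Fin s, Pr (iidWeight (coin t)) (fun b : Fin n → Bool =>
        bitDot b (diffB (Fin.castAdd r j) (Sum.elim q.1 q.2)) = 0) ≤ Φ q.1 := by
      simp only [hΦ]
      split_ifs with hx
      · exact Finset.prod_le_one (fun i _ => Pr_nonneg hμ _) fun i _ => Pr_le_one hμ _
      · exact prod_PrB_le h0.le h1.le _ _ (smallBall_nonneg h0 h1 _ _)
          (smallBall_le_one h0 h1 _ _) hq2 (Pr_le_smallBall h0 h1
            (Nat.pos_of_ne_zero fun h => hx (suppCard_eq_zero_iff.1 h)) le_rfl)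
    rw [mul_comm (Φ q.1)]
    exact mul_le_mul e1 e2 (hPrB1 q) (hΨ0 _)
  -- For dense y, rows with x i = 0 test y and rows with y j ≠ 0 test x - y j, each at a price β of
  -- order 1/p. The remaining rows are dropped.
  have hdense : ∀ q ∈ Q, ¬ suppCard q.2 ≤ S2 → A q ≤ D q := by
    intro q hq hq2
    have hq1 : suppCard q.1 ≤ S := (Finset.mem_filter.1 hq).2.2
    have hy : ζ * n ≤ suppCard q.2 := by
      have e1 : η * ((s + r : ℕ) : ℝ) < (S2 : ℝ) + 1 := Nat.lt_floor_add_one _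
      have e2 : (S2 : ℝ) + 1 ≤ suppCard q.2 := by exact_mod_cast not_le.1 hq2
      have e3 : ζ * n ≤ η * (θ * n) := by rw [← mul_assoc]; gcongr
      have e4 : η * (θ * n) ≤ η * ((s + r : ℕ) : ℝ) := by
        push_cast; gcongr; linarith
      linarith
    refine mul_le_mul ?_ ?_ (hPrB1 q) (pow_nonneg hβpos _)
    · refine prod_PrA_le h0.le h1.le _ _ hβpos hβ1 hq1 ((Pr_le_smallBall h0 h1 ?_ le_rfl).trans
        (hball _ hy))
      omega
    · refine Finset.prod_le_prod (fun j _ => Pr_nonneg hμ _) fun j _ => ?_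
      split_ifs with hj
      · have e1 := le_suppCard_diffB q.1 q.2 (Fin.castAdd r j) hj hq1
        have e2 : ζ * n ≤ ((n - S : ℕ) : ℝ) := by
          rw [Nat.cast_sub hSn]
          have : ζ * n ≤ 1 / 2 * n := by gcongr
          linarith
        have e3 : 0 < n - S := by
          have : (0 : ℝ) < ((n - S : ℕ) : ℝ) := lt_of_lt_of_le (by positivity) e2
          exact_mod_cast this
        exact (Pr_le_smallBall h0 h1 e3 e1).trans (hball _ e2)
      · exact Pr_le_one hμ _
  have hsplit : ∑ q ∈ Q, A q ≤ ∑ q ∈ (X ×ˢ Y).erase 0, Φ q.1 * Ψ q.2 +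
      ∑ q ∈ X ×ˢ (Finset.univ : Finset (Fin (s + r) → ZMod p)), D q := by
    rw [← Finset.sum_filter_add_sum_filter_not Q (fun q => suppCard q.2 ≤ S2)]
    refine add_le_add ?_ ?_
    · refine (Finset.sum_le_sum fun q hq => hsparse q (Finset.mem_filter.1 hq).1
        (Finset.mem_filter.1 hq).2).trans (Finset.sum_le_sum_of_subset_of_nonneg (fun q hq => ?_)
          fun q _ _ => mul_nonneg (hΦ0 _) (hΨ0 _))
      simp only [hQ, Finset.mem_filter, Finset.mem_univ, true_and] at hq
      simp only [hX, hY, Finset.mem_erase, Finset.mem_product, Finset.mem_filter, Finset.mem_univ,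
        true_and]
      exact ⟨hq.1.1, hq.1.2, hq.2⟩
    · refine (Finset.sum_le_sum fun q hq => hdense q (Finset.mem_filter.1 hq).1
        (Finset.mem_filter.1 hq).2).trans (Finset.sum_le_sum_of_subset_of_nonneg (fun q hq => ?_)
          fun q _ _ => hD0 q)
      simp only [hQ, Finset.mem_filter, Finset.mem_univ, true_and] at hq
      simp only [hX, Finset.mem_product, Finset.mem_filter, Finset.mem_univ, true_and, and_true]
      exact hq.1.2
  refine hsplit.trans ?_
  have hκn1 : Real.exp (-(κ1 * ((s + r : ℕ) : ℝ))) ≤ Real.exp (-(κ * n)) := by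
    refine Real.exp_le_exp.2 (neg_le_neg ?_)
    have e1 : κ * n ≤ κ1 * θ * n := by gcongr; exact min_le_left _ _
    have e2 : κ1 * (θ * n) ≤ κ1 * ((s + r : ℕ) : ℝ) := by push_cast; gcongr; linarith
    linarith
  have hκn2 : Real.exp (-(κ2 * n)) ≤ Real.exp (-(κ * n)) := by
    refine Real.exp_le_exp.2 (neg_le_neg ?_)
    gcongr; exact (min_le_right _ _).trans (min_le_left _ _)
  have hκn3 : Real.exp (-(κ3 * n)) ≤ Real.exp (-(κ * n)) := by
    refine Real.exp_le_exp.2 (neg_le_neg ?_)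
    gcongr; exact (min_le_right _ _).trans (min_le_right _ _)
  have hκ0 : Real.exp (-(κ * n)) ≤ 1 := by
    rw [Real.exp_le_one_iff, neg_nonpos]
    have : 0 < κ := lt_min (by positivity) (lt_min hκ2 hκ3)
    positivity
  set W := Real.exp (-(κ * n)) with hW
  have hW0 : 0 < W := Real.exp_pos _
  have ha : ∑ x ∈ X.erase 0, Φ x ≤ 2 * W := by
    have e : ∑ x ∈ X.erase 0, Φ x = ∑ v ∈ Finset.univ.filter
        (fun v : Fin n → ZMod p => v ≠ 0 ∧ (suppCard v : ℝ) ≤ (S : ℝ)),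
        smallBall t p (suppCard v) ^ (s - S2) := by
      refine Finset.sum_congr ?_ fun x hx => ?_
      · ext x; simp [hX]
      · have : x ≠ 0 := (Finset.mem_filter.1 hx).2.1
        simp [hΦ, this]
    rw [e]
    refine (H2 p hpf n (s - S2) S hpc2 ?_ hS2).trans (by linarith)
    have e1 : η * ((s + r : ℕ) : ℝ) ≤ θ / 2 * n := by
      push_cast; gcongr
    have e2 : S2 ≤ s := by
      have : (S2 : ℝ) ≤ s := by
        have : 0 ≤ θ * n := by positivity
        linarith
      exact_mod_cast this
    rw [Nat.cast_sub e2]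
    linarith
  have hb : ∑ y ∈ Y.erase 0, Ψ y ≤ 2 * W := by
    have e : ∑ y ∈ Y.erase 0, Ψ y = ∑ v ∈ Finset.univ.filter
        (fun v : Fin (s + r) → ZMod p => v ≠ 0 ∧ (suppCard v : ℝ) ≤ (S2 : ℝ)),
        smallBall t p (suppCard v) ^ (n - S) := by
      refine Finset.sum_congr ?_ fun x hx => ?_
      · ext x; simp [hY]
      · have : x ≠ 0 := (Finset.mem_filter.1 hx).2.1
        simp [hΨ, this]
    rw [e]
    refine (H1 p hpf (s + r) (n - S) S2 hpc1 ?_ (hS2le.trans (by gcongr))).trans (by linarith)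
    rw [Nat.cast_sub hSn]
    push_cast
    linarith
  have hsp := sum_erase_zero_mul_le X Y (by simp [hX, suppCard]) (by simp [hY, suppCard]) Φ Ψ
    (by simp [hΦ]) (by simp [hΨ]) rfl rfl
  have ha0 : 0 ≤ ∑ x ∈ X.erase 0, Φ x := Finset.sum_nonneg fun x _ => hΦ0 x
  have hb0 : 0 ≤ ∑ y ∈ Y.erase 0, Ψ y := Finset.sum_nonneg fun x _ => hΨ0 x
  have hab : (∑ x ∈ X.erase 0, Φ x) * (∑ y ∈ Y.erase 0, Ψ y) ≤ 2 * W * 2 := by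
    refine mul_le_mul ha (hb.trans (by linarith)) hb0 (by positivity)
  have hDsum : ∑ q ∈ X ×ˢ (Finset.univ : Finset (Fin (s + r) → ZMod p)), D q ≤ W := by
    refine le_trans ?_ ((H3 p (Fact.out : p.Prime).two_le n s r S β hsr hs hβ0 hβ2 hβ1 hSn
      hS3).trans hκn3)
    have e : ∀ x : Fin n → ZMod p, ∑ y : Fin (s + r) → ZMod p, D (x, y) =
        β ^ (n - S) * ((p : ℝ) ^ r * (1 + (p - 1) * β) ^ s) := by
      intro x
      rw [← sum_prod_dense_le (p := p), Finset.mul_sum]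
    rw [Finset.sum_product, Finset.sum_congr rfl fun x _ => e x, Finset.sum_const, nsmul_eq_mul]
    refine mul_le_mul_of_nonneg_right ?_ ?_
    · have := card_suppCard_le (p := p) n S hh
      simpa [hX] using this
    · rw [← e 0]; exact Finset.sum_nonneg fun y _ => hD0 (0, y)
  rw [hsp]
  linarith

theorem Pr_le_of_cover {X : Type*} [Fintype X] {μ : X → ℝ} (hμ : IsProb μ)
    {G P1 P2 P3 P4 P5 : X → Prop} {e1 e2 e3 e4 e5 : ℝ}
    (h : ∀ x, G x → P1 x ∨ P2 x ∨ P3 x ∨ P4 x ∨ P5 x) (h1 : Pr μ P1 ≤ e1) (h2 : Pr μ P2 ≤ e2)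
    (h3 : Pr μ P3 ≤ e3) (h4 : Pr μ P4 ≤ e4) (h5 : Pr μ P5 ≤ e5) :
    Pr μ G ≤ e1 + e2 + e3 + e4 + e5 := by
  have k1 := Pr_or_le hμ P1 (fun x => P2 x ∨ P3 x ∨ P4 x ∨ P5 x)
  have k2 := Pr_or_le hμ P2 (fun x => P3 x ∨ P4 x ∨ P5 x)
  have k3 := Pr_or_le hμ P3 (fun x => P4 x ∨ P5 x)
  have k4 := Pr_or_le hμ P4 P5
  have k5 := Pr_mono hμ h
  linarith

/-! ### The solution space of the first-part rows -/

section SolutionSpace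

variable {F : Type*} [Field F] {n m : ℕ}

/-- The solutions of the equations given by the rows of the first part. -/
def solA (F : Type*) [Field F] {n m : ℕ} (A : Fin n → Fin m → Bool) :
    Submodule F (Fin n ⊕ Fin m → F) :=
  cut (fun i => diffA i) ⊤ A

theorem diffA_eq (i : Fin n) (w : Fin n ⊕ Fin m → F) :
    diffA i w = (fun j => w (Sum.inr j)) - w (Sum.inl i) • (1 : Fin m → F) := by
  ext j; simp [diffA_apply]

theorem mem_solA {A : Fin n → Fin m → Bool} {w : Fin n ⊕ Fin m → F} :
    w ∈ solA F A ↔ ∀ i, bitDot (A i) (diffA i w) = 0 := by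
  simp [solA, mem_cut]

theorem finrank_solA_ge (A : Fin n → Fin m → Bool) : m ≤ Module.finrank F (solA F A) := by
  have := finrank_cut_add_ge (fun i => diffA i) (⊤ : Submodule F (Fin n ⊕ Fin m → F)) A
  rw [finrank_top, Module.finrank_fintype_fun_eq_card, Fintype.card_sum, Fintype.card_fin,
    Fintype.card_fin] at this
  unfold solA; omega

/-- Project to the second part. The image satisfies the balanced equations; over y = 0 an unbalanced
row forces its own coordinate to vanish, so only balanced rows leave one free. If the balanced
equations are independent, the bound is m and meets `finrank_solA_ge`. -/
theorem finrank_solA_le (A : Fin n → Fin m → Bool) :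
    Module.finrank F (solA F A) ≤
      Module.finrank F (balancedCut (⊤ : Submodule F (Fin m → F)) A) + balancedCount F A := by
  classical
  set T : (Fin n ⊕ Fin m → F) →ₗ[F] (Fin m → F) := LinearMap.funLeft F F Sum.inr with hT
  have hTa : ∀ w j, T w j = w (Sum.inr j) := fun w j => rfl
  rw [← finrank_map_add T (solA F A)]
  refine add_le_add (Submodule.finrank_mono ?_) ?_
  · rintro _ ⟨w, hw, rfl⟩
    refine mem_balancedCut.2 ⟨trivial, fun i hi => ?_⟩
    have h := mem_solA.1 hw i
    rw [diffA_eq, map_sub, map_smul, hi, smul_zero, sub_zero] at h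
    exact h
  · let U := solA F A ⊓ LinearMap.ker T
    let Z := {i // bitDot (A i) (1 : Fin m → F) = 0}
    let f : U →ₗ[F] (Z → F) := (LinearMap.funLeft F F fun i : Z => Sum.inl i.1) ∘ₗ U.subtype
    have hf : Function.Injective f := by
      refine (injective_iff_map_eq_zero f).2 fun w hw => Subtype.ext (funext fun v => ?_)
      have h2 : ∀ j, w.1 (Sum.inr j) = 0 := fun j => congrFun w.2.2 j
      rcases v with i | j
      · by_cases hi : bitDot (A i) (1 : Fin m → F) = 0
        · exact congrFun hw ⟨i, hi⟩
        · have h := mem_solA.1 w.2.1 i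
          rw [diffA_eq, show (fun j => w.1 (Sum.inr j)) = 0 from funext h2, zero_sub, map_neg,
            map_smul, smul_eq_mul, neg_eq_zero] at h
          exact (mul_eq_zero.1 h).resolve_right hi
      · exact h2 j
    have h3 := LinearMap.finrank_le_finrank_of_injective hf
    rw [Module.finrank_fintype_fun_eq_card, Fintype.card_subtype, Finset.card_filter] at h3
    refine h3.trans (le_of_eq ?_)
    unfold balancedCount
    exact Finset.sum_congr rfl fun i _ => by congr

/-- When all differences at inr j vanish, the first part is constant. Subtracting this constant
leaves a second-part vector annihilated by every row of A; the + 1 accounts for the constants. -/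
theorem finrank_solA_inf_ker_le (A : Fin n → Fin m → Bool) (j : Fin m) :
    Module.finrank F ↥(solA F A ⊓ LinearMap.ker (diffB j)) ≤
      Module.finrank F (cut (fun _ => LinearMap.id) (⊤ : Submodule F (Fin m → F)) A) + 1 := by
  set U := solA F A ⊓ LinearMap.ker (diffB j) with hU
  let T : (Fin n ⊕ Fin m → F) →ₗ[F] (Fin m → F) :=
    { toFun := fun w k => w (Sum.inr k) - w (Sum.inr j)
      map_add' := fun w w' => by ext k; simp only [Pi.add_apply]; ring
      map_smul' := fun a w => by ext k; simp [mul_sub] }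
  have hTa : ∀ w k, T w k = w (Sum.inr k) - w (Sum.inr j) := fun w k => rfl
  have hx : ∀ w ∈ U, ∀ i, w (Sum.inl i) = w (Sum.inr j) := by
    intro w hw i
    exact sub_eq_zero.1 (congrFun hw.2 i)
  rw [← finrank_map_add T U]
  refine add_le_add (Submodule.finrank_mono ?_) ?_
  · rintro _ ⟨w, hw, rfl⟩
    refine mem_cut.2 ⟨trivial, fun i => ?_⟩
    have h := mem_solA.1 hw.1 i
    have e : diffA i w = T w := by
      ext k; rw [diffA_apply, hTa, hx w hw i]
    rw [e] at h
    exact h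
  · have : U ⊓ LinearMap.ker T ≤ Submodule.span F {(1 : Fin n ⊕ Fin m → F)} := by
      intro w hw
      refine Submodule.mem_span_singleton.2 ⟨w (Sum.inr j), funext fun v => ?_⟩
      rcases v with i | k
      · simp [hx w hw.1 i]
      · have := sub_eq_zero.1 (congrFun hw.2 k)
        simp [this]
    exact (Submodule.finrank_mono this).trans (by simpa using finrank_span_le_card (R := F) ({(1 : Fin n ⊕ Fin m → F)} : Set _))

theorem Pr_finrank_cut_solA_ne_le {t : ℝ} (h0 : 0 ≤ t) (h1 : t ≤ 1) {s r N2 N : ℕ}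
    (A : Fin n → Fin (s + r) → Bool)
    (hA : Module.finrank F (cut (fun _ => LinearMap.id) (⊤ : Submodule F (Fin (s + r) → F)) A) ≤ N2)
    (hN : s + (N2 + 1) + N ≤ Module.finrank F (solA F A)) :
    Pr (iidWeight (iidWeight (coin t))) (fun B : Fin s → Fin n → Bool =>
      Module.finrank F (cut (fun j => diffB (Fin.castAdd r j)) (solA F A) B) + s ≠
        Module.finrank F (solA F A)) ≤ s * coinMax t ^ N :=
  Pr_finrank_cut_ne_le h0 h1 (fun j : Fin s => diffB (F := F) (Fin.castAdd r j)) (solA F A)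
    (fun _ => (finrank_solA_inf_ker_le A _).trans (Nat.succ_le_succ hA)) hN

end SolutionSpace

/-! ### The good event and the last rows -/

section FinalLaw

variable {p : ℕ} [Fact p.Prime] {n s r : ℕ}

/-- The solutions of the equations given by all rows of the first part and the first `s` rows of
the second part. -/
def solAB (p : ℕ) [Fact p.Prime] {n s r : ℕ}
    (z : (Fin n → Fin (s + r) → Bool) × (Fin s → Fin n → Bool)) :
    Submodule (ZMod p) (Fin n ⊕ Fin (s + r) → ZMod p) :=
  cut (fun j => diffB (Fin.castAdd r j)) (solA (ZMod p) z.1) z.2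

/-- A nonzero solution that is sparse on the first part. -/
def HasSparseSolution (p : ℕ) [Fact p.Prime] (S : ℕ) {n s r : ℕ}
    (z : (Fin n → Fin (s + r) → Bool) × (Fin s → Fin n → Bool)) : Prop :=
  ∃ q : (Fin n → ZMod p) × (Fin (s + r) → ZMod p), q ≠ 0 ∧ suppCard q.1 ≤ S ∧
    (∀ i, bitDot (z.1 i) (diffA i (Sum.elim q.1 q.2)) = 0) ∧
    ∀ j, bitDot (z.2 j) (diffB (Fin.castAdd r j) (Sum.elim q.1 q.2)) = 0

theorem mem_solAB {z : (Fin n → Fin (s + r) → Bool) × (Fin s → Fin n → Bool)}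
    {w : Fin n ⊕ Fin (s + r) → ZMod p} : w ∈ solAB p z ↔
      (∀ i, bitDot (z.1 i) (diffA i w) = 0) ∧
        ∀ j, bitDot (z.2 j) (diffB (Fin.castAdd r j) w) = 0 := by
  rw [solAB, mem_cut, mem_solA]

theorem one_mem_solAB (z : (Fin n → Fin (s + r) → Bool) × (Fin s → Fin n → Bool)) :
    (1 : Fin n ⊕ Fin (s + r) → ZMod p) ∈ solAB p z := by
  have h1 : ∀ i, diffA i (1 : Fin n ⊕ Fin (s + r) → ZMod p) = 0 := fun i => by
    ext j; simp [diffA_apply]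
  have h2 : ∀ j, diffB j (1 : Fin n ⊕ Fin (s + r) → ZMod p) = 0 := fun i => by
    ext j; simp [diffB_apply]
  exact mem_solAB.2 ⟨fun i => by rw [h1, map_zero], fun j => by rw [h2, map_zero]⟩

/-- Without sparse solutions, every solution that is constant near `inr j` on most of the first
part is constant. -/
theorem eq_smul_one_of_suppCard_le {S : ℕ}
    {z : (Fin n → Fin (s + r) → Bool) × (Fin s → Fin n → Bool)} (hz : ¬ HasSparseSolution p S z)
    {w : Fin n ⊕ Fin (s + r) → ZMod p} (hw : w ∈ solAB p z) (j : Fin (s + r))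
    (hS : suppCard (diffB j w) ≤ S) : w = w (Sum.inr j) • (1 : Fin n ⊕ Fin (s + r) → ZMod p) := by
  by_contra hne
  -- Subtracting this constant turns a sparse difference into a solution that is sparse on the first
  -- part.
  have hw' : w - w (Sum.inr j) • (1 : Fin n ⊕ Fin (s + r) → ZMod p) ∈ solAB p z :=
    Submodule.sub_mem _ hw (Submodule.smul_mem _ _ (one_mem_solAB z))
  set w' := w - w (Sum.inr j) • (1 : Fin n ⊕ Fin (s + r) → ZMod p) with hwdef
  have he : Sum.elim (w' ∘ Sum.inl) (w' ∘ Sum.inr) = w' := Sum.elim_comp_inl_inr w'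
  obtain ⟨e1, e2⟩ := mem_solAB.1 hw'
  refine hz ⟨(w' ∘ Sum.inl, w' ∘ Sum.inr), fun h0 => hne ?_, ?_, ?_⟩
  · rw [← sub_eq_zero, ← hwdef, ← he]
    rw [Prod.mk_eq_zero] at h0
    rw [h0.1, h0.2]
    ext v; rcases v with i | k <;> rfl
  · have : w' ∘ Sum.inl = diffB j w := by
      ext i; simp [hwdef, diffB_apply]
    change suppCard (w' ∘ Sum.inl) ≤ S
    rw [this]; exact hS
  · change (∀ i, bitDot (z.1 i) (diffA i (Sum.elim (w' ∘ Sum.inl) (w' ∘ Sum.inr))) = 0) ∧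
      ∀ j, bitDot (z.2 j) (diffB (Fin.castAdd r j) (Sum.elim (w' ∘ Sum.inl) (w' ∘ Sum.inr))) = 0
    rw [he]; exact ⟨e1, e2⟩

/-- The constants are the line killed by every row. The absence of sparse solutions shows both that
nothing else is killed identically and that all other differences have large support. -/
theorem abs_Pr_finrank_final_sub_le {t : ℝ} (h0 : 0 ≤ t) (h1 : t ≤ 1) {R S : ℕ} (k : ℕ)
    {z : (Fin n → Fin (s + (R + 1)) → Bool) × (Fin s → Fin n → Bool)}
    (hz : ¬ HasSparseSolution p S z) (hd : Module.finrank (ZMod p) (solAB p z) = R + 1) :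
    |Pr (iidWeight (iidWeight (coin t))) (fun B : Fin (R + 1) → Fin n → Bool =>
      Module.finrank (ZMod p) (cut (fun j => diffB (Fin.natAdd s j)) (solAB p z) B) = k + 1) -
      uniformCorank (1 / p) k R (R + 1)| ≤ ∑ i ∈ Finset.range (R + 1),
        min (Real.exp (-(8 * (t * (1 - t)) * S / (p : ℝ) ^ 2))) (coinMax t ^ i) := by
  have he0 : (1 : Fin n ⊕ Fin (s + (R + 1)) → ZMod p) ≠ 0 := fun h => by
    have := congrFun h (Sum.inr (Fin.natAdd s 0))
    simp at this
  have he1 : ∀ j : Fin (R + 1),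
      diffB (Fin.natAdd s j) (1 : Fin n ⊕ Fin (s + (R + 1)) → ZMod p) = 0 := by
    intro j; ext i; simp [diffB_apply]
  have hker : ∀ (j : Fin (R + 1)), ∀ w ∈ solAB p z, diffB (Fin.natAdd s j) w = 0 →
      w ∈ Submodule.span (ZMod p) {1} := by
    intro j w hw hjw
    rw [eq_smul_one_of_suppCard_le hz hw (Fin.natAdd s j) (by rw [hjw]; simp [suppCard])]
    exact Submodule.smul_mem _ _ (Submodule.mem_span_singleton_self _)
  have hsupp : ∀ (j : Fin (R + 1)), ∀ w ∈ solAB p z, diffB (Fin.natAdd s j) w ≠ 0 →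
      S ≤ suppCard (diffB (Fin.natAdd s j) w) := by
    intro j w hw hjw
    by_contra hlt
    refine hjw ?_
    rw [eq_smul_one_of_suppCard_le hz hw (Fin.natAdd s j) (by omega)]
    ext i; simp [diffB_apply]
  exact abs_Pr_finrank_cut_sub_le (s := S) (d := R) h0 h1 k
    (fun j : Fin (R + 1) => diffB (F := ZMod p) (Fin.natAdd s j)) (solAB p z) he0
    (one_mem_solAB z) he1 hker hsupp hd le_rfl

/-- The event that the rows of the first part and the first `s` rows of the second part are
independent and have no sparse solution. -/
def IsGood (p : ℕ) [Fact p.Prime] (S : ℕ) {n s r : ℕ}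
    (z : (Fin n → Fin (s + r) → Bool) × (Fin s → Fin n → Bool)) : Prop :=
  ¬ HasSparseSolution p S z ∧ Module.finrank (ZMod p) (solAB p z) = r

/-- Five failures cover the bad event: too many balanced rows, dependent balanced rows, a large
kernel of A, a dependent row among the first s of the second part, a sparse solution. Excluding the
first two fixes the dimension of `solA`; excluding the third gives the nondegeneracy that bounds the
fourth. -/
theorem Pr_not_isGood_le {t : ℝ} (h0 : 0 < t) (h1 : t < 1) {S zc N1 N2 N3 : ℕ} {γ e5 : ℝ}
    (hsr : s + r ≤ n) (hsr0 : 0 < s + r) (hγ0 : 0 ≤ γ) (hγ1 : γ ≤ 1)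
    (hzc : (smallBall t p (s + r) + γ) * n ≤ zc)
    (hN1 : zc + N1 ≤ s + r) (hN23 : N2 + 1 + N3 ≤ r)
    (he5 : Pr (prodWeight (iidWeight (iidWeight (coin t))) (iidWeight (iidWeight (coin t))))
      (HasSparseSolution p S :
        (Fin n → Fin (s + r) → Bool) × (Fin s → Fin n → Bool) → Prop) ≤ e5) :
    Pr (prodWeight (iidWeight (iidWeight (coin t))) (iidWeight (iidWeight (coin t))))
      (fun z : (Fin n → Fin (s + r) → Bool) × (Fin s → Fin n → Bool) => ¬ IsGood p S z) ≤
      Real.exp (-(γ ^ 2 / 4 * n)) + n * coinMax t ^ N1 + n * coinMax t ^ N2 + s * coinMax t ^ N3 +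
        e5 := by
  have hμ := ((isProb_coin h0.le h1.le).iid (ι := Fin (s + r))).iid (ι := Fin n)
  have hν := ((isProb_coin h0.le h1.le).iid (ι := Fin n)).iid (ι := Fin s)
  set M := prodWeight (iidWeight (iidWeight (coin t)) : (Fin n → Fin (s + r) → Bool) → ℝ)
    (iidWeight (iidWeight (coin t)) : (Fin s → Fin n → Bool) → ℝ) with hM
  have hMp : IsProb M := hμ.prod hν
  let P1 : (Fin n → Fin (s + r) → Bool) → Prop := fun A => zc < balancedCount (ZMod p) A
  let P2 : (Fin n → Fin (s + r) → Bool) → Prop := fun A => balancedCount (ZMod p) A ≤ zc ∧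
    Module.finrank (ZMod p) (balancedCut (⊤ : Submodule (ZMod p) (Fin (s + r) → ZMod p)) A) +
      balancedCount (ZMod p) A ≠
      Module.finrank (ZMod p) (⊤ : Submodule (ZMod p) (Fin (s + r) → ZMod p))
  let P3 : (Fin n → Fin (s + r) → Bool) → Prop := fun A => N2 < Module.finrank (ZMod p)
    (cut (fun _ => LinearMap.id) (⊤ : Submodule (ZMod p) (Fin (s + r) → ZMod p)) A)
  let P4 : (Fin n → Fin (s + r) → Bool) × (Fin s → Fin n → Bool) → Prop := fun z =>
    ¬ P1 z.1 ∧ ¬ P2 z.1 ∧ ¬ P3 z.1 ∧ Module.finrank (ZMod p) (solAB p z) + s ≠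
      Module.finrank (ZMod p) (solA (ZMod p) z.1)
  have hdim : ∀ A, ¬ P1 A → ¬ P2 A → Module.finrank (ZMod p) (solA (ZMod p) A) = s + r := by
    intro A hA1 hA2
    have e1 := finrank_solA_ge (F := ZMod p) A
    have e2 := finrank_solA_le (F := ZMod p) A
    simp only [P1, P2, not_and, not_not, not_lt] at hA1 hA2
    have e3 := hA2 hA1
    rw [finrank_top, Module.finrank_fintype_fun_eq_card, Fintype.card_fin] at e3
    omega
  have b1 : Pr M (fun z => P1 z.1) ≤ Real.exp (-(γ ^ 2 / 4 * n)) := by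
    rw [hM, Pr_prod_fst hν]
    refine le_trans (Pr_mono hμ fun A hA => ?_) (Pr_iid_card_le
      ((isProb_coin h0.le h1.le).iid (ι := Fin (s + r)))
      (fun b => bitDot b (1 : Fin (s + r) → ZMod p) = 0) (w := smallBall t p (s + r))
      (Pr_le_smallBall h0 h1 hsr0 (by simp [suppCard])) (smallBall_le_one h0 h1 _ _) hγ0 hγ1)
    refine hzc.trans ?_
    have h2 : balancedCount (ZMod p) A = (Finset.univ.filter fun i =>
        bitDot (A i) (1 : Fin (s + r) → ZMod p) = 0).card := by
      rw [Finset.card_filter]; unfold balancedCount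
      exact Finset.sum_congr rfl fun i _ => by congr
    have h3 : zc ≤ balancedCount (ZMod p) A := le_of_lt hA
    have h4 : (zc : ℝ) ≤ (balancedCount (ZMod p) A : ℝ) := by exact_mod_cast h3
    refine h4.trans (le_of_eq ?_)
    rw [h2]
    congr
  have b2 : Pr M (fun z => P2 z.1) ≤ n * coinMax t ^ N1 := by
    rw [hM, Pr_prod_fst hν]
    refine Pr_finrank_balancedCut_ne_le h0.le h1.le ⊤ ?_
    rw [finrank_top, Module.finrank_fintype_fun_eq_card, Fintype.card_fin]
    exact hN1
  have b3 : Pr M (fun z => P3 z.1) ≤ n * coinMax t ^ N2 := by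
    rw [hM, Pr_prod_fst hν]
    refine Pr_lt_finrank_cut_le h0.le h1.le _ ⊤ (fun _ => LinearMap.ker_id) ?_
    rw [finrank_top, Module.finrank_fintype_fun_eq_card, Fintype.card_fin]
    omega
  have b4 : Pr M P4 ≤ s * coinMax t ^ N3 := by
    have := Pr_prod_le hμ hν (fun _ => True) P4 (ε := s * coinMax t ^ N3)
      (mul_nonneg (Nat.cast_nonneg _) (pow_nonneg (coinMax_pos t).le _)) (fun A _ => ?_)
    · simpa [Pr_false] using this
    · by_cases hA : ¬ P1 A ∧ ¬ P2 A ∧ ¬ P3 A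
      · have hd := hdim A hA.1 hA.2.1
        have hA3 : Module.finrank (ZMod p) (cut (fun _ => LinearMap.id)
            (⊤ : Submodule (ZMod p) (Fin (s + r) → ZMod p)) A) ≤ N2 := not_lt.1 hA.2.2
        have key := Pr_finrank_cut_solA_ne_le h0.le h1.le A hA3 (N := N3) (by rw [hd]; omega)
        exact le_trans (Pr_mono hν fun B hB => hB.2.2.2) key
      · rw [Pr_congr (Q := fun _ => False), Pr_false]
        · exact mul_nonneg (Nat.cast_nonneg _) (pow_nonneg (coinMax_pos t).le _)
        · intro B
          exact iff_of_false (fun h => hA ⟨h.1, h.2.1, h.2.2.1⟩) id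
  have hcover : ∀ z : (Fin n → Fin (s + r) → Bool) × (Fin s → Fin n → Bool), ¬ IsGood p S z →
      P1 z.1 ∨ P2 z.1 ∨ P3 z.1 ∨ P4 z ∨ HasSparseSolution p S z := by
    intro z hz
    by_contra hcon
    push Not at hcon
    obtain ⟨g1, g2, g3, g4, g5⟩ := hcon
    refine hz ⟨g5, ?_⟩
    have hd := hdim z.1 g1 g2
    by_contra hne
    exact g4 ⟨g1, g2, g3, by omega⟩
  exact Pr_le_of_cover hMp hcover b1 b2 b3 b4 he5

/-- The law of the dimension of the solution space of all rows. -/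
theorem abs_Pr_finrank_solution_sub_le {t : ℝ} (h0 : 0 < t) (h1 : t < 1) {R S : ℕ} (k : ℕ)
    {e : ℝ} (he : Pr (prodWeight (iidWeight (iidWeight (coin t))) (iidWeight (iidWeight (coin t))))
      (fun z : (Fin n → Fin (s + (R + 1)) → Bool) × (Fin s → Fin n → Bool) => ¬ IsGood p S z) ≤ e) :
    |Pr (prodWeight (iidWeight (iidWeight (coin t))) (iidWeight (iidWeight (coin t))))
      (fun z : (Fin n → Fin (s + (R + 1)) → Bool) × (Fin (s + (R + 1)) → Fin n → Bool) =>
        Module.finrank (ZMod p) (cut diffB (solA (ZMod p) z.1) z.2) = k + 1) - limitLaw p k| ≤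
      (∑ i ∈ Finset.range (R + 1),
        min (Real.exp (-(8 * (t * (1 - t)) * S / (p : ℝ) ^ 2))) (coinMax t ^ i)) + e +
          32 * (1 / (p : ℝ)) ^ R := by
  have hp := (Fact.out : p.Prime)
  have hμ := ((isProb_coin h0.le h1.le).iid (ι := Fin (s + (R + 1)))).iid (ι := Fin n)
  have hν := ((isProb_coin h0.le h1.le).iid (ι := Fin n)).iid (ι := Fin s)
  have hκ := ((isProb_coin h0.le h1.le).iid (ι := Fin n)).iid (ι := Fin (R + 1))
  have hp1 : (1 : ℝ) < p := by exact_mod_cast hp.one_lt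
  have hp0 : (0 : ℝ) < p := by linarith
  have hx0 : 0 ≤ 1 / (p : ℝ) := by positivity
  have hx1 : 1 / (p : ℝ) ≤ 1 := by rw [div_le_one hp0]; exact hp1.le
  obtain ⟨u0, u1⟩ := uniformCorank_mem hx0 hx1 k R (R + 1)
  -- Regrouping makes the good event depend only on the first factor, with the last R + 1 rows as
  -- fresh randomness.
  have hassoc : Pr (prodWeight (iidWeight (iidWeight (coin t))) (iidWeight (iidWeight (coin t))))
      (fun z : (Fin n → Fin (s + (R + 1)) → Bool) × (Fin (s + (R + 1)) → Fin n → Bool) =>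
        Module.finrank (ZMod p) (cut diffB (solA (ZMod p) z.1) z.2) = k + 1) =
      Pr (prodWeight (prodWeight (iidWeight (iidWeight (coin t))) (iidWeight (iidWeight (coin t))))
        (iidWeight (iidWeight (coin t))))
      (fun y : ((Fin n → Fin (s + (R + 1)) → Bool) × (Fin s → Fin n → Bool)) ×
          (Fin (R + 1) → Fin n → Bool) =>
        Module.finrank (ZMod p)
          (cut (fun j => diffB (Fin.natAdd s j)) (solAB p y.1) y.2) = k + 1) := by
    rw [Pr_prod, Pr_prod, Fintype.sum_prod_type]
    refine Finset.sum_congr rfl fun A _ => ?_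
    simp only [prodWeight, mul_assoc]
    rw [← Finset.mul_sum, Pr_iid_add, Pr_prod]
    refine congrArg _ (Finset.sum_congr rfl fun B _ => congrArg _ (Pr_congr fun C => ?_))
    have : cut diffB (solA (ZMod p) A) (Fin.append B C) =
        cut (fun j => diffB (Fin.natAdd s j)) (solAB p (A, B)) C := by
      ext w
      rw [mem_cut, mem_cut, solAB, mem_cut, and_assoc]
      refine and_congr_right fun _ => ⟨fun h => ⟨fun j => ?_, fun j => ?_⟩, fun h j => ?_⟩
      · simpa using h (Fin.castAdd (R + 1) j)
      · simpa using h (Fin.natAdd s j)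
      · refine Fin.addCases (fun i => ?_) (fun i => ?_) j
        · simpa using h.1 i
        · simpa using h.2 i
    rw [this]
  rw [hassoc]
  have hmain := abs_Pr_prod_sub_le (hμ.prod hν) hκ (IsGood p S)
    (fun y : ((Fin n → Fin (s + (R + 1)) → Bool) × (Fin s → Fin n → Bool)) ×
          (Fin (R + 1) → Fin n → Bool) => Module.finrank (ZMod p)
          (cut (fun j => diffB (Fin.natAdd s j)) (solAB p y.1) y.2) = k + 1) u0 u1
    (ε := ∑ i ∈ Finset.range (R + 1),
        min (Real.exp (-(8 * (t * (1 - t)) * S / (p : ℝ) ^ 2))) (coinMax t ^ i))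
    (Finset.sum_nonneg fun i _ => le_min (Real.exp_pos _).le (pow_nonneg (coinMax_pos t).le _))
    (fun z hz => abs_Pr_finrank_final_sub_le h0.le h1.le k hz.1 hz.2)
  have hlim := abs_uniformCorank_sub_limitLaw_le hp.two_le k R
  refine (abs_sub_le _ _ _).trans (add_le_add (hmain.trans (add_le_add le_rfl he)) hlim)

end FinalLaw

/-! ### Transfer to the random digraph and its Laplacian -/

section Law

variable {n m : ℕ}

/-- An arc configuration as the pair of its two bipartite adjacency arrays. -/
def arcEquiv (n m : ℕ) : (Arc n m → Bool) ≃ (Fin n → Fin m → Bool) × (Fin m → Fin n → Bool) :=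
  (Equiv.sumArrowEquivProdArrow _ _ _).trans
    ((Equiv.curry _ _ _).prodCongr (Equiv.curry _ _ _))

theorem arcEquiv_fst (ω : Arc n m → Bool) (i : Fin n) (j : Fin m) :
    (arcEquiv n m ω).1 i j = ω (Sum.inl (i, j)) := rfl

theorem arcEquiv_snd (ω : Arc n m → Bool) (j : Fin m) (i : Fin n) :
    (arcEquiv n m ω).2 j i = ω (Sum.inr (j, i)) := rfl

theorem arcMeasure_real_singleton (q : unitInterval) (ω : Arc n m → Bool) :
    (arcMeasure n m q).real {ω} =
      prodWeight (iidWeight (iidWeight (coin q))) (iidWeight (iidWeight (coin q)))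
        (arcEquiv n m ω) := by
  have h : ∀ b : Bool, (bernoulliMeasure true false q).real {b} = coin q b := by
    intro b
    cases b
    · rw [bernoulliMeasure_real_apply_of_notMem_of_mem q (MeasurableSet.singleton _) (by simp)
        (by simp)]
      simp [coin]
    · rw [bernoulliMeasure_real_apply_of_mem_of_notMem q (MeasurableSet.singleton _) (by simp)
        (by simp)]
      simp [coin]
  rw [Measure.real, arcMeasure, Measure.pi_singleton, ENNReal.toReal_prod]
  have h' : ∀ a, ((bernoulliMeasure true false q) {ω a}).toReal = coin q (ω a) := fun a => h _
  rw [Finset.prod_congr rfl fun a _ => h' a]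
  rw [Fintype.prod_sum_type, Fintype.prod_prod_type, Fintype.prod_prod_type]
  rfl

theorem integral_arcMeasure (q : unitInterval) (f : (Arc n m → Bool) → ℝ) :
    ∫ ω, f ω ∂(arcMeasure n m q) =
      ∑ z, prodWeight (iidWeight (iidWeight (coin q))) (iidWeight (iidWeight (coin q))) z *
        f ((arcEquiv n m).symm z) := by
  have : IsProbabilityMeasure (arcMeasure n m q) := by unfold arcMeasure; infer_instance
  rw [integral_fintype Integrable.of_finite, ← (arcEquiv n m).sum_comp]
  refine Finset.sum_congr rfl fun ω _ => ?_
  rw [arcMeasure_real_singleton, Equiv.symm_apply_apply, smul_eq_mul]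

theorem arcMeasure_real_eq (q : unitInterval) (P : (Arc n m → Bool) → Prop) :
    (arcMeasure n m q).real {ω | P ω} =
      Pr (prodWeight (iidWeight (iidWeight (coin q))) (iidWeight (iidWeight (coin q))))
        (fun z => P ((arcEquiv n m).symm z)) := by
  classical
  rw [← integral_indicator_one (Set.toFinite _).measurableSet]
  have := integral_arcMeasure (n := n) (m := m) q ({ω | P ω}.indicator 1)
  rw [this, Pr_eq_sum]
  refine Finset.sum_congr rfl fun z _ => ?_
  simp [Set.indicator_apply]

end Law

section Kernel

theorem modMatrix_laplacian_mulVec {V : Type*} [Fintype V] [DecidableEq V] (p : ℕ)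
    (G : Digraph V) (w : V → ZMod p) (u : V) :
    (modMatrix p (laplacian G)).mulVec w u =
      ∑ v, (adjacency G u v : ZMod p) * (w v - w u) := by
  simp only [Matrix.mulVec, dotProduct, modMatrix, laplacian, Matrix.map_apply, Matrix.sub_apply,
    Int.cast_sub, sub_mul, mul_sub, Finset.sum_sub_distrib, Matrix.diagonal_apply]
  congr 1
  rw [Finset.sum_eq_single u (fun v _ hv => by rw [if_neg (Ne.symm hv)]; simp) (by simp),
    if_pos rfl, Int.cast_sum, Finset.sum_mul]

theorem corank_eq_finrank_ker {V : Type*} [Fintype V] [DecidableEq V] {F : Type*} [Field F]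
    (A : Matrix V V F) : corank A = Module.finrank F (LinearMap.ker A.mulVecLin) := by
  have h := LinearMap.finrank_range_add_finrank_ker A.mulVecLin
  rw [Module.finrank_fintype_fun_eq_card] at h
  unfold corank Matrix.rank
  omega

variable {n m p : ℕ} [Fact p.Prime]

theorem ker_modMatrix_laplacian (ω : Arc n m → Bool) :
    LinearMap.ker (modMatrix p (laplacian (bipartiteDigraph ω))).mulVecLin =
      cut diffB (solA (ZMod p) (arcEquiv n m ω).1) (arcEquiv n m ω).2 := by
  have hll : ∀ i i', adjacency (bipartiteDigraph ω) (Sum.inl i) (Sum.inl i') = 0 := fun i i' => by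
    simp [adjacency, bipartiteDigraph]
  have hrr : ∀ j j', adjacency (bipartiteDigraph ω) (Sum.inr j) (Sum.inr j') = 0 := fun j j' => by
    simp [adjacency, bipartiteDigraph]
  have hlr : ∀ i j, adjacency (bipartiteDigraph ω) (Sum.inl i) (Sum.inr j) =
      if (arcEquiv n m ω).1 i j then 1 else 0 := fun i j => by
    simp only [adjacency, bipartiteDigraph, arcEquiv_fst, Matrix.of_apply]
    congr
  have hrl : ∀ j i, adjacency (bipartiteDigraph ω) (Sum.inr j) (Sum.inl i) =
      if (arcEquiv n m ω).2 j i then 1 else 0 := fun j i => by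
    simp only [adjacency, bipartiteDigraph, arcEquiv_snd, Matrix.of_apply]
    congr
  ext w
  rw [mem_cut, mem_solA, LinearMap.mem_ker, Matrix.mulVecLin_apply, funext_iff, Sum.forall]
  refine and_congr (forall_congr' fun i => ?_) (forall_congr' fun j => ?_)
  · rw [modMatrix_laplacian_mulVec, Fintype.sum_sum_type, bitDot_apply, Pi.zero_apply]
    simp [hll, hlr, diffA_apply]
  · rw [modMatrix_laplacian_mulVec, Fintype.sum_sum_type, bitDot_apply, Pi.zero_apply]
    simp [hrr, hrl, diffB_apply]

theorem corank_modMatrix_laplacian (ω : Arc n m → Bool) :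
    corank (modMatrix p (laplacian (bipartiteDigraph ω))) =
      Module.finrank (ZMod p)
        (cut diffB (solA (ZMod p) (arcEquiv n m ω).1) (arcEquiv n m ω).2) := by
  rw [corank_eq_finrank_ker, ker_modMatrix_laplacian]

end Kernel

/-! ### The p-rank is at most the corank -/

section PRank

variable {V : Type*} [Fintype V]

theorem mem_zeroSum {x : V → ℤ} : x ∈ zeroSum V ↔ ∑ v, x v = 0 := by
  simp [zeroSum]

variable [DecidableEq V]

/-- The difference of two coordinate vectors. -/
def singleSub (v v₀ : V) : zeroSum V :=
  ⟨Pi.single v 1 - Pi.single v₀ 1, by simp [mem_zeroSum, Finset.sum_sub_distrib]⟩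

theorem sum_smul_singleSub (v₀ : V) (x : zeroSum V) : ∑ v, x.1 v • singleSub v v₀ = x := by
  refine Subtype.ext ?_
  have h := mem_zeroSum.1 x.2
  rw [Submodule.coe_sum]
  simp only [Submodule.coe_smul, singleSub, smul_sub, Finset.sum_sub_distrib]
  rw [← Finset.sum_smul, h, zero_smul, sub_zero]
  ext u
  simp [Finset.sum_apply, Pi.single_apply]

/-- Sending the basis vector at v to the class of e_v - e_{v₀} maps (ℤ/p)^V onto Γ/pΓ and agrees
with reduction on zero-sum vectors, so it kills the rows of M. It also kills the basis vector at v₀,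
a gain of one that is not needed. -/
theorem pRank_sandpileGroup_le_corank (p : ℕ) [Fact p.Prime] (G : Digraph V) :
    pRank p (SandpileGroup G) ≤ corank (modMatrix p (laplacian G)) := by
  unfold pRank
  rcases isEmpty_or_nonempty V with hV | ⟨⟨v₀⟩⟩
  · have : Subsingleton (SandpileGroup G) := Quotient.instSubsingletonQuotient _
    have : Subsingleton (ModN (SandpileGroup G) p) := Quotient.instSubsingletonQuotient _
    rw [Module.finrank_zero_of_subsingleton]
    exact Nat.zero_le _
  let π : zeroSum V →ₗ[ℤ] ModN (SandpileGroup G) p :=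
    (Submodule.mkQ _) ∘ₗ (Submodule.mkQ _)
  have hπ : Function.Surjective π :=
    (Submodule.mkQ_surjective _).comp (Submodule.mkQ_surjective _)
  let g : (V → ZMod p) →ₗ[ZMod p] ModN (SandpileGroup G) p :=
    (Pi.basisFun (ZMod p) V).constr (ZMod p) fun v => π (singleSub v v₀)
  have hg : ∀ x : zeroSum V, g (fun v => (x.1 v : ZMod p)) = π x := by
    intro x
    rw [Module.Basis.constr_apply_fintype]
    simp only [Pi.basisFun_equivFun, LinearEquiv.refl_apply, Int.cast_smul_eq_zsmul]
    conv_rhs => rw [← sum_smul_singleSub v₀ x, map_sum]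
    exact Finset.sum_congr rfl fun v _ => (map_zsmul π _ _).symm
  have hsurj : LinearMap.range g = ⊤ := by
    refine LinearMap.range_eq_top.2 fun y => ?_
    obtain ⟨x, rfl⟩ := hπ y
    exact ⟨_, hg x⟩
  have hker : Submodule.span (ZMod p) (Set.range (modMatrix p (laplacian G)).row) ≤
      LinearMap.ker g := by
    rw [Submodule.span_le]
    rintro _ ⟨u, rfl⟩
    have hu : (laplacian G).row u ∈ rowLattice G := Submodule.subset_span ⟨u, rfl⟩
    have h := hg ⟨_, rowLattice_le_zeroSum G hu⟩
    have h0 : π ⟨_, rowLattice_le_zeroSum G hu⟩ = 0 := by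
      change Submodule.mkQ _ (Submodule.mkQ _ _) = _
      have h0 : (⟨_, rowLattice_le_zeroSum G hu⟩ : zeroSum V) ∈
          (rowLattice G).submoduleOf (zeroSum V) := hu
      rw [Submodule.mkQ_apply ((rowLattice G).submoduleOf (zeroSum V)),
        (Submodule.Quotient.mk_eq_zero _).2 h0, map_zero]
    exact h.trans h0
  have h1 := LinearMap.finrank_range_add_finrank_ker g
  rw [hsurj, finrank_top, Module.finrank_fintype_fun_eq_card] at h1
  have h2 := Submodule.finrank_mono hker
  rw [← Matrix.rank_eq_finrank_span_row] at h2
  unfold corank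
  omega

end PRank

/-! ### Choice of constants -/

theorem exists_gap_inv_prime {α : ℝ} (h0 : 0 < α) :
    ∃ γ : ℝ, 0 < γ ∧ γ ≤ α ∧ ∀ p : ℕ, p.Prime → 1 / (p : ℝ) < α → 1 / (p : ℝ) + γ ≤ α := by
  classical
  have hex : ∃ N : ℕ, 0 < N ∧ 1 / (N : ℝ) < α := by
    obtain ⟨N, hN⟩ := exists_nat_one_div_lt h0
    exact ⟨N + 1, N.succ_pos, by exact_mod_cast hN⟩
  obtain ⟨hN0, hN⟩ := Nat.find_spec hex
  have hpos : (0 : ℝ) < (Nat.find hex : ℕ) := by exact_mod_cast hN0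
  have : 0 < 1 / ((Nat.find hex : ℕ) : ℝ) := by positivity
  refine ⟨α - 1 / (Nat.find hex : ℕ), by linarith, by linarith, fun p hp hpα => ?_⟩
  have hle : Nat.find hex ≤ p := Nat.find_min' hex ⟨hp.pos, hpα⟩
  have : 1 / (p : ℝ) ≤ 1 / (Nat.find hex : ℕ) :=
    one_div_le_one_div_of_le hpos (by exact_mod_cast hle)
  linarith

/-- Half of the decay rate absorbs the factor n left by a union over the rows. -/
theorem exists_natCast_mul_pow_floor_le {x b : ℝ} (h0 : 0 < x) (h1 : x < 1) (hb : 0 < b) :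
    ∃ K > 0, ∃ a > 0, ∀ n : ℕ, n * x ^ ⌊b * n⌋₊ ≤ K * Real.exp (-(a * n)) := by
  set l := -Real.log x with hl
  have hl0 : 0 < l := by have := Real.log_neg h0 h1; linarith
  refine ⟨2 / (l * b) * Real.exp l, by positivity, l * b / 2, by positivity, fun n => ?_⟩
  have hfl := Nat.lt_floor_add_one (b * n)
  have e1 : x ^ ⌊b * n⌋₊ ≤ Real.exp (l - l * b * n) := by
    rw [← Real.exp_log (pow_pos h0 _), Real.log_pow, Real.exp_le_exp]
    have : Real.log x = -l := by rw [hl, neg_neg]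
    rw [this]
    nlinarith
  have e2 : (n : ℝ) ≤ 2 / (l * b) * Real.exp (l * b / 2 * n) := by
    have := Real.add_one_le_exp (l * b / 2 * n)
    rw [div_mul_eq_mul_div, le_div_iff₀ (by positivity)]
    nlinarith
  calc (n : ℝ) * x ^ ⌊b * n⌋₊
      ≤ 2 / (l * b) * Real.exp (l * b / 2 * n) * Real.exp (l - l * b * n) := by gcongr
    _ = _ := by
      rw [mul_assoc, ← Real.exp_add, mul_assoc _ (Real.exp _), ← Real.exp_add]
      congr 2; ring

/-- Each minimum is at most the geometric mean √(ε x^i). The number of rows disappears at the price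
of halving the exponent in ε. -/
theorem sum_min_pow_le {ε x : ℝ} (hε : 0 ≤ ε) (h0 : 0 ≤ x) (h1 : x < 1) (r : ℕ) :
    ∑ i ∈ Finset.range r, min ε (x ^ i) ≤ 1 / (1 - √x) * √ε := by
  have hs1 : √x < 1 := by rw [Real.sqrt_lt' one_pos]; simpa using h1
  have hs0 := Real.sqrt_nonneg x
  have hterm : ∀ i, min ε (x ^ i) ≤ √ε * √x ^ i := by
    intro i
    have h2 : (√ε * √x ^ i) ^ 2 = ε * x ^ i := by
      rw [mul_pow, Real.sq_sqrt hε, ← pow_mul, mul_comm i 2, pow_mul, Real.sq_sqrt h0]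
    refine le_of_sq_le_sq ?_ (by positivity)
    rw [h2, sq]
    exact mul_le_mul (min_le_left _ _) (min_le_right _ _) (le_min hε (by positivity)) hε
  refine (Finset.sum_le_sum fun i _ => hterm i).trans ?_
  rw [← Finset.mul_sum, mul_comm]
  refine mul_le_mul_of_nonneg_right ?_ (Real.sqrt_nonneg _)
  rw [geom_sum_eq hs1.ne, ← neg_div_neg_eq, neg_sub, neg_sub]
  have : 0 < 1 - √x := by linarith
  gcongr
  have := pow_nonneg hs0 r
  linarith

theorem exists_eq_add_add_one {α : ℝ} {n m : ℕ} (hα : 16 ≤ α * n) (hm : α * n - 1 ≤ m) :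
    ∃ s R : ℕ, m = s + (R + 1) ∧ α / 4 * n ≤ s ∧ α / 8 * n ≤ R := by
  have hm2 : 2 ≤ m := by
    have : (2 : ℝ) ≤ m := by linarith
    exact_mod_cast this
  obtain ⟨s, hs⟩ : ∃ s, s = m / 2 := ⟨_, rfl⟩
  obtain ⟨R, hR⟩ : ∃ R, R + 1 = m - s := ⟨m - s - 1, by omega⟩
  refine ⟨s, R, by omega, ?_, ?_⟩
  · have : m ≤ 2 * s + 1 := by omega
    have : (m : ℝ) ≤ 2 * s + 1 := by exact_mod_cast this
    linarith
  · have : m ≤ 2 * R + 2 := by omega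
    have : (m : ℝ) ≤ 2 * R + 2 := by exact_mod_cast this
    linarith

/-- Applied to the all-ones vector on the second part: a first-part row is balanced with probability
at most 1/p + γ. -/
theorem smallBall_le {t α c γ : ℝ} (h0 : 0 < t) (h1 : t < 1) {p n m : ℕ} (hp : 1 ≤ p)
    (hα : 0 < α) (hαn : 16 ≤ α * n) (hm : α * n - 1 ≤ m) (hpc : (p : ℝ) ^ 2 ≤ c * n)
    (hc : c / (t * (1 - t)) ≤ α * γ) : smallBall t p m ≤ 1 / p + γ := by
  have ht : 0 < t * (1 - t) := mul_pos h0 (by linarith)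
  have hp1 : (1 : ℝ) ≤ p := by exact_mod_cast hp
  have hm0 : (0 : ℝ) < m := by linarith
  refine (min_le_right _ _).trans ?_
  rw [add_div]
  refine add_le_add le_rfl ?_
  have e1 : 1 / (2 * (t * (1 - t))) * ((p : ℝ) ^ 2 / m) ≤ γ := by
    rw [div_mul_div_comm, one_mul, div_le_iff₀ (by positivity)]
    rw [div_le_iff₀ ht] at hc
    have hn : (0 : ℝ) ≤ n := Nat.cast_nonneg n
    have hγ : 0 ≤ γ * (t * (1 - t)) := by
      have : 0 < c * n := lt_of_lt_of_le (by positivity) hpc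
      have hc0 : 0 < c := by
        by_contra hcon; nlinarith
      have : 0 < α * (γ * (t * (1 - t))) := by rw [← mul_assoc]; linarith
      exact (pos_of_mul_pos_right this hα.le).le
    have h2 : c * n ≤ α * γ * (t * (1 - t)) * n := mul_le_mul_of_nonneg_right hc hn
    have h3 : α * n ≤ 2 * m := by linarith
    have h4 := mul_le_mul_of_nonneg_left h3 hγ
    nlinarith
  have e0 : 0 ≤ 1 / (2 * (t * (1 - t))) * ((p : ℝ) ^ 2 / m) := by positivity
  exact (div_le_self e0 hp1).trans e1

section Main

variable {t α : ℝ}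

theorem exists_abs_Pr_finrank_solution_sub_le_mul_exp (h0 : 0 < t) (h1 : t < 1) (hα0 : 0 < α)
    (hα1 : α ≤ 1) :
    ∃ c > 0, ∃ K > 0, ∃ a > 0, ∀ p : ℕ, ∀ _ : Fact p.Prime, 1 / (p : ℝ) < α → ∀ n : ℕ,
      (p : ℝ) ^ 2 ≤ c * n → ∀ m : ℕ, α * n - 1 ≤ m → (m : ℝ) ≤ α * n → ∀ k : ℕ,
      |Pr (prodWeight (iidWeight (iidWeight (coin t))) (iidWeight (iidWeight (coin t))))
        (fun z : (Fin n → Fin m → Bool) × (Fin m → Fin n → Bool) =>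
          Module.finrank (ZMod p) (cut diffB (solA (ZMod p) z.1) z.2) = k + 1) - limitLaw p k| ≤
        K * Real.exp (-(a * (n / (p : ℝ) ^ 2))) := by
  obtain ⟨γ, hγ0, hγα, hgap⟩ := exists_gap_inv_prime hα0
  obtain ⟨δ, hδ, c₀, hc₀, κ, hκ, -, hstr⟩ :=
    exists_structured_bound h0 h1 (θ := α / 4) (by positivity)
  have ht : 0 < t * (1 - t) := mul_pos h0 (by linarith)
  have hx0 := coinMax_pos t
  have hx1 : coinMax t < 1 := max_lt h1 (by linarith)
  obtain ⟨K₁, hK₁, a₁, ha₁, H₁⟩ :=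
    exists_natCast_mul_pow_floor_le hx0 hx1 (b := γ / 4) (by positivity)
  obtain ⟨K₂, hK₂, a₂, ha₂, H₂⟩ :=
    exists_natCast_mul_pow_floor_le hx0 hx1 (b := α / 16) (by positivity)
  obtain ⟨K₃, hK₃, a₃, ha₃, H₃⟩ :=
    exists_natCast_mul_pow_floor_le (x := 1 / 2) (by norm_num) (by norm_num) (b := α / 8)
      (by positivity)
  have hsq1 : √(coinMax t) < 1 := by rw [Real.sqrt_lt' one_pos]; simpa using hx1
  have hK₄ : 0 < 1 / (1 - √(coinMax t)) := one_div_pos.2 (by linarith)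
  -- As p² ≥ 4 forces c n ≥ 4, these bounds give γ n ≥ 8, α n ≥ 16 and δ n ≥ 2, which makes all
  -- roundings harmless.
  obtain ⟨c, hc, hcc₀, hcγ, hcα, hcδ, hcs⟩ : ∃ c : ℝ, 0 < c ∧ c ≤ c₀ ∧ c ≤ γ / 2 ∧ c ≤ α / 4 ∧
      c ≤ 2 * δ ∧ c / (t * (1 - t)) ≤ α * (γ / 4) := by
    refine ⟨min c₀ (min (γ / 2) (min (α / 4) (min (2 * δ) (α * (γ / 4) * (t * (1 - t)))))),
      by positivity, ?_, ?_, ?_, ?_, ?_⟩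
    · simp
    · simp
    · simp
    · simp
    · rw [div_le_iff₀ ht]; simp
  obtain ⟨a, ha, hA₁, hA₂, hA₃, hA₄, hA₅, hA₆⟩ : ∃ a : ℝ, 0 < a ∧ a ≤ a₁ ∧ a ≤ a₂ ∧ a ≤ a₃ ∧
      a ≤ κ ∧ a ≤ (γ / 4) ^ 2 / 4 ∧ a ≤ 2 * (t * (1 - t)) * δ := by
    refine ⟨min a₁ (min a₂ (min a₃ (min κ (min ((γ / 4) ^ 2 / 4) (2 * (t * (1 - t)) * δ))))),
      by positivity, ?_, ?_, ?_, ?_, ?_, ?_⟩ <;> simp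
  refine ⟨c, hc, 1 / (1 - √(coinMax t)) + (1 + K₁ + K₂ + K₂ + 9) + 32 * K₃, by positivity, a, ha,
    fun p hpf hpα n hpc m hm hmα k => ?_⟩
  have hp := hpf.out
  have hp2 : (2 : ℝ) ≤ p := by exact_mod_cast hp.two_le
  have hn : 4 ≤ c * n := le_trans (by linarith [pow_le_pow_left₀ zero_le_two hp2 2]) hpc
  have hn0 : (0 : ℝ) ≤ n := Nat.cast_nonneg n
  have hγn : 8 ≤ γ * n := by linarith [mul_le_mul_of_nonneg_right hcγ hn0]
  have hαn : 16 ≤ α * n := by linarith [mul_le_mul_of_nonneg_right hcα hn0]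
  have hδn : 2 ≤ δ * n := by linarith [mul_le_mul_of_nonneg_right hcδ hn0]
  have hmn : m ≤ n := by
    have : (m : ℝ) ≤ n := hmα.trans (mul_le_of_le_one_left hn0 hα1)
    exact_mod_cast this
  have hn1 : (1 : ℝ) ≤ n := by linarith [mul_le_of_le_one_left hn0 hα1]
  set y : ℝ := n / (p : ℝ) ^ 2 with hy
  have hyn : y ≤ n := div_le_self hn0 (one_le_pow₀ (by linarith))
  have hy0 : 0 ≤ y := by positivity
  have hexp : ∀ b, a ≤ b → Real.exp (-(b * n)) ≤ Real.exp (-(a * y)) := fun b hb =>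
    Real.exp_le_exp.2 (neg_le_neg (mul_le_mul hb hyn hy0 (ha.le.trans hb)))
  have hsb := smallBall_le h0 h1 hp.one_le hα0 hαn hm hpc hcs
  have hg := hgap p hp hpα
  obtain ⟨s, R, rfl, hs, hR⟩ := exists_eq_add_add_one hαn hm
  set S := ⌊δ * n⌋₊ with hS
  have hSle : (S : ℝ) ≤ δ * n := Nat.floor_le (by positivity)
  have hSge : δ * n - 1 < S := by have := Nat.lt_floor_add_one (δ * n); linarith
  have hsp : Pr (prodWeight (iidWeight (iidWeight (coin t))) (iidWeight (iidWeight (coin t))))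
      (fun z : (Fin n → Fin (s + (R + 1)) → Bool) × (Fin s → Fin n → Bool) =>
        HasSparseSolution p S z) ≤ 9 * Real.exp (-(κ * n)) := by
    rw [Pr_congr fun z => Iff.rfl]
    exact hstr p hpf n s (R + 1) S hmn hs (hpc.trans (mul_le_mul_of_nonneg_right hcc₀ hn0)) hSle
  -- A row is balanced with probability at most 1/p + γ/4, and Chernoff adds γ/4. The gap gives 1/p
  -- + γ/2 ≤ α - γ/2, which leaves room for N1 spare dimensions.
  have hgood := Pr_not_isGood_le (p := p) (s := s) (r := R + 1) h0 h1
    (zc := ⌈(α - γ / 2) * n⌉₊) (N1 := ⌊γ / 4 * n⌋₊) (N2 := ⌊α / 16 * n⌋₊) (N3 := ⌊α / 16 * n⌋₊)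
    (γ := γ / 4) hmn (by omega) (by positivity) (by linarith)
    ((mul_le_mul_of_nonneg_right (by linarith) hn0).trans (Nat.le_ceil _))
    (by
      have e1 := Nat.ceil_lt_add_one (a := (α - γ / 2) * n) (mul_nonneg (by linarith) hn0)
      have e2 := Nat.floor_le (a := γ / 4 * n) (by positivity)
      have : ((⌈(α - γ / 2) * n⌉₊ + ⌊γ / 4 * n⌋₊ : ℕ) : ℝ) ≤ ((s + (R + 1) : ℕ) : ℝ) := by
        rw [Nat.cast_add ⌈_⌉₊]; linarith
      exact_mod_cast this)
    (by
      have e2 := Nat.floor_le (a := α / 16 * n) (by positivity)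
      have : ((⌊α / 16 * n⌋₊ + 1 + ⌊α / 16 * n⌋₊ : ℕ) : ℝ) ≤ ((R + 1 : ℕ) : ℝ) := by
        push_cast; linarith
      exact_mod_cast this)
    hsp
  refine (abs_Pr_finrank_solution_sub_le h0 h1 k hgood).trans ?_
  rw [add_mul, add_mul]
  refine add_le_add (add_le_add ?_ ?_) ?_
  · refine (sum_min_pow_le (Real.exp_pos _).le hx0.le hx1 _).trans
      (mul_le_mul_of_nonneg_left ?_ hK₄.le)
    rw [← Real.exp_half, Real.exp_le_exp, neg_div, neg_le_neg_iff, hy, ← mul_div_assoc,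
      div_div, mul_comm ((p : ℝ) ^ 2) 2, ← div_div]
    refine div_le_div_of_nonneg_right ?_ (by positivity)
    have e1 : a * n ≤ 2 * (t * (1 - t)) * δ * n := mul_le_mul_of_nonneg_right hA₆ hn0
    have e2 : δ * n ≤ 2 * S := by linarith
    have e3 := mul_le_mul_of_nonneg_left e2 ht.le
    linarith
  · have f1 := hexp _ hA₅
    have f2 := (H₁ n).trans (mul_le_mul_of_nonneg_left (hexp _ hA₁) hK₁.le)
    have f3 := (H₂ n).trans (mul_le_mul_of_nonneg_left (hexp _ hA₂) hK₂.le)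
    have f4 : (s : ℝ) * coinMax t ^ ⌊α / 16 * n⌋₊ ≤ n * coinMax t ^ ⌊α / 16 * n⌋₊ :=
      mul_le_mul_of_nonneg_right (by exact_mod_cast (by omega : s ≤ n)) (pow_nonneg hx0.le _)
    have f5 := hexp _ hA₄
    linarith
  · rw [mul_assoc]
    refine mul_le_mul_of_nonneg_left ?_ (by norm_num)
    have f1 : (1 / (p : ℝ)) ^ R ≤ (1 / 2) ^ R :=
      pow_le_pow_left₀ (by positivity) (one_div_le_one_div_of_le two_pos hp2) _
    have f2 : ((1 : ℝ) / 2) ^ R ≤ (1 / 2) ^ ⌊α / 8 * n⌋₊ :=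
      pow_le_pow_of_le_one (by norm_num) (by norm_num)
        (Nat.floor_le_of_le hR)
    have f3 : ((1 : ℝ) / 2) ^ ⌊α / 8 * n⌋₊ ≤ n * (1 / 2) ^ ⌊α / 8 * n⌋₊ :=
      le_mul_of_one_le_left (by positivity) hn1
    exact f1.trans (f2.trans (f3.trans ((H₃ n).trans
      (mul_le_mul_of_nonneg_left (hexp _ hA₃) hK₃.le))))

/-- Shrinking c makes n/p² so large that K ≤ exp((a/2) n/p²); halving the rate then removes the
constant K. -/
theorem exists_abs_Pr_finrank_solution_sub_le (h0 : 0 < t) (h1 : t < 1) (hα0 : 0 < α)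
    (hα1 : α ≤ 1) :
    ∃ c > 0, ∃ C > 0, ∀ p : ℕ, ∀ _ : Fact p.Prime, 1 / (p : ℝ) < α → ∀ n : ℕ,
      (p : ℝ) ^ 2 ≤ c * n → ∀ k : ℕ,
      |Pr (prodWeight (iidWeight (iidWeight (coin t))) (iidWeight (iidWeight (coin t))))
        (fun z : (Fin n → Fin ⌊α * n⌋₊ → Bool) × (Fin ⌊α * n⌋₊ → Fin n → Bool) =>
          Module.finrank (ZMod p) (cut diffB (solA (ZMod p) z.1) z.2) = k + 1) - limitLaw p k| ≤
        Real.exp (-(C * n / (p : ℝ) ^ 2)) := by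
  obtain ⟨c, hc, K, hK, a, ha, H⟩ :=
    exists_abs_Pr_finrank_solution_sub_le_mul_exp h0 h1 hα0 hα1
  refine ⟨min c (a / (2 * K)), by positivity, a / 2, by positivity,
    fun p hp hpα n hpc k => ?_⟩
  have hn0 : (0 : ℝ) ≤ n := Nat.cast_nonneg n
  have hp0 : (0 : ℝ) < p := by exact_mod_cast hp.out.pos
  refine (H p hp hpα n (hpc.trans (mul_le_mul_of_nonneg_right (min_le_left _ _) hn0)) _
    (by have := Nat.lt_floor_add_one (α * n); linarith) (Nat.floor_le (by positivity)) k).trans ?_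
  have h2 : (p : ℝ) ^ 2 ≤ a / (2 * K) * n :=
    hpc.trans (mul_le_mul_of_nonneg_right (min_le_right _ _) hn0)
  have h3 : K ≤ a / 2 * (n / (p : ℝ) ^ 2) := by
    rw [← mul_div_assoc, le_div_iff₀ (by positivity)]
    calc K * (p : ℝ) ^ 2 ≤ K * (a / (2 * K) * n) := mul_le_mul_of_nonneg_left h2 hK.le
      _ = a / 2 * n := by field_simp
  calc K * Real.exp (-(a * (n / (p : ℝ) ^ 2)))
      ≤ Real.exp (a / 2 * (n / (p : ℝ) ^ 2)) * Real.exp (-(a * (n / (p : ℝ) ^ 2))) := by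
        refine mul_le_mul_of_nonneg_right ?_ (Real.exp_pos _).le
        have := Real.add_one_le_exp (a / 2 * (n / (p : ℝ) ^ 2))
        linarith
    _ = _ := by
      rw [← Real.exp_add]; congr 1; ring

end Main

/-! ### The expected p-rank -/

theorem sum_mul_natCast_le {X : Type*} [Fintype X] {μ : X → ℝ} (hμ : IsProb μ) {f : X → ℕ} {N : ℕ}
    (hf : ∀ x, f x ≤ N) : ∑ x, μ x * (f x : ℝ) ≤ N := by
  calc ∑ x, μ x * (f x : ℝ) ≤ ∑ x, μ x * (N : ℝ) := Finset.sum_le_sum fun x _ =>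
        mul_le_mul_of_nonneg_left (by exact_mod_cast hf x) (hμ.nonneg x)
    _ = N := by rw [← Finset.sum_mul, hμ.sum_eq, one_mul]

theorem sum_mul_natCast_eq {X : Type*} [Fintype X] (μ : X → ℝ) {f : X → ℕ} {N : ℕ}
    (hf : ∀ x, f x ≤ N) :
    ∑ x, μ x * (f x : ℝ) = ∑ k ∈ Finset.range N, ((k : ℝ) + 1) * Pr μ fun x => f x = k + 1 := by
  classical
  simp only [Pr_eq_sum, Finset.mul_sum]
  rw [Finset.sum_comm]
  refine Finset.sum_congr rfl fun x _ => ?_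
  rcases Nat.eq_zero_or_pos (f x) with h | h
  · rw [h, Nat.cast_zero, mul_zero]
    refine (Finset.sum_eq_zero fun k _ => ?_).symm
    rw [if_neg (by omega), mul_zero]
  · rw [Finset.sum_eq_single (f x - 1)]
    · rw [if_pos (by omega), Nat.cast_sub h]; push_cast; ring
    · intro k _ hk
      rw [if_neg (by omega), mul_zero]
    · intro hk
      exact absurd (Finset.mem_range.2 (by have := hf x; omega)) hk

theorem sum_succ_mul_half_pow_le (N : ℕ) :
    ∑ k ∈ Finset.range N, ((k : ℝ) + 1) * (1 / 2) ^ k ≤ 4 := by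
  have h : ∑ k ∈ Finset.range N, ((k : ℝ) + 1) * (1 / 2) ^ k = 4 - (2 * N + 4) * (1 / 2) ^ N := by
    induction N with
    | zero => norm_num
    | succ N ih => rw [Finset.sum_range_succ, ih]; push_cast; ring
  rw [h]
  have : (0 : ℝ) ≤ (2 * N + 4) * (1 / 2) ^ N := by positivity
  linarith

theorem sq_mul_exp_neg_le {b : ℝ} (hb : 0 < b) (n : ℕ) :
    (2 * (n : ℝ)) ^ 2 * Real.exp (-(b * n)) ≤ (4 / b) ^ 2 := by
  have h1 : 2 * (n : ℝ) ≤ 4 / b * Real.exp (b * n / 2) := by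
    have := Real.add_one_le_exp (b * n / 2)
    rw [div_mul_eq_mul_div, le_div_iff₀ hb]
    linarith
  calc (2 * (n : ℝ)) ^ 2 * Real.exp (-(b * n))
      ≤ (4 / b * Real.exp (b * n / 2)) ^ 2 * Real.exp (-(b * n)) := by gcongr
    _ = _ := by
      rw [mul_pow, ← Real.exp_nat_mul, mul_assoc, ← Real.exp_add]
      have : ((2 : ℕ) : ℝ) * (b * n / 2) + -(b * n) = 0 := by push_cast; ring
      rw [this, Real.exp_zero, mul_one]

/-- The limit law contributes at most 4 ∑ (k + 1) 2^(-k) ≤ 16; the 2n error terms, with weights at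
most 2n, contribute (2n)² e^(-Cn). -/
theorem sum_mul_natCast_le_of_close {X : Type*} [Fintype X] {μ : X → ℝ} {f : X → ℕ} {n p : ℕ}
    {C : ℝ} (hp : 2 ≤ p) (hC : 0 < C) (hf : ∀ x, f x ≤ 2 * n)
    (h : ∀ k, |Pr μ (fun x => f x = k + 1) - limitLaw p k| ≤ Real.exp (-(C * n))) :
    ∑ x, μ x * (f x : ℝ) ≤ 16 + (4 / C) ^ 2 := by
  have hp2 : (2 : ℝ) ≤ p := by exact_mod_cast hp
  rw [sum_mul_natCast_eq μ hf]
  calc ∑ k ∈ Finset.range (2 * n), ((k : ℝ) + 1) * Pr μ (fun x => f x = k + 1)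
      ≤ ∑ k ∈ Finset.range (2 * n),
          (4 * (((k : ℝ) + 1) * (1 / 2) ^ k) + 2 * n * Real.exp (-(C * n))) := by
        refine Finset.sum_le_sum fun k hk => ?_
        have h1 := (abs_le.1 (h k)).2
        have h2 : limitLaw p k ≤ 4 * (1 / 2) ^ k := (limitLaw_le hp k).trans (by gcongr)
        have h3 : (k : ℝ) + 1 ≤ 2 * n := by exact_mod_cast Finset.mem_range.1 hk
        have h4 : Pr μ (fun x => f x = k + 1) ≤ 4 * (1 / 2) ^ k + Real.exp (-(C * n)) := by
          linarith
        calc ((k : ℝ) + 1) * Pr μ (fun x => f x = k + 1)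
            ≤ (k + 1) * (4 * (1 / 2) ^ k + Real.exp (-(C * n))) := by gcongr
          _ = 4 * (((k : ℝ) + 1) * (1 / 2) ^ k) + (k + 1) * Real.exp (-(C * n)) := by ring
          _ ≤ _ := by gcongr
    _ = 4 * ∑ k ∈ Finset.range (2 * n), ((k : ℝ) + 1) * (1 / 2) ^ k +
          (2 * (n : ℝ)) ^ 2 * Real.exp (-(C * n)) := by
        rw [Finset.sum_add_distrib, ← Finset.mul_sum, Finset.sum_const, Finset.card_range,
          nsmul_eq_mul]
        push_cast; ring
    _ ≤ _ := by
        have h1 := sum_succ_mul_half_pow_le (2 * n)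
        have h2 := sq_mul_exp_neg_le hC n
        linarith

section Expectation

variable {n m p : ℕ} [Fact p.Prime]

theorem arcMeasure_real_corank_eq (q : unitInterval) (k : ℕ) :
    (arcMeasure n m q).real
        {ω | corank (modMatrix p (laplacian (bipartiteDigraph ω))) = 1 + k} =
      Pr (prodWeight (iidWeight (iidWeight (coin q))) (iidWeight (iidWeight (coin q))))
        (fun z : (Fin n → Fin m → Bool) × (Fin m → Fin n → Bool) =>
          Module.finrank (ZMod p) (cut diffB (solA (ZMod p) z.1) z.2) = k + 1) := by
  rw [arcMeasure_real_eq]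
  refine Pr_congr fun z => ?_
  rw [corank_modMatrix_laplacian, Equiv.apply_symm_apply, add_comm]

theorem integral_pRank_le (q : unitInterval) :
    ∫ ω, (pRank p (SandpileGroup (bipartiteDigraph ω)) : ℝ) ∂(arcMeasure n m q) ≤
      ∑ z : (Fin n → Fin m → Bool) × (Fin m → Fin n → Bool),
        prodWeight (iidWeight (iidWeight (coin q))) (iidWeight (iidWeight (coin q))) z *
          (Module.finrank (ZMod p) (cut diffB (solA (ZMod p) z.1) z.2) : ℝ) := by
  have hc := isProb_coin q.2.1 q.2.2
  rw [integral_arcMeasure]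
  refine Finset.sum_le_sum fun z _ =>
    mul_le_mul_of_nonneg_left ?_ (((hc.iid).iid.prod (hc.iid).iid).nonneg z)
  have h := pRank_sandpileGroup_le_corank p (bipartiteDigraph ((arcEquiv n m).symm z))
  rw [corank_modMatrix_laplacian, Equiv.apply_symm_apply] at h
  exact_mod_cast h

theorem finrank_solution_le (hmn : m ≤ n)
    (z : (Fin n → Fin m → Bool) × (Fin m → Fin n → Bool)) :
    Module.finrank (ZMod p) (cut diffB (solA (ZMod p) z.1) z.2) ≤ 2 * n := by
  refine (Submodule.finrank_le _).trans ?_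
  rw [Module.finrank_fintype_fun_eq_card, Fintype.card_sum, Fintype.card_fin, Fintype.card_fin]
  omega

end Expectation

end BipartiteSandpile

end

theorem theorem1 (q : unitInterval) (hq0 : 0 < q) (hq1 : q < 1)
    (α : ℝ) (hα0 : 0 < α) (hα1 : α ≤ 1) :
    (∃ c : ℝ, 0 < c ∧ ∃ C : ℝ, 0 < C ∧
      ∀ p : ℕ, p.Prime → 1 / (p : ℝ) < α →
      ∀ n : ℕ, (p : ℝ) ≤ c * Real.sqrt n →
      ∀ k : ℕ, (k : ℝ) ≤ (1 + α) * n →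
        |(BipartiteSandpile.arcMeasure n ⌊α * n⌋₊ q).real
            {ω | BipartiteSandpile.corank (BipartiteSandpile.modMatrix p
              (BipartiteSandpile.laplacian (BipartiteSandpile.bipartiteDigraph ω))) = 1 + k}
          - BipartiteSandpile.limitLaw p k| ≤ Real.exp (-(C * n / (p : ℝ) ^ 2))) ∧
    (∀ p : ℕ, p.Prime → 1 / (p : ℝ) < α →
      ∃ B : ℝ, ∀ n : ℕ,
        ∫ ω, (BipartiteSandpile.pRank p (BipartiteSandpile.SandpileGroup
            (BipartiteSandpile.bipartiteDigraph ω)) : ℝ)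
          ∂(BipartiteSandpile.arcMeasure n ⌊α * n⌋₊ q) ≤ B) := by
  have h0 : (0 : ℝ) < q := hq0
  have h1 : (q : ℝ) < 1 := hq1
  obtain ⟨c, hc, C, hC, H⟩ :=
    BipartiteSandpile.exists_abs_Pr_finrank_solution_sub_le h0 h1 hα0 hα1
  refine ⟨⟨√c, Real.sqrt_pos.2 hc, C, hC, fun p hp hpα n hpn k _ => ?_⟩, fun p hp hpα => ?_⟩
  · have : Fact p.Prime := ⟨hp⟩
    rw [BipartiteSandpile.arcMeasure_real_corank_eq]
    refine H p this hpα n ?_ k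
    calc (p : ℝ) ^ 2 ≤ (√c * √n) ^ 2 := pow_le_pow_left₀ (Nat.cast_nonneg _) hpn 2
      _ = c * n := by rw [mul_pow, Real.sq_sqrt hc.le, Real.sq_sqrt (Nat.cast_nonneg _)]
  · have hpf : Fact p.Prime := ⟨hp⟩
    have hp0 : (0 : ℝ) < p := by exact_mod_cast hp.pos
    have hcoin := BipartiteSandpile.isProb_coin h0.le h1.le
    have hC' : 0 < C / (p : ℝ) ^ 2 := by positivity
    refine ⟨16 + (4 / (C / (p : ℝ) ^ 2)) ^ 2 + 2 * ((p : ℝ) ^ 2 / c), fun n => ?_⟩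
    have hmn : ⌊α * n⌋₊ ≤ n := Nat.floor_le_of_le (mul_le_of_le_one_left (Nat.cast_nonneg _) hα1)
    have hD := BipartiteSandpile.finrank_solution_le (p := p) hmn
    refine (BipartiteSandpile.integral_pRank_le q).trans ?_
    -- Otherwise n < p²/c is bounded in terms of p, and the trivial bound 2n on the corank suffices.
    by_cases hn : (p : ℝ) ^ 2 ≤ c * n
    · refine (BipartiteSandpile.sum_mul_natCast_le_of_close hp.two_le hC' hD fun k => ?_).trans
        (le_add_of_nonneg_right (by positivity))
      rw [div_mul_eq_mul_div]
      exact H p hpf hpα n hn k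
    · refine (BipartiteSandpile.sum_mul_natCast_le (hcoin.iid.iid.prod hcoin.iid.iid) hD).trans ?_
      have : (n : ℝ) ≤ (p : ℝ) ^ 2 / c := by
        rw [le_div_iff₀ hc, mul_comm]; exact (not_le.1 hn).le
      have h3 : 0 ≤ (4 / (C / (p : ℝ) ^ 2)) ^ 2 := by positivity
      push_cast
      linarith
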